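/- **Notation.** Let $\mathcal S^7$ be the unit sphere of $\mathfrak{su}(3)$ for $\langle X|Y\rangle=\mathrm{tr}(X^\dagger Y)$, let $\varpi_1=\frac i3\mathrm{diag}(2,-1,-1)$, $\varpi_2=\frac i3\mathrm{diag}(1,1,-2)$ be the fundamental weights, and let $\overline{\mathcal Q}$ be the set of points $\xi=\sqrt{3/2}\,(x\varpi_1+y\varpi_2)\in\mathcal S^7$ ($x,y\ge 0$) of the closed Weyl chamber that are positively proportional to a dominant weight $p\varpi_1+q\varpi_2$, $p,q\in\mathbb N_0$. These $\xi$ label the rational adjoint orbits $\mathcal O_\xi\subset\mathcal S^7$. The integral radius is $r(\xi)=\min\{R>0: R\xi\text{ is a dominant weight}\}$. A *symbol correspondence* for an irreducible unitary representation $\mathcal H_\omega$ of $SU(3)$ with highest weight $\omega=\|\omega\|\xi$ is an injective linear $SU(3)$-equivariant map $W:\mathcal B(\mathcal H_\omega)\to Poly(\mathcal O_\xi)$ with $W_{A^*}=\overline{W_A}$ and $\int_{\mathcal O_\xi}W_A=\mathrm{tr}(A)/\dim\mathcal H_\omega$ (normalized invariant integral). Composed with the representation $U(\mathfrak{sl}(3))\to\mathcal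 B(\mathcal H_\omega)$ it is a *universal correspondence* for $\omega$; a $\xi$-ray is a sequence $(w^s_\xi)_{s\ge1}$ of universal correspondences for the weights $s\,r(\xi)\,\xi$. The twisted product on the image of $w^s_\xi$ is $w^s_\xi[u]\star^s_\xi w^s_\xi[v]=w^s_\xi[uv]$, with commutator $[\cdot,\cdot]_{\star^s_\xi}$. The Berezin correspondence is $B_A(\mathrm{Ad}_g\xi)=\mathrm{tr}(A\,\Pi^g)$, with $\Pi$ the projection onto the highest weight line and $\Pi^g$ its conjugate by $g$; $b^s_\xi$ is the resulting universal correspondence for $s\,r(\xi)\,\xi$. A *Magoo sphere* consists of a $\xi$-ray for each $\xi\in\overline{\mathcal Q}$ and a chain of finite sets $\mathcal P_1\subsetneq\mathcal P_2\subsetneq\cdots$ with union $\overline{\mathcal Q}$, together with the maps $w^s_n=\sum_{\xi\in\mathcal P_n}\mathfrak d^\xi_n w^s_\xi:U(\mathfrak{sl}(3))\to Poly(\mathcal S^7)/I_{\mathcal P_n}$. Here $I_{\mathcal P_n}$ is the ideal of polynomials vanishing on the orbits of $\mathcal P_n$, and $\mathfrak d^\xi_n=\prod_{\xi'\in\mathcal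 P_n\setminus\{\xi\}}\frac{\tau-\tau(\xi')}{\tau(\xi)-\tau(\xi')}$ with $\tau=6\sqrt6\,i\det$. On the image of $w^s_n$ one has the products $w^s_n[u]\star^s_n w^s_n[v]=w^s_n[uv]$ and the brackets $[w^s_n[u],w^s_n[v]]^r_{\star^s_n}=\sum_{\xi\in\mathcal P_n}\mathfrak d_n^\xi\, r(\xi)\,[w^s_\xi[u],w^s_\xi[v]]_{\star^s_\xi}$. It is *radial* if, with $n_\xi=\min\{n:\xi\in\mathcal P_n\}$, one has $r(\xi)<r(\xi')\iff n_\xi<n_{\xi'}$. It is *of Poisson type* if for all $f_1,f_2\in Poly(\mathcal S^7)$ and all $n$ the classes of $f_1,f_2$ are in the image of $w^s_n$ for all large $s$ and, as $s\to\infty$, $f_1\star^s_n f_2\to f_1f_2$ and $s[f_1,f_2]^r_{\star^s_n}\to i\{f_1,f_2\}$ uniformly on the orbits of $\mathcal P_n$, where $\{\cdot,\cdot\}$ is the Kirillov–Kostant–Souriau bracket. It has the *uniform Poisson property* on $V\subseteq\overline{\mathcal Q}$ if for all $f_1,f_2\in Poly(\mathcal S^7)$ $$\|f_1\star^s_\xi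 f_2-f_1f_2\|_{\infty,\mathcal O_\xi}\quad\text{and}\quad\|s\,r(\xi)[f_1,f_2]_{\star^s_\xi}-i\{f_1,f_2\}\|_{\infty,\mathcal O_\xi}$$ tend to $0$ as $s\to\infty$, uniformly over $\xi\in V$ (for $s\ge s_0$, with $s_0$ such that the restrictions of $f_1,f_2$ to $\mathcal O_\xi$ are in the image of $w^s_\xi$ for all $s\ge s_0$ and all $\xi\in\overline{\mathcal Q}$). **Proposition 4.23.** There exists a (radial) Magoo sphere of Poisson type such that, for every $\xi\in\overline{\mathcal Q}$ and every neighborhood $V$ of $\xi$ in $\overline{\mathcal Q}$, the uniform Poisson property on $V$ fails. Moreover, it can be taken with $w^s_\xi[u]=\left(1+\frac{r(\xi)}{s}\right)b^s_\xi[u]$ for $u$ in any nontrivial irreducible subspace of $U(\mathfrak{sl}(3))$ under the adjoint action, and $w^s_\xi[u]=b^s_\xi[u]$ for $u$ in a trivial one. -/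

import Mathlib

attribute [local instance 100] LieRing.ofAssociativeRing

namespace Magoo

open Filter Topology MeasureTheory

noncomputable section

/-! ### The groups, the Lie algebra, its universal enveloping algebra -/

/-- Complex `3 × 3` matrices; `su(3)` and `sl(3)` are contained in them. -/
abbrev Mat3 : Type := Matrix (Fin 3) (Fin 3) ℂ

/-- The group `SU(3)`. -/
abbrev SU3 : Type := Matrix.specialUnitaryGroup (Fin 3) ℂ

/-- The Lie algebra `sl(3)` over `ℂ`. -/
abbrev Sl3 : Type := LieAlgebra.SpecialLinear.sl (Fin 3) ℂ

/-- The universal enveloping algebra `U(sl(3))`. -/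
abbrev USl3 : Type := UniversalEnvelopingAlgebra ℂ Sl3

instance : IsTopologicalGroup SU3 where
  continuous_inv :=
    Continuous.subtype_mk (continuous_star.comp continuous_subtype_val) _

instance : CompactSpace SU3 := by
  have hK : IsCompact (Set.pi Set.univ fun _ : Fin 3 =>
      Set.pi Set.univ fun _ : Fin 3 => Metric.closedBall (0 : ℂ) 1) :=
    isCompact_univ_pi fun _ => isCompact_univ_pi fun _ => isCompact_closedBall _ _
  have hc : IsClosed ((Matrix.specialUnitaryGroup (Fin 3) ℂ : Set Mat3)) := by
    have h : (Matrix.specialUnitaryGroup (Fin 3) ℂ : Set Mat3)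
        = {A : Mat3 | A * star A = 1} ∩ {A : Mat3 | A.det = 1} := by
      ext A
      simp [Matrix.mem_specialUnitaryGroup_iff, Matrix.mem_unitaryGroup_iff]
    rw [h]
    exact (isClosed_eq (continuous_id.mul continuous_star) continuous_const).inter
      (isClosed_eq (Continuous.matrix_det continuous_id) continuous_const)
  refine isCompact_iff_compactSpace.mp (hK.of_isClosed_subset hc ?_)
  intro A hA i _ j _
  have := entry_norm_bound_of_unitary (Matrix.specialUnitaryGroup_le_unitaryGroup hA) i j
  simpa using this

instance : MeasurableSpace SU3 := borel SU3

instance : BorelSpace SU3 := ⟨rfl⟩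

/-- The normalized Haar measure of `SU(3)`. -/
def haarSU3 : Measure SU3 := Measure.haarMeasure ⊤

/-! ### Adjoint orbits, rational orbits and the integral radius -/

/-- The adjoint action `X ↦ g X g⁻¹`. -/
def Ad (g : SU3) (X : Mat3) : Mat3 := (g : Mat3) * X * ((g⁻¹ : SU3) : Mat3)

/-- The adjoint orbit `𝒪_ξ`. -/
def orbit (ξ : Mat3) : Set Mat3 := Set.range fun g : SU3 => Ad g ξ

/-- The point `Ad_g ξ` of `𝒪_ξ`. -/
def orbitPt (ξ : Mat3) (g : SU3) : orbit ξ := ⟨Ad g ξ, g, rfl⟩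

/-- The element `x ϖ₁ + y ϖ₂` of the Cartan subalgebra of `su(3)`, where `ϖ₁ = (i/3) diag(2,-1,-1)`
and `ϖ₂ = (i/3) diag(1,1,-2)` are the fundamental weights, seen in `su(3)` by means of the inner
product `⟨X|Y⟩ = tr(X† Y)`. -/
def weight (x y : ℝ) : Mat3 :=
  (Complex.I / 3) • Matrix.diagonal
    ![((2 * x + y : ℝ) : ℂ), ((-x + y : ℝ) : ℂ), ((-x - 2 * y : ℝ) : ℂ)]

/-- The dominant weight `ω_(p,q) = p ϖ₁ + q ϖ₂`. -/
def dominantWeight (p q : ℕ) : Mat3 := weight p q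

/-- The intersection `ℱ̄` of the unit sphere `𝒮⁷` of `su(3)` with the closed principal Weyl
chamber: the points `√(3/2) (x ϖ₁ + y ϖ₂)` with `x, y ≥ 0` and `x² + x y + y² = 1`. -/
def Fbar : Set Mat3 :=
  {ξ | ∃ x y : ℝ, 0 ≤ x ∧ 0 ≤ y ∧ x ^ 2 + x * y + y ^ 2 = 1 ∧ ξ = √(3 / 2) • weight x y}

/-- The set `𝒬̄` of rational orbits: the points of `ℱ̄` that are positively proportional to a
dominant weight. -/
def Qbar : Set Mat3 :=
  {ξ | ξ ∈ Fbar ∧ ∃ R : ℝ, 0 < R ∧ ∃ p q : ℕ, R • ξ = dominantWeight p q}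

/-- The integral radius `r(ξ) = min {R > 0 : R ξ is a dominant weight}`. -/
def intRadius (ξ : Mat3) : ℝ :=
  sInf {R : ℝ | 0 < R ∧ ∃ p q : ℕ, R • ξ = dominantWeight p q}

/-! ### Polynomials and the Poisson bracket -/

/-- Complex polynomials in the matrix entries. Restricted to `su(3)` they are the complex
polynomials on `su(3)`, since the entries span the complex linear functions on `su(3)`. -/
abbrev Poly : Type := MvPolynomial (Fin 3 × Fin 3) ℂ

/-- The function given by a polynomial. -/
def polyFun (f : Poly) (X : Mat3) : ℂ := MvPolynomial.eval (fun ij => X ij.1 ij.2) f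

/-- The restriction of a polynomial to a subset. -/
def restr (S : Set Mat3) (f : Poly) : S → ℂ := fun x => polyFun f x

/-- The matrix `D` that represents the differential of `f` at `X` through the trace form:
`df_X(Y) = tr(D Y)`. -/
def gradMat (f : Poly) (X : Mat3) : Mat3 :=
  Matrix.of fun i j => polyFun (MvPolynomial.pderiv (j, i) f) X

/-- The Kirillov–Kostant–Souriau Poisson bracket `{f, h}(X) = tr(X [D_f, D_h])`. On linear functions
`tr(u ·)`, `tr(v ·)` it gives `tr([u, v] ·)`. -/
def poisson (f h : Poly) (X : Mat3) : ℂ :=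
  Matrix.trace (X * (gradMat f X * gradMat h X - gradMat h X * gradMat f X))

/-- The `SU(3)`-invariant cubic polynomial `τ = 6 √6 i det`, which takes the value
`2x³ + 3x²y - 3xy² - 2y³` at `√(3/2) (x ϖ₁ + y ϖ₂)` and separates the points of `ℱ̄`. -/
def tau (X : Mat3) : ℂ := 6 * (√6 : ℝ) * Complex.I * X.det

/-! ### Quark systems and symbol correspondences -/

/-- A quantum quark system with highest weight `ω_(p,q)`: a unitary irreducible representation `U`
of `SU(3)` on `ℂ^dim`, its differential `ρ` extended complex-linearly to `sl(3)`, and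
a highest weight unit vector of weight `(p, q)`. -/
structure QuarkSystem (p q : ℕ) where
  dim : ℕ
  U : SU3 →* Matrix.unitaryGroup (Fin dim) ℂ
  ρ : Sl3 →ₗ⁅ℂ⁆ Matrix (Fin dim) (Fin dim) ℂ
  /-- `U (exp X) = exp (ρ X)` for `X ∈ su(3)`. -/
  U_exp : ∀ (X : Sl3) (g : SU3), star (X : Mat3) = -(X : Mat3) →
    (g : Mat3) = NormedSpace.exp (X : Mat3) →
    (U g : Matrix (Fin dim) (Fin dim) ℂ) = NormedSpace.exp (ρ X)
  irreducible : ∀ K : Submodule ℂ (Fin dim → ℂ),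
    (∀ g : SU3, ∀ v ∈ K, (U g : Matrix (Fin dim) (Fin dim) ℂ).mulVec v ∈ K) → K = ⊥ ∨ K = ⊤
  hw : Fin dim → ℂ
  hw_unit : dotProduct (star hw) hw = 1
  hw_raise : ∀ (i j : Fin 3) (h : i ≠ j), i < j →
    (ρ (LieAlgebra.SpecialLinear.single i j h (1 : ℂ))).mulVec hw = 0
  hw_weight₁ : (ρ (LieAlgebra.SpecialLinear.singleSubSingle 0 1 (1 : ℂ))).mulVec hw = (p : ℂ) • hw
  hw_weight₂ : (ρ (LieAlgebra.SpecialLinear.singleSubSingle 1 2 (1 : ℂ))).mulVec hw = (q : ℂ) • hw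

namespace QuarkSystem

variable {p q : ℕ} (H : QuarkSystem p q)

/-- The algebra `ℬ(ℋ)` of operators. -/
abbrev Op : Type := Matrix (Fin H.dim) (Fin H.dim) ℂ

/-- The representation of `U(sl(3))` on `ℋ`. -/
def rep : USl3 →ₐ[ℂ] H.Op := UniversalEnvelopingAlgebra.lift ℂ H.ρ

/-- `A^g = U(g) A U(g)⁻¹`. -/
def conj (g : SU3) (A : H.Op) : H.Op := (H.U g : H.Op) * A * (H.U g⁻¹ : H.Op)

/-- The orthogonal projection onto the highest weight line. -/
def hwProj : H.Op := Matrix.vecMulVec H.hw (star H.hw)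

/-- `W` is a symbol correspondence `ℬ(ℋ) → Poly(𝒪_ξ)`: it is linear, injective,
`SU(3)`-equivariant, real and normalized. -/
structure IsSymbolCorrespondence (ξ : Mat3) (W : H.Op →ₗ[ℂ] (orbit ξ → ℂ)) : Prop where
  poly : ∀ A, ∃ f : Poly, W A = restr (orbit ξ) f
  injective : Function.Injective W
  equivariant : ∀ (h g : SU3) (A : H.Op), W (H.conj h A) (orbitPt ξ (h * g)) = W A (orbitPt ξ g)
  real : ∀ (A : H.Op) (x : orbit ξ), W (star A) x = star (W A x)
  normalized : ∀ A : H.Op, ∫ g, W A (orbitPt ξ g) ∂haarSU3 = Matrix.trace A / (H.dim : ℂ)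

/-- `B` is the Berezin correspondence `B_A(Ad_g ξ) = tr(A Π^g)`, where `Π` is the projection
onto the highest weight line. -/
def IsBerezin (ξ : Mat3) (B : H.Op →ₗ[ℂ] (orbit ξ → ℂ)) : Prop :=
  ∀ (A : H.Op) (g : SU3), B A (orbitPt ξ g) = Matrix.trace (A * H.conj g H.hwProj)

end QuarkSystem

/-- `w : U(sl(3)) → Poly(𝒪_ξ)` is a universal correspondence for the dominant weight `ω`:
it is `W ∘ ρ_ω` with `W` a symbol correspondence for a quark system of highest weight `ω`. -/
def IsUniversal (ξ ω : Mat3) (w : USl3 →ₗ[ℂ] (orbit ξ → ℂ)) : Prop :=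
  ∃ p q : ℕ, ω = dominantWeight p q ∧ ∃ (H : QuarkSystem p q) (W : H.Op →ₗ[ℂ] (orbit ξ → ℂ)),
    H.IsSymbolCorrespondence ξ W ∧ ∀ u, w u = W (H.rep u)

/-- `b : U(sl(3)) → Poly(𝒪_ξ)` is the universal Berezin correspondence for `ω`. -/
def IsUniversalBerezin (ξ ω : Mat3) (b : USl3 →ₗ[ℂ] (orbit ξ → ℂ)) : Prop :=
  ∃ p q : ℕ, ω = dominantWeight p q ∧ ∃ (H : QuarkSystem p q) (B : H.Op →ₗ[ℂ] (orbit ξ → ℂ)),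
    H.IsBerezin ξ B ∧ ∀ u, b u = B (H.rep u)

/-! ### Twisted products -/

open Classical in
/-- The product induced on the image of a map `w` on `U(sl(3))` by `w[u] ⋆ w[v] = w[u v]`. It is
only meaningful on the image of `w`; outside it is set to zero. -/
def twistedProduct {S : Type*} (w : USl3 →ₗ[ℂ] (S → ℂ)) (f h : S → ℂ) : S → ℂ :=
  if H : (∃ u, w u = f) ∧ (∃ v, w v = h) then w (H.1.choose * H.2.choose) else 0

/-- The commutator of the twisted product. -/
def starComm {S : Type*} (w : USl3 →ₗ[ℂ] (S → ℂ)) (f h : S → ℂ) : S → ℂ :=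
  twistedProduct w f h - twistedProduct w h f

/-- The twisted product of a universal correspondence does not depend on the choices. -/
theorem IsUniversal.twistedProduct_eq {ξ ω : Mat3} {w : USl3 →ₗ[ℂ] (orbit ξ → ℂ)} (hw : IsUniversal ξ ω w)
    (u v : USl3) : twistedProduct w (w u) (w v) = w (u * v) := by
  obtain ⟨p, q, -, H, W, hW, h⟩ := hw
  have key : ∀ a b, w a = w b → H.rep a = H.rep b := fun a b hab =>
    hW.injective (by rw [← h, ← h, hab])
  have H' : (∃ a, w a = w u) ∧ (∃ a, w a = w v) := ⟨⟨u, rfl⟩, ⟨v, rfl⟩⟩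
  have e : twistedProduct w (w u) (w v) = w (H'.1.choose * H'.2.choose) := dif_pos H'
  have k₁ := key _ _ H'.1.choose_spec
  have k₂ := key _ _ H'.2.choose_spec
  rw [e, h (_ * _), h (u * v), map_mul H.rep, map_mul H.rep, k₁, k₂]

/-! ### Chains of finite sets of rational orbits and Magoo spheres -/

/-- A strictly increasing chain of finite subsets of `𝒬̄` that exhausts `𝒬̄`. -/
structure Chain where
  P : ℕ → Finset Qbar
  strict : ∀ n, P n ⊂ P (n + 1)
  exhaust : ∀ ξ : Qbar, ∃ n, ξ ∈ P n

/-- `n_ξ = min {n : ξ ∈ 𝒫_n}`. -/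
def Chain.index (C : Chain) (ξ : Qbar) : ℕ := sInf {n | ξ ∈ C.P n}

/-- The chain is the radial one: rational orbits are added in increasing order of radius. -/
def Chain.IsRadial (C : Chain) : Prop :=
  ∀ ξ ξ' : Qbar, intRadius ξ < intRadius ξ' ↔ C.index ξ < C.index ξ'

/-- The union of the orbits in a finite set `𝒫` of rational orbits. The algebra
`Poly(𝒮⁷) / I_𝒫` is identified with the polynomial functions on this union. -/
def orbitUnion (P : Finset Qbar) : Set Mat3 := {X | ∃ ξ ∈ P, X ∈ orbit (ξ : Mat3)}

open Classical in
/-- The gluing polynomial `𝔡_𝒫^ξ`, equal to `1` on `𝒪_ξ` and to `0` on the other orbits of `𝒫`. -/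
def glue (P : Finset Qbar) (ξ : Qbar) (X : Mat3) : ℂ :=
  (∏ ξ' ∈ P.erase ξ, (tau X - tau ξ')) / ∏ ξ' ∈ P.erase ξ, (tau ξ - tau ξ')

open Classical in
/-- Extension by zero of a function on a subset. It is only multiplied by gluing polynomials, so
that on the orbits of `𝒫` any other extension gives the same products. -/
def extend {S : Set Mat3} (f : S → ℂ) (X : Mat3) : ℂ := if h : X ∈ S then f ⟨X, h⟩ else 0

/-- A Magoo sphere: a chain, and for each rational orbit `ξ` a `ξ`-ray `(w_ξ^s)_{s ≥ 1}` of universal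
correspondences, `w_ξ^s` for the weight `s ω_ξ = s r(ξ) ξ`. The maps, products and brackets of the
Magoo sphere are built from these below. (The value at `s = 0` plays no role.) -/
structure MagooSphere where
  chain : Chain
  w : (ξ : Qbar) → ℕ → USl3 →ₗ[ℂ] (orbit (ξ : Mat3) → ℂ)
  universal : ∀ (ξ : Qbar) (s : ℕ), 1 ≤ s →
    IsUniversal (ξ : Mat3) (((s : ℝ) * intRadius ξ) • (ξ : Mat3)) (w ξ s)

namespace MagooSphere

variable (M : MagooSphere)

/-- The union of the orbits in `𝒫_n`. -/
abbrev X (n : ℕ) : Set Mat3 := orbitUnion (M.chain.P n)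

/-- The pencil `w_n^s[u] = ∑_{ξ ∈ 𝒫_n} 𝔡_n^ξ w_ξ^s[u]`. -/
def pencil (n s : ℕ) : USl3 →ₗ[ℂ] (M.X n → ℂ) where
  toFun u x := ∑ ξ ∈ M.chain.P n, glue (M.chain.P n) ξ x * extend (M.w ξ s u) x
  map_add' u v := by
    funext x
    simp only [Pi.add_apply, ← Finset.sum_add_distrib]
    refine Finset.sum_congr rfl fun ξ _ => ?_
    simp only [extend, map_add]
    split_ifs <;> simp [mul_add]
  map_smul' c u := by
    funext x
    simp only [Pi.smul_apply, smul_eq_mul, RingHom.id_apply, Finset.mul_sum]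
    refine Finset.sum_congr rfl fun ξ _ => ?_
    simp only [extend, map_smul]
    split_ifs
    · simp only [Pi.smul_apply, smul_eq_mul]; ring
    · simp

/-- The Magoo product `⋆_n^s`, with `w_n^s[u] ⋆_n^s w_n^s[v] = w_n^s[u v]`. -/
def prod (n s : ℕ) (f h : M.X n → ℂ) : M.X n → ℂ := twistedProduct (M.pencil n s) f h

open Classical in
/-- The Magoo bracket: for `f = w_n^s[u]` and `h = w_n^s[v]` it is
`∑_{ξ ∈ 𝒫_n} 𝔡_n^ξ r(ξ) [w_ξ^s[u], w_ξ^s[v]]`. Outside the image of `w_n^s` it is set to zero. -/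
def bracket (n s : ℕ) (f h : M.X n → ℂ) : M.X n → ℂ :=
  if H : (∃ u, M.pencil n s u = f) ∧ (∃ v, M.pencil n s v = h) then
    fun x => ∑ ξ ∈ M.chain.P n, glue (M.chain.P n) ξ x * (intRadius ξ : ℂ) *
      extend (starComm (M.w ξ s) (M.w ξ s H.1.choose) (M.w ξ s H.2.choose)) x
  else 0

/-- The Magoo sphere is of Poisson type: for all polynomials `f₁, f₂` on `𝒮⁷` and every `n`, the
products and brackets of `f₁, f₂` modulo `I_{𝒫_n}` are defined for large `s`, and, for `s → ∞`,
`f₁ ⋆_n^s f₂ → f₁ f₂` and `s [f₁, f₂]_n^s → i {f₁, f₂}` uniformly on the orbits of `𝒫_n`. -/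
def IsPoissonType : Prop :=
  ∀ (f₁ f₂ : Poly) (n : ℕ),
    (∃ s₀ : ℕ, ∀ s ≥ s₀, (∃ u, M.pencil n s u = restr (M.X n) f₁) ∧
      (∃ u, M.pencil n s u = restr (M.X n) f₂)) ∧
    TendstoUniformly (fun (s : ℕ) x => M.prod n s (restr (M.X n) f₁) (restr (M.X n) f₂) x)
      (fun x => restr (M.X n) (f₁ * f₂) x) atTop ∧
    TendstoUniformly
      (fun (s : ℕ) x => (s : ℂ) * M.bracket n s (restr (M.X n) f₁) (restr (M.X n) f₂) x)
      (fun x => Complex.I * poisson f₁ f₂ x) atTop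

/-- The uniform Poisson property on a set `V` of rational orbits (for `V = 𝒬̄` this is what makes
a Magoo sphere of Poisson type one of uniform Poisson type): for all polynomials `f₁, f₂` on `𝒮⁷`,
if `s₀` is such that `f₁, f₂` are in the images of all `w_ξ^s` with `s ≥ s₀`, then, for
`s₀ ≤ s → ∞`, the sup norms on `𝒪_ξ` of `f₁ ⋆_ξ^s f₂ - f₁ f₂` and of
`s r(ξ) [f₁, f₂] - i {f₁, f₂}` tend to zero uniformly over `ξ ∈ V`. -/
def IsUniformPoissonOn (V : Set Qbar) : Prop :=
  ∀ (f₁ f₂ : Poly) (s₀ : ℕ),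
    (∀ s ≥ s₀, ∀ ξ : Qbar, (∃ u, M.w ξ s u = restr (orbit (ξ : Mat3)) f₁) ∧
      (∃ u, M.w ξ s u = restr (orbit (ξ : Mat3)) f₂)) →
    TendstoUniformlyOn
      (fun (s : ℕ) (z : (ξ : Qbar) × orbit (ξ : Mat3)) =>
        twistedProduct (M.w z.1 s) (restr (orbit (z.1 : Mat3)) f₁) (restr (orbit (z.1 : Mat3)) f₂) z.2)
      (fun z => restr (orbit (z.1 : Mat3)) (f₁ * f₂) z.2) atTop {z | z.1 ∈ V} ∧
    TendstoUniformlyOn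
      (fun (s : ℕ) (z : (ξ : Qbar) × orbit (ξ : Mat3)) =>
        (s : ℂ) * (intRadius z.1 : ℂ) *
          starComm (M.w z.1 s) (restr (orbit (z.1 : Mat3)) f₁)
            (restr (orbit (z.1 : Mat3)) f₂) z.2)
      (fun z => Complex.I * poisson f₁ f₂ z.2) atTop {z | z.1 ∈ V}

end MagooSphere

/-! ### The rescaled Berezin symbols -/

/-- The infinitesimal adjoint action of `sl(3)` on `U(sl(3))`. -/
def adAct (X : Sl3) (u : USl3) : USl3 :=
  UniversalEnvelopingAlgebra.ι ℂ X * u - u * UniversalEnvelopingAlgebra.ι ℂ X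

/-- The subspace `N` of `U(sl(3))` is invariant under the adjoint action. -/
def IsAdStable (N : Submodule ℂ USl3) : Prop := ∀ (X : Sl3), ∀ u ∈ N, adAct X u ∈ N

/-- The subspace `N` of `U(sl(3))` carries an irreducible representation. -/
def IsAdIrreducible (N : Submodule ℂ USl3) : Prop :=
  IsAdStable N ∧ N ≠ ⊥ ∧ ∀ N' ≤ N, IsAdStable N' → N' = ⊥ ∨ N' = N

/-- The correspondences of the Magoo sphere are the rescaled Berezin ones: `w_ξ^s` is
`(1 + r(ξ)/s) b_ξ^s` on the nontrivial irreducible subspaces of `U(sl(3))`, and `b_ξ^s` on the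
trivial ones, where `b_ξ^s` is the universal Berezin correspondence. Since `U(sl(3))` is spanned by
its irreducible subspaces, this determines `w_ξ^s`. -/
def MagooSphere.IsRescaledBerezin (M : MagooSphere) : Prop :=
  ∀ (ξ : Qbar) (s : ℕ), 1 ≤ s → ∃ b : USl3 →ₗ[ℂ] (orbit (ξ : Mat3) → ℂ),
    IsUniversalBerezin (ξ : Mat3) (((s : ℝ) * intRadius ξ) • (ξ : Mat3)) b ∧
    ∀ N : Submodule ℂ USl3, IsAdIrreducible N →
      ((∀ X : Sl3, ∀ u ∈ N, adAct X u = 0) → ∀ u ∈ N, M.w ξ s u = b u) ∧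
      (¬ (∀ X : Sl3, ∀ u ∈ N, adAct X u = 0) → ∀ u ∈ N,
        M.w ξ s u = ((1 + intRadius ξ / s : ℝ) : ℂ) • b u)

end

end Magoo

namespace Magoo

open Filter Topology MeasureTheory

noncomputable section

set_option linter.unusedSectionVars false

/-! ### Tensor products of `3 × 3` matrices -/

section Kron

open Matrix

variable {ι : Type*} [Fintype ι] [DecidableEq ι]

/-- The tensor product of the matrices `M k`. -/
def kron (M : ι → Mat3) : Matrix (ι → Fin 3) (ι → Fin 3) ℂ :=
  Matrix.of fun I J => ∏ k, M k (I k) (J k)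

theorem kron_apply (M : ι → Mat3) (I J : ι → Fin 3) : kron M I J = ∏ k, M k (I k) (J k) := rfl

theorem kron_mul (M N : ι → Mat3) : kron M * kron N = kron fun k => M k * N k := by
  ext I J
  simp only [kron, Matrix.mul_apply, of_apply, Finset.prod_univ_sum, Finset.prod_mul_distrib,
    Fintype.piFinset_univ]

theorem kron_one : kron (fun _ : ι => (1 : Mat3)) = 1 := by
  ext I J
  simp only [kron_apply, Matrix.one_apply, Finset.prod_ite_zero, Finset.mem_univ, true_imp_iff,
    Finset.prod_const_one, funext_iff]

theorem kron_conjTranspose (M : ι → Mat3) : (kron M)ᴴ = kron fun k => (M k)ᴴ := by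
  ext I J
  simp [kron_apply, Matrix.conjTranspose_apply]

theorem trace_kron (M : ι → Mat3) : trace (kron M) = ∏ k, trace (M k) := by
  simp only [Matrix.trace, Matrix.diag, kron_apply, Finset.prod_univ_sum, Fintype.piFinset_univ]

theorem kron_update_apply (M : ι → Mat3) (k : ι) (Y : Mat3) (I J : ι → Fin 3) :
    kron (Function.update M k Y) I J =
      Y (I k) (J k) * ∏ l ∈ Finset.univ.erase k, M l (I l) (J l) := by
  rw [kron_apply, ← Finset.mul_prod_erase _ _ (Finset.mem_univ k), Function.update_self]
  congr 1
  refine Finset.prod_congr rfl fun l hl => ?_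
  rw [Function.update_of_ne (Finset.ne_of_mem_erase hl)]

/-- The matrix that acts by `Y` on the `k`-th tensor factor. -/
def slot (k : ι) : Mat3 →⋆ₐ[ℂ] Matrix (ι → Fin 3) (ι → Fin 3) ℂ where
  toFun Y := kron (Function.update (fun _ => 1) k Y)
  map_one' := by
    rw [← kron_one]
    congr 1
    exact Function.update_eq_self k _
  map_mul' X Y := by
    rw [kron_mul]
    congr 1
    funext l
    by_cases h : l = k
    · subst h; simp
    · simp [h]
  map_zero' := by
    ext I J
    simp [kron_update_apply]
  map_add' X Y := by
    ext I J
    simp [kron_update_apply, add_mul]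
  commutes' c := by
    ext I J
    rw [kron_update_apply, Algebra.algebraMap_eq_smul_one, Algebra.algebraMap_eq_smul_one,
      ← kron_one, Matrix.smul_apply, Matrix.smul_apply, kron_apply,
      ← Finset.mul_prod_erase _ _ (Finset.mem_univ k), smul_eq_mul, smul_eq_mul, mul_assoc]
  map_star' X := by
    rw [Matrix.star_eq_conjTranspose, Matrix.star_eq_conjTranspose, kron_conjTranspose]
    congr 1
    funext l
    by_cases h : l = k
    · subst h; simp
    · simp [h]

theorem slot_def (k : ι) (Y : Mat3) : slot k Y = kron (Function.update (fun _ => 1) k Y) := rfl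

theorem slot_mul_kron (k : ι) (Y : Mat3) (M : ι → Mat3) :
    slot k Y * kron M = kron (Function.update M k (Y * M k)) := by
  rw [slot_def, kron_mul]
  congr 1
  funext l
  by_cases h : l = k
  · subst h; simp
  · simp [h]

theorem kron_mul_slot (k : ι) (Y : Mat3) (M : ι → Mat3) :
    kron M * slot k Y = kron (Function.update M k (M k * Y)) := by
  rw [slot_def, kron_mul]
  congr 1
  funext l
  by_cases h : l = k
  · subst h; simp
  · simp [h]

theorem slot_comm {k l : ι} (h : k ≠ l) (Y Z : Mat3) : Commute (slot k Y) (slot l Z) := by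
  rw [Commute, SemiconjBy, slot_def l Z, slot_mul_kron, kron_mul_slot]
  congr 1
  funext m
  by_cases hk : m = k
  · subst hk; simp [h]
  · simp [hk]

theorem kron_ite_insert (M : ι → Mat3) (s : Finset ι) {k : ι} (hk : k ∉ s) :
    (kron fun l => if l ∈ insert k s then M l else 1) =
      slot k (M k) * kron fun l => if l ∈ s then M l else 1 := by
  rw [slot_mul_kron]
  congr 1
  funext l
  by_cases h : l = k
  · subst h; simp [hk]
  · simp [h]

open scoped Matrix.Norms.L2Operator in
theorem norm_slot_le (k : ι) (Y : Mat3) : ‖slot k Y‖ ≤ ‖Y‖ :=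
  NonUnitalStarAlgHom.norm_apply_le (slot k) Y

open scoped Matrix.Norms.L2Operator in
theorem norm_kron_le (M : ι → Mat3) : ‖kron M‖ ≤ ∏ k, ‖M k‖ := by
  have h : ∀ s : Finset ι, ‖kron fun l => if l ∈ s then M l else 1‖ ≤ ∏ k ∈ s, ‖M k‖ := by
    intro s
    induction s using Finset.induction_on with
    | empty => simp [kron_one]
    | insert k s hk ih =>
      rw [kron_ite_insert M s hk, Finset.prod_insert hk]
      exact (norm_mul_le _ _).trans
        (mul_le_mul (norm_slot_le k _) ih (norm_nonneg _) (norm_nonneg _))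
  simpa using h Finset.univ

open scoped Matrix.Norms.L2Operator in
theorem exp_slot (k : ι) (Y : Mat3) :
    NormedSpace.exp (slot k Y) = slot k (NormedSpace.exp Y) :=
  letI : NormedAlgebra ℚ Mat3 := NormedAlgebra.restrictScalars ℚ ℂ Mat3
  (NormedSpace.map_exp (slot k) (AddMonoidHomClass.continuous_of_bound (slot k) 1
    fun Z => by simpa using norm_slot_le k Z) Y).symm

open scoped Matrix.Norms.L2Operator in
theorem exp_sum_slot (Z : ι → Mat3) :
    NormedSpace.exp (∑ k, slot k (Z k)) = kron fun k => NormedSpace.exp (Z k) := by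
  have h : ∀ s : Finset ι, NormedSpace.exp (∑ k ∈ s, slot k (Z k)) =
      kron fun l => if l ∈ s then NormedSpace.exp (Z l) else 1 := by
    intro s
    induction s using Finset.induction_on with
    | empty => simp [kron_one]
    | insert k s hk ih =>
      rw [kron_ite_insert (fun l => NormedSpace.exp (Z l)) s hk, Finset.sum_insert hk,
        Matrix.exp_add_of_commute, ih, exp_slot]
      refine Commute.sum_right _ _ _ fun l hl => slot_comm ?_ _ _
      rintro rfl
      exact hk hl
  simpa using h Finset.univ

end Kron

section
open Matrix
open scoped Matrix.Norms.L2Operator in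
theorem exists_exp_eq_of_mem_unitary {U : Mat3} (hU : U ∈ Matrix.unitaryGroup (Fin 3) ℂ) :
    ∃ Y : Mat3, star Y = -Y ∧ NormedSpace.exp Y = U := by
  have hN : IsStarNormal U := ⟨by
    rw [Commute, SemiconjBy, (Matrix.mem_unitaryGroup_iff').1 hU, (Matrix.mem_unitaryGroup_iff).1 hU]⟩
  have hfin : (spectrum ℂ U).Finite := by
    exact Matrix.finite_spectrum U
  have hc : ContinuousOn (fun z : ℂ => Complex.I * Complex.arg z) (spectrum ℂ U) :=
    hfin.continuousOn _
  refine ⟨cfc (fun z : ℂ => Complex.I * Complex.arg z) U, ?_, ?_⟩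
  · rw [← cfc_star, ← cfc_neg]
    congr 1
    funext z
    simp
  · have hn : IsStarNormal (cfc (fun z : ℂ => Complex.I * Complex.arg z) U) := cfc_predicate _ U
    rw [← CFC.complex_exp_eq_normedSpace_exp hn,
      ← cfc_comp' Complex.exp (fun z : ℂ => Complex.I * Complex.arg z) U]
    refine (cfc_congr fun z hz => ?_).trans (cfc_id ℂ U)
    have h1 := spectrum.subset_circle_of_unitary (𝕜 := ℂ) hU hz
    have h2 := Complex.norm_mul_exp_arg_mul_I z
    rw [mem_sphere_zero_iff_norm.1 h1] at h2
    simpa [mul_comm] using h2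

theorem det_exp_of_star_eq_neg {X : Mat3} (hX : star X = -X) :
    (NormedSpace.exp X).det = Complex.exp X.trace := by
  have hH : (Complex.I • X).IsHermitian := by
    rw [Matrix.IsHermitian, Matrix.conjTranspose_smul, ← Matrix.star_eq_conjTranspose, hX]
    simp
  have hs := hH.spectral_theorem
  set V : Matrix.unitaryGroup (Fin 3) ℂ := hH.eigenvectorUnitary
  have hinv : star (V : Mat3) = (V : Mat3)⁻¹ :=
    (Matrix.inv_eq_left_inv ((Matrix.mem_unitaryGroup_iff').1 V.2)).symm
  have hX' : X = (V : Mat3) * Matrix.diagonal (fun i => -Complex.I * hH.eigenvalues i) *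
      (V : Mat3)⁻¹ := by
    have h1 : X = (-Complex.I) • (Complex.I • X) := by
      rw [smul_smul]; simp
    have h2 : Matrix.diagonal (fun i => -Complex.I * (hH.eigenvalues i : ℂ)) =
        (-Complex.I) • Matrix.diagonal (RCLike.ofReal ∘ hH.eigenvalues) := by
      rw [← Matrix.diagonal_smul]
      rfl
    rw [h2, mul_smul_comm, smul_mul_assoc, ← hinv]
    conv_lhs => rw [h1, hs, Unitary.conjStarAlgAut_apply]
  have hV : IsUnit (V : Mat3) := ⟨⟨V, star (V : Mat3), (Matrix.mem_unitaryGroup_iff).1 V.2,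
    (Matrix.mem_unitaryGroup_iff').1 V.2⟩, rfl⟩
  have e : NormedSpace.exp X = (V : Mat3) * Matrix.diagonal
      (fun i => Complex.exp (-Complex.I * hH.eigenvalues i)) * (V : Mat3)⁻¹ := by
    conv_lhs => rw [hX', Matrix.exp_conj _ _ hV, Matrix.exp_diagonal]
    congr 3
    funext i
    simp [Complex.exp_eq_exp_ℂ]
  rw [e, Matrix.det_conj hV, Matrix.det_diagonal, ← Complex.exp_sum, ← Finset.mul_sum]
  have ht := hH.trace_eq_sum_eigenvalues
  rw [Matrix.trace_smul] at ht
  have ht' : X.trace = -Complex.I * (Complex.I • X.trace) := by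
    rw [smul_eq_mul, ← mul_assoc]; simp
  rw [ht', ht]
  rfl

/-- The one-parameter subgroup of `SU(3)` generated by an element of `su(3)`. -/
def expSU3 (X : Mat3) (hX : star X = -X) (ht : X.trace = 0) : SU3 :=
  ⟨NormedSpace.exp X, by
    rw [Matrix.mem_specialUnitaryGroup_iff, det_exp_of_star_eq_neg hX, ht, Complex.exp_zero]
    refine ⟨?_, rfl⟩
    rw [Matrix.mem_unitaryGroup_iff, NormedSpace.star_exp, hX,
      ← Matrix.exp_add_of_commute _ _ ((Commute.refl X).neg_right)]
    simp⟩

section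
variable {n : Type*} [Fintype n] [DecidableEq n]
open scoped Matrix.Norms.L2Operator in
theorem hasDerivAt_exp_conj (X B : Matrix n n ℂ) (φ : Matrix n n ℂ →ₗ[ℂ] ℂ) :
    HasDerivAt (fun t : ℝ => φ (NormedSpace.exp (t • X) * B * NormedSpace.exp (t • (-X))))
      (φ (X * B - B * X)) 0 := by
  have h : ∀ Y : Matrix n n ℂ, HasDerivAt (fun t : ℝ => NormedSpace.exp (t • Y)) Y 0 := fun Y => by
    simpa using hasDerivAt_exp_smul_const (𝕂 := ℝ) Y (0 : ℝ)
  have h2 := ((h X).mul_const B).mul (h (-X))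
  have h3 := ((LinearMap.toContinuousLinearMap (φ.restrictScalars ℝ)).hasFDerivAt).comp_hasDerivAt
    (0 : ℝ) h2
  refine h3.congr_deriv ?_
  change φ _ = φ _
  simp [sub_eq_add_neg]
open scoped Matrix.Norms.L2Operator in
theorem hasDerivAt_exp_mulVec (X : Matrix n n ℂ) (v : n → ℂ) (φ : (n → ℂ) →ₗ[ℂ] ℂ) :
    HasDerivAt (fun t : ℝ => φ (Matrix.mulVec (NormedSpace.exp (t • X)) v))
      (φ (Matrix.mulVec X v)) 0 := by
  have h : HasDerivAt (fun t : ℝ => NormedSpace.exp (t • X)) X 0 := by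
    simpa using hasDerivAt_exp_smul_const (𝕂 := ℝ) X (0 : ℝ)
  let ψ : Matrix n n ℂ →ₗ[ℂ] ℂ := φ ∘ₗ (Matrix.mulVecBilin ℂ ℂ).flip v
  exact ((LinearMap.toContinuousLinearMap (ψ.restrictScalars ℝ)).hasFDerivAt).comp_hasDerivAt
    (0 : ℝ) h
end
end
theorem exists_isometry {ι : Type*} [Fintype ι] (K : Submodule ℂ (ι → ℂ)) :
    ∃ (d : ℕ) (J : Matrix ι (Fin d) ℂ), Matrix.conjTranspose J * J = 1 ∧
      ∀ v, v ∈ K ↔ ∃ w, J.mulVec w = v := by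
  let K' : Submodule ℂ (EuclideanSpace ℂ ι) := K.comap (WithLp.linearEquiv 2 ℂ (ι → ℂ)).toLinearMap
  let b := stdOrthonormalBasis ℂ K'
  refine ⟨_, Matrix.of fun i j => (b j : EuclideanSpace ℂ ι) i, ?_, fun v => ⟨fun hv => ?_, ?_⟩⟩
  · ext i j
    have := orthonormal_iff_ite.1 b.orthonormal i j
    rw [Submodule.coe_inner, PiLp.inner_apply] at this
    simp only [Matrix.mul_apply, Matrix.conjTranspose_apply, Matrix.of_apply, Matrix.one_apply]
    rw [← this]
    refine Finset.sum_congr rfl fun x _ => ?_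
    simp [mul_comm]
  · let v' : K' := ⟨WithLp.toLp 2 v, hv⟩
    refine ⟨fun j => b.repr v' j, ?_⟩
    have := congrArg (fun z : K' => (z : EuclideanSpace ℂ ι)) (b.sum_repr v')
    funext i
    have := congrArg (fun z : EuclideanSpace ℂ ι => z i) this
    simp [v'] at this
    simp [Matrix.mulVec, dotProduct]
    rw [← this]
    refine Finset.sum_congr rfl fun x _ => ?_
    ring
  · rintro ⟨w, rfl⟩
    have : (Matrix.of fun i j => (b j : EuclideanSpace ℂ ι) i).mulVec w =
      ∑ j, w j • (WithLp.linearEquiv 2 ℂ (ι → ℂ)) (b j : EuclideanSpace ℂ ι) := by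
      funext i
      simp [Matrix.mulVec, dotProduct, mul_comm]
    rw [this]
    exact Submodule.sum_mem _ fun j _ => K.smul_mem _ (b j).2

/-! ### The representations on mixed tensors -/

section Tensors

open Matrix

/-- The tensor slots: `n true` vector slots and `n false` covector slots. -/
abbrev Idx (n : Bool → ℕ) : Type := (b : Bool) × Fin (n b)

/-- The action of a unitary matrix on a vector, resp. covector slot. -/
def slotGrp (b : Bool) (g : Mat3) : Mat3 := if b then g else gᴴᵀ

/-- The infinitesimal action on a vector, resp. covector slot. -/
def slotLie (b : Bool) : Mat3 →ₗ[ℂ] Mat3 where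
  toFun X := if b then X else -Xᵀ
  map_add' X Y := by cases b <;> simp [add_comm]
  map_smul' c X := by cases b <;> simp

/-- The highest weight vector of a slot. -/
def slotBase (b : Bool) : Fin 3 := if b then 0 else 2

theorem slotGrp_mul (b : Bool) (g h : Mat3) : slotGrp b (g * h) = slotGrp b g * slotGrp b h := by
  cases b <;> simp [slotGrp]

theorem slotGrp_one (b : Bool) : slotGrp b 1 = 1 := by
  cases b <;> simp [slotGrp]

theorem slotGrp_star (b : Bool) (g : Mat3) : slotGrp b gᴴ = (slotGrp b g)ᴴ := by
  cases b
  · simp only [slotGrp, Bool.false_eq_true, if_false]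
    ext i j
    simp [Matrix.conjTranspose_apply]
  · simp [slotGrp]

theorem slotLie_star (b : Bool) (X : Mat3) : slotLie b Xᴴ = (slotLie b X)ᴴ := by
  cases b <;> simp [slotLie]
  rfl

theorem slotLie_mul_sub (b : Bool) (X Y : Mat3) :
    slotLie b (X * Y - Y * X) = slotLie b X * slotLie b Y - slotLie b Y * slotLie b X := by
  cases b <;> simp [slotLie]

theorem slotLie_exp (b : Bool) {X : Mat3} (hX : star X = -X) :
    NormedSpace.exp (slotLie b X) = slotGrp b (NormedSpace.exp X) := by
  cases b
  · have : slotLie false X = Xᴴᵀ := by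
      rw [← Matrix.star_eq_conjTranspose, hX]; simp [slotLie]
    rw [this, Matrix.exp_transpose, Matrix.exp_conjTranspose]
    simp [slotGrp]
  · simp [slotLie, slotGrp]

/-- The diagonal entries of `slotLie b (diagonal d)`. -/
def slotDiag (b : Bool) (d : Fin 3 → ℂ) (i : Fin 3) : ℂ := if b then d i else -d i

theorem slotLie_diagonal (b : Bool) (d : Fin 3 → ℂ) :
    slotLie b (diagonal d) = diagonal (slotDiag b d) := by
  cases b
  · simp [slotLie, slotDiag]
  · simp [slotLie, slotDiag]

theorem slot_diagonal {ι : Type*} [Fintype ι] [DecidableEq ι] (k : ι) (e : Fin 3 → ℂ) :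
    slot k (diagonal e) = diagonal fun I => e (I k) := by
  ext I J
  rw [slot_def, kron_update_apply]
  by_cases h : I = J
  · subst h; simp
  · rw [Matrix.diagonal_apply_ne _ h]
    by_cases hk : I k = J k
    · obtain ⟨l, hl⟩ := Function.ne_iff.1 h
      rw [Finset.prod_eq_zero (i := l), mul_zero]
      · refine Finset.mem_erase.2 ⟨?_, Finset.mem_univ _⟩
        rintro rfl
        exact hl hk
      · exact Matrix.one_apply_ne hl
    · rw [Matrix.diagonal_apply_ne _ hk, zero_mul]

theorem mem_sl {X : Mat3} : X ∈ LieAlgebra.SpecialLinear.sl (Fin 3) ℂ ↔ X.trace = 0 := Iff.rfl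

variable (n : Bool → ℕ)

/-- The tensor representation of the unitary group. -/
def tensGrp (g : Mat3) : Matrix (Idx n → Fin 3) (Idx n → Fin 3) ℂ :=
  kron fun k : Idx n => slotGrp k.1 g

/-- The infinitesimal tensor representation. -/
def tensLie : Mat3 →ₗ[ℂ] Matrix (Idx n → Fin 3) (Idx n → Fin 3) ℂ where
  toFun X := ∑ k : Idx n, slot k (slotLie k.1 X)
  map_add' X Y := by simp [Finset.sum_add_distrib]
  map_smul' c X := by simp [Finset.smul_sum]

/-- The index of the highest weight vector among the standard basis. -/
def tensBase : Idx n → Fin 3 := fun k => slotBase k.1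

/-- The highest weight vector. -/
def tensHw : (Idx n → Fin 3) → ℂ := Pi.single (tensBase n) 1

theorem tensLie_apply (X : Mat3) : tensLie n X = ∑ k : Idx n, slot k (slotLie k.1 X) := rfl

theorem tensGrp_mul (g h : Mat3) : tensGrp n (g * h) = tensGrp n g * tensGrp n h := by
  simp only [tensGrp, kron_mul, slotGrp_mul]

theorem tensGrp_one : tensGrp n 1 = 1 := by
  simp only [tensGrp, slotGrp_one, kron_one]

theorem tensGrp_star (g : Mat3) : tensGrp n gᴴ = (tensGrp n g)ᴴ := by
  simp only [tensGrp, kron_conjTranspose, slotGrp_star]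

theorem tensLie_star (X : Mat3) : tensLie n Xᴴ = (tensLie n X)ᴴ := by
  simp only [tensLie_apply, slotLie_star, Matrix.conjTranspose_sum]
  refine Finset.sum_congr rfl fun k _ => ?_
  rw [← Matrix.star_eq_conjTranspose, ← Matrix.star_eq_conjTranspose, map_star]

theorem tensGrp_exp {X : Mat3} (hX : star X = -X) :
    tensGrp n (NormedSpace.exp X) = NormedSpace.exp (tensLie n X) := by
  rw [tensLie_apply, exp_sum_slot]
  simp only [tensGrp, slotLie_exp _ hX]

theorem tensLie_mul_sub (X Y : Mat3) :
    tensLie n (X * Y - Y * X) = tensLie n X * tensLie n Y - tensLie n Y * tensLie n X := by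
  have h : ∀ Z W : Mat3, tensLie n Z * tensLie n W = ∑ k, ∑ l,
      slot k (slotLie k.1 Z) * slot l (slotLie l.1 W) := fun Z W => by
    rw [tensLie_apply, tensLie_apply, Finset.sum_mul_sum]
  have h' : tensLie n Y * tensLie n X = ∑ k, ∑ l,
      slot l (slotLie l.1 Y) * slot k (slotLie k.1 X) := by
    rw [h, Finset.sum_comm]
  rw [h, h', ← Finset.sum_sub_distrib, tensLie_apply]
  refine Finset.sum_congr rfl fun k _ => ?_
  rw [← Finset.sum_sub_distrib, Finset.sum_eq_single k]
  · rw [slotLie_mul_sub, map_sub, map_mul, map_mul]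
  · intro l _ hl
    rw [(slot_comm hl.symm _ _).eq, sub_self]
  · simp

theorem tensLie_diagonal (d : Fin 3 → ℂ) :
    tensLie n (diagonal d) = diagonal fun I => ∑ k : Idx n, slotDiag k.1 d (I k) := by
  ext I J
  simp only [tensLie_apply, slotLie_diagonal, slot_diagonal, Matrix.sum_apply]
  by_cases h : I = J
  · subst h; simp
  · simp [h]

theorem tensLie_one : ∃ c : ℂ, tensLie n 1 = c • 1 := by
  refine ⟨∑ k : Idx n, if k.1 then 1 else -1, ?_⟩
  rw [← Matrix.diagonal_one, tensLie_diagonal, ← Matrix.diagonal_one, ← Matrix.diagonal_smul]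
  congr 1
  funext I
  simp [slotDiag]

theorem tensLie_diagonal_mulVec_tensHw (d : Fin 3 → ℂ) :
    tensLie n (diagonal d) *ᵥ tensHw n = ((n true : ℂ) * d 0 - (n false : ℂ) * d 2) • tensHw n := by
  rw [tensLie_diagonal, tensHw]
  funext I
  rw [Matrix.mulVec_diagonal, Pi.smul_apply, smul_eq_mul]
  by_cases h : I = tensBase n
  · subst h
    congr 1
    simp [Fintype.sum_sigma, slotDiag, tensBase, slotBase, sub_eq_add_neg]
  · simp [h]

theorem tensLie_single_mulVec_tensHw {i j : Fin 3} (h : i < j) (c : ℂ) :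
    tensLie n (Matrix.single i j c) *ᵥ tensHw n = 0 := by
  rw [tensLie_apply, Matrix.sum_mulVec]
  refine Finset.sum_eq_zero fun k _ => ?_
  funext I
  rw [tensHw, Matrix.mulVec_single_one, Matrix.col_apply, slot_def, kron_update_apply]
  rw [Pi.zero_apply]
  refine mul_eq_zero_of_left ?_ _
  obtain ⟨b, k⟩ := k
  cases b
  · have : i ≠ 2 := by rintro rfl; revert h; decide +revert
    simp [slotLie, tensBase, slotBase, this]
  · have : j ≠ 0 := by rintro rfl; exact absurd h (Nat.not_lt_zero _)
    simp [slotLie, tensBase, slotBase, this]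

/-- The algebra generated by the infinitesimal action of `sl(3)`. -/
def tensAlg : Subalgebra ℂ (Matrix (Idx n → Fin 3) (Idx n → Fin 3) ℂ) :=
  Algebra.adjoin ℂ (Set.range fun X : Sl3 => tensLie n (X : Mat3))

/-- The cyclic subspace generated by the highest weight vector. -/
def tensSub : Submodule ℂ ((Idx n → Fin 3) → ℂ) :=
  (Subalgebra.toSubmodule (tensAlg n)).map ((Matrix.mulVecBilin ℂ ℂ).flip (tensHw n))

theorem tensLie_mem (X : Sl3) : tensLie n (X : Mat3) ∈ tensAlg n :=
  Algebra.subset_adjoin ⟨X, rfl⟩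

theorem mem_tensSub {v : (Idx n → Fin 3) → ℂ} :
    v ∈ tensSub n ↔ ∃ a ∈ tensAlg n, a *ᵥ tensHw n = v := Iff.rfl

theorem tensHw_mem : tensHw n ∈ tensSub n :=
  (mem_tensSub n).2 ⟨1, one_mem _, Matrix.one_mulVec _⟩

theorem star_mem_tensAlg {a : Matrix (Idx n → Fin 3) (Idx n → Fin 3) ℂ} (ha : a ∈ tensAlg n) :
    aᴴ ∈ tensAlg n := by
  have h : star (tensAlg n) = tensAlg n := by
    rw [tensAlg, Subalgebra.star_adjoin_comm]
    congr 1
    have hX : ∀ X : Sl3, (tensLie n (X : Mat3))ᴴ ∈ Set.range fun X : Sl3 => tensLie n (X : Mat3) :=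
      fun X => ⟨⟨(X : Mat3)ᴴ, by rw [mem_sl, Matrix.trace_conjTranspose, mem_sl.1 X.2, star_zero]⟩,
        tensLie_star n _⟩
    ext a
    constructor
    · rintro ⟨X, h⟩
      have := hX X
      change tensLie n (X : Mat3) = star a at h
      rwa [h, ← Matrix.star_eq_conjTranspose, star_star] at this
    · rintro ⟨X, rfl⟩
      exact hX X
  rw [← h]
  exact Subalgebra.star_mem_star_iff _ _ |>.2 ha

/-- The algebra of matrices that preserve the cyclic subspace. -/
def tensStab : Subalgebra ℂ (Matrix (Idx n → Fin 3) (Idx n → Fin 3) ℂ) where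
  carrier := {A | ∀ v ∈ tensSub n, A *ᵥ v ∈ tensSub n}
  mul_mem' {A B} hA hB v hv := by
    rw [← Matrix.mulVec_mulVec]
    exact hA _ (hB v hv)
  add_mem' {A B} hA hB v hv := by
    rw [Matrix.add_mulVec]
    exact add_mem (hA v hv) (hB v hv)
  algebraMap_mem' c v hv := by
    rw [Algebra.algebraMap_eq_smul_one, Matrix.smul_mulVec, Matrix.one_mulVec]
    exact Submodule.smul_mem _ _ hv

theorem tensAlg_le_tensStab : tensAlg n ≤ tensStab n := by
  intro a ha v hv
  obtain ⟨b, hb, rfl⟩ := (mem_tensSub n).1 hv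
  rw [Matrix.mulVec_mulVec]
  exact (mem_tensSub n).2 ⟨_, mul_mem ha hb, rfl⟩

theorem tensLie_mem_tensStab (X : Mat3) : tensLie n X ∈ tensStab n := by
  have h : X - (X.trace / 3) • 1 ∈ LieAlgebra.SpecialLinear.sl (Fin 3) ℂ := by
    rw [mem_sl, Matrix.trace_sub, Matrix.trace_smul, Matrix.trace_one]
    simp
  obtain ⟨c, hc⟩ := tensLie_one n
  have h2 : tensLie n X = tensLie n (X - (X.trace / 3) • 1) + (X.trace / 3) • c • 1 := by
    rw [map_sub, map_smul, hc]
    abel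
  rw [h2]
  refine add_mem (tensAlg_le_tensStab n (tensLie_mem n ⟨_, h⟩)) ?_
  exact Subalgebra.smul_mem _ (Subalgebra.smul_mem _ (one_mem _) _) _

open scoped Matrix.Norms.L2Operator in
theorem hasSum_exp {m : Type*} [Fintype m] [DecidableEq m] (A : Matrix m m ℂ) :
    HasSum (fun k : ℕ => ((k.factorial : ℂ)⁻¹) • A ^ k) (NormedSpace.exp A) :=
  NormedSpace.exp_series_hasSum_exp' (𝕂 := ℂ) A

open scoped Matrix.Norms.L2Operator in
theorem exp_mem_tensStab {A : Matrix (Idx n → Fin 3) (Idx n → Fin 3) ℂ} (hA : A ∈ tensStab n) :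
    NormedSpace.exp A ∈ tensStab n := by
  have hc : IsClosed ((Subalgebra.toSubmodule (tensStab n) :
      Set (Matrix (Idx n → Fin 3) (Idx n → Fin 3) ℂ))) :=
    Submodule.closed_of_finiteDimensional _
  refine hc.mem_of_tendsto (hasSum_exp A) (Eventually.of_forall fun s => ?_)
  exact Submodule.sum_mem _ fun k _ => Submodule.smul_mem _ _ (pow_mem hA k)

theorem tensGrp_mem_tensStab {g : Mat3} (hg : g ∈ Matrix.unitaryGroup (Fin 3) ℂ) :
    tensGrp n g ∈ tensStab n := by
  obtain ⟨Y, hY, rfl⟩ := exists_exp_eq_of_mem_unitary hg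
  rw [tensGrp_exp n hY]
  exact exp_mem_tensStab n (tensLie_mem_tensStab n Y)

/-- The projection onto the highest weight line belongs to the algebra generated by `sl(3)`. -/
theorem single_tensBase_mem : Matrix.single (tensBase n) (tensBase n) (1 : ℂ) ∈ tensAlg n := by
  let S : Subalgebra ℂ ((Idx n → Fin 3) → ℂ) :=
    (tensAlg n).comap (Matrix.diagonalAlgHom ℂ)
  let d : Fin 3 → ℤ := ![1, 0, -1]
  let e : (Idx n → Fin 3) → ℤ := fun I => ∑ k : Idx n, if k.1 then d (I k) else -d (I k)
  let χ : (Idx n → Fin 3) → ℂ := fun I => (e I : ℂ)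
  have hχ : χ ∈ S := by
    have ht : diagonal (fun i => (d i : ℂ)) ∈ LieAlgebra.SpecialLinear.sl (Fin 3) ℂ := by
      rw [mem_sl]
      simp [Matrix.trace, Fin.sum_univ_three, d]
    have := tensLie_mem n ⟨_, ht⟩
    rw [tensLie_diagonal] at this
    change diagonal χ ∈ tensAlg n
    convert this using 3 with I
    simp only [χ, e, Int.cast_sum]
    refine Finset.sum_congr rfl fun k _ => ?_
    simp only [slotDiag]
    split_ifs <;> simp
  have hlt : ∀ I, I ≠ tensBase n → e I < e (tensBase n) := by
    intro I hI
    obtain ⟨k, hk⟩ := Function.ne_iff.1 hI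
    have key : ∀ (b : Bool) (i : Fin 3), (if b then d i else -d i) ≤
        (if b then d (slotBase b) else -d (slotBase b)) ∧ (i ≠ slotBase b →
        (if b then d i else -d i) < (if b then d (slotBase b) else -d (slotBase b))) := by
      decide
    exact Finset.sum_lt_sum (fun k _ => (key k.1 (I k)).1)
      ⟨k, Finset.mem_univ _, (key k.1 (I k)).2 hk⟩
  let L : (Idx n → Fin 3) → ℂ := ∏ I ∈ Finset.univ.erase (tensBase n),
    (χ (tensBase n) - χ I)⁻¹ • (χ - algebraMap ℂ _ (χ I))
  have hL : L ∈ S := Subalgebra.prod_mem _ fun I _ =>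
    Subalgebra.smul_mem _ (sub_mem hχ (algebraMap_mem _ _)) _
  have hL' : L = Pi.single (tensBase n) 1 := by
    funext J
    simp only [L, Finset.prod_apply]
    by_cases hJ : J = tensBase n
    · subst hJ
      rw [Pi.single_eq_same]
      refine Finset.prod_eq_one fun I hI => ?_
      have : χ (tensBase n) - χ I ≠ 0 := by
        rw [sub_ne_zero]
        exact fun h => (hlt I (Finset.ne_of_mem_erase hI)).ne' (Int.cast_injective h)
      simp [this]
    · rw [Pi.single_eq_of_ne hJ]
      refine Finset.prod_eq_zero (Finset.mem_erase.2 ⟨hJ, Finset.mem_univ J⟩) ?_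
      simp
  have h : diagonal L ∈ tensAlg n := hL
  rwa [hL', Matrix.diagonal_single] at h

end Tensors

/-! ### The irreducible representations of `SU(3)` -/

section Irreducible

open Matrix

theorem vecMulVec_mul_vecMulVec_star {m : Type*} [Fintype m] (A B : Matrix m m ℂ) (v : m → ℂ) :
    A * vecMulVec v (star v) * Bᴴ = vecMulVec (A *ᵥ v) (star (B *ᵥ v)) := by
  rw [Matrix.mul_vecMulVec, Matrix.vecMulVec_mul, Matrix.star_mulVec]

theorem coe_inv_SU3 (g : SU3) : ((g⁻¹ : SU3) : Mat3) = (g : Mat3)ᴴ := rfl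

theorem coe_SU3_mem (g : SU3) : (g : Mat3) ∈ Matrix.unitaryGroup (Fin 3) ℂ :=
  Matrix.specialUnitaryGroup_le_unitaryGroup g.2

theorem SU3_mul_star (g : SU3) : (g : Mat3) * (g : Mat3)ᴴ = 1 :=
  Matrix.mem_unitaryGroup_iff.1 (coe_SU3_mem g)

theorem SU3_star_mul (g : SU3) : (g : Mat3)ᴴ * (g : Mat3) = 1 :=
  Matrix.mem_unitaryGroup_iff'.1 (coe_SU3_mem g)

/-- `sl(3)` is spanned over `ℂ` by its skew-hermitian elements. -/
theorem mem_of_skew_mem (S : Submodule ℂ Sl3)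
    (h : ∀ X : Sl3, star (X : Mat3) = -(X : Mat3) → X ∈ S) (X : Sl3) : X ∈ S := by
  have ht : (X : Mat3).trace = 0 := X.2
  have ht' : (X : Mat3)ᴴ.trace = 0 := by rw [Matrix.trace_conjTranspose, ht, star_zero]
  let Y : Sl3 := ⟨(X : Mat3) - (X : Mat3)ᴴ, by rw [mem_sl, Matrix.trace_sub, ht, ht', sub_zero]⟩
  let Z : Sl3 := ⟨Complex.I • ((X : Mat3) + (X : Mat3)ᴴ), by
    rw [mem_sl, Matrix.trace_smul, Matrix.trace_add, ht, ht', add_zero, smul_zero]⟩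
  have hY : Y ∈ S := h Y (by simp [Y, Matrix.star_eq_conjTranspose])
  have hZ : Z ∈ S := h Z (by
    simp only [Z, Matrix.star_eq_conjTranspose, Matrix.conjTranspose_smul, Matrix.conjTranspose_add,
      Matrix.conjTranspose_conjTranspose, Complex.star_def, Complex.conj_I]
    rw [neg_smul, add_comm])
  have : X = (1 / 2 : ℂ) • Y - (Complex.I / 2) • Z := by
    apply Subtype.ext
    change (X : Mat3) = (1 / 2 : ℂ) • ((X : Mat3) - (X : Mat3)ᴴ) -
      (Complex.I / 2) • (Complex.I • ((X : Mat3) + (X : Mat3)ᴴ))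
    rw [smul_smul, show Complex.I / 2 * Complex.I = -(1 / 2) by
      rw [div_mul_eq_mul_div, Complex.I_mul_I]; norm_num]
    module
  rw [this]
  exact sub_mem (S.smul_mem _ hY) (S.smul_mem _ hZ)

variable (n : Bool → ℕ)

/-- The dimension of the irreducible representation with highest weight `(n true, n false)`. -/
def irrepDim : ℕ := (exists_isometry (tensSub n)).choose

/-- An isometry from `ℂ^dim` onto the cyclic subspace. -/
def isom : Matrix (Idx n → Fin 3) (Fin (irrepDim n)) ℂ :=
  (exists_isometry (tensSub n)).choose_spec.choose

theorem isom_star_mul : (isom n)ᴴ * isom n = 1 :=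
  (exists_isometry (tensSub n)).choose_spec.choose_spec.1

theorem mem_tensSub_iff (v : (Idx n → Fin 3) → ℂ) : v ∈ tensSub n ↔ ∃ w, isom n *ᵥ w = v :=
  (exists_isometry (tensSub n)).choose_spec.choose_spec.2 v

theorem isom_mulVec_star {v : (Idx n → Fin 3) → ℂ} (hv : v ∈ tensSub n) :
    isom n *ᵥ ((isom n)ᴴ *ᵥ v) = v := by
  obtain ⟨w, rfl⟩ := (mem_tensSub_iff n v).1 hv
  rw [Matrix.mulVec_mulVec (M := (isom n)ᴴ), isom_star_mul, Matrix.one_mulVec]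

/-- The compression of an operator on tensors to the cyclic subspace. -/
def compress : Matrix (Idx n → Fin 3) (Idx n → Fin 3) ℂ →ₗ[ℂ]
    Matrix (Fin (irrepDim n)) (Fin (irrepDim n)) ℂ where
  toFun A := (isom n)ᴴ * A * isom n
  map_add' A B := by rw [Matrix.mul_add, Matrix.add_mul]
  map_smul' c A := by simp

theorem compress_apply (A : Matrix (Idx n → Fin 3) (Idx n → Fin 3) ℂ) :
    compress n A = (isom n)ᴴ * A * isom n := rfl

theorem isom_mul_compress {A : Matrix (Idx n → Fin 3) (Idx n → Fin 3) ℂ} (hA : A ∈ tensStab n) :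
    isom n * compress n A = A * isom n := by
  refine Matrix.ext_of_mulVec_single fun j => ?_
  rw [compress_apply, ← Matrix.mulVec_mulVec, ← Matrix.mulVec_mulVec, ← Matrix.mulVec_mulVec,
    ← Matrix.mulVec_mulVec]
  exact isom_mulVec_star n (hA _ ((mem_tensSub_iff n _).2 ⟨_, rfl⟩))

theorem compress_mul (A : Matrix (Idx n → Fin 3) (Idx n → Fin 3) ℂ)
    {B : Matrix (Idx n → Fin 3) (Idx n → Fin 3) ℂ} (hB : B ∈ tensStab n) :
    compress n (A * B) = compress n A * compress n B := by
  rw [compress_apply n A, Matrix.mul_assoc, isom_mul_compress n hB, compress_apply]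
  simp only [Matrix.mul_assoc]

theorem compress_one : compress n 1 = 1 := by
  rw [compress_apply, Matrix.mul_one, isom_star_mul]

theorem compress_star (A : Matrix (Idx n → Fin 3) (Idx n → Fin 3) ℂ) :
    compress n Aᴴ = (compress n A)ᴴ := by
  simp only [compress_apply, Matrix.conjTranspose_mul, Matrix.conjTranspose_conjTranspose,
    Matrix.mul_assoc]

theorem compress_pow {A : Matrix (Idx n → Fin 3) (Idx n → Fin 3) ℂ} (hA : A ∈ tensStab n) (k : ℕ) :
    compress n (A ^ k) = compress n A ^ k := by
  induction k with
  | zero => simp [compress_one]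
  | succ k ih => rw [pow_succ, pow_succ, compress_mul n _ hA, ih]

open scoped Matrix.Norms.L2Operator in
theorem compress_exp {A : Matrix (Idx n → Fin 3) (Idx n → Fin 3) ℂ} (hA : A ∈ tensStab n) :
    compress n (NormedSpace.exp A) = NormedSpace.exp (compress n A) := by
  have h := (hasSum_exp A).mapL (LinearMap.toContinuousLinearMap (compress n))
  refine h.unique ?_
  have h' := hasSum_exp (compress n A)
  simp only [← compress_pow n hA, ← map_smul] at h'
  exact h'

/-- The highest weight vector of the irreducible representation. -/
def irrepHw : Fin (irrepDim n) → ℂ := (isom n)ᴴ *ᵥ tensHw n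

theorem isom_irrepHw : isom n *ᵥ irrepHw n = tensHw n := isom_mulVec_star n (tensHw_mem n)

theorem compress_mulVec_irrepHw (A : Matrix (Idx n → Fin 3) (Idx n → Fin 3) ℂ) :
    compress n A *ᵥ irrepHw n = (isom n)ᴴ *ᵥ (A *ᵥ tensHw n) := by
  rw [compress_apply, ← Matrix.mulVec_mulVec, isom_irrepHw, ← Matrix.mulVec_mulVec]

theorem star_tensHw : star (tensHw n) = tensHw n := by
  funext I
  by_cases h : I = tensBase n
  · subst h; simp [tensHw]
  · simp [tensHw, h]

theorem vecMulVec_tensHw : vecMulVec (tensHw n) (star (tensHw n)) =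
    Matrix.single (tensBase n) (tensBase n) (1 : ℂ) := by
  rw [star_tensHw, tensHw, ← Matrix.single_eq_single_vecMulVec_single]

theorem compress_vecMulVec (v w : (Idx n → Fin 3) → ℂ) :
    compress n (vecMulVec v (star w)) =
      vecMulVec ((isom n)ᴴ *ᵥ v) (star ((isom n)ᴴ *ᵥ w)) := by
  rw [compress_apply, Matrix.mul_vecMulVec, Matrix.vecMulVec_mul, Matrix.star_mulVec,
    Matrix.conjTranspose_conjTranspose]

/-- The infinitesimal irreducible representation. -/
def irrepLie : Sl3 →ₗ⁅ℂ⁆ Matrix (Fin (irrepDim n)) (Fin (irrepDim n)) ℂ where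
  toFun X := compress n (tensLie n (X : Mat3))
  map_add' X Y := by
    rw [← map_add, ← map_add]
    rfl
  map_smul' c X := by
    rw [RingHom.id_apply, ← map_smul, ← map_smul]
    rfl
  map_lie' := by
    intro X Y
    change compress n (tensLie n (X * Y - Y * X : Mat3)) = _
    rw [tensLie_mul_sub, map_sub, compress_mul n _ (tensLie_mem_tensStab n _),
      compress_mul n _ (tensLie_mem_tensStab n _)]
    rfl

theorem irrepLie_apply (X : Sl3) : irrepLie n X = compress n (tensLie n (X : Mat3)) := rfl

theorem compress_mem_adjoin {a : Matrix (Idx n → Fin 3) (Idx n → Fin 3) ℂ} (ha : a ∈ tensAlg n) :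
    compress n a ∈ Algebra.adjoin ℂ (Set.range (irrepLie n)) := by
  let S : Subalgebra ℂ (Matrix (Idx n → Fin 3) (Idx n → Fin 3) ℂ) :=
    { carrier := {a | a ∈ tensAlg n ∧ compress n a ∈ Algebra.adjoin ℂ (Set.range (irrepLie n))}
      mul_mem' := fun {a b} ha hb => ⟨mul_mem ha.1 hb.1, by
        rw [compress_mul n _ (tensAlg_le_tensStab n hb.1)]
        exact mul_mem ha.2 hb.2⟩
      add_mem' := fun {a b} ha hb => ⟨add_mem ha.1 hb.1, by
        rw [map_add]
        exact add_mem ha.2 hb.2⟩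
      algebraMap_mem' := fun c => ⟨algebraMap_mem _ c, by
        rw [Algebra.algebraMap_eq_smul_one, map_smul, compress_one]
        exact Subalgebra.smul_mem _ (one_mem _) c⟩ }
  have : tensAlg n ≤ S := Algebra.adjoin_le (by
    rintro _ ⟨X, rfl⟩
    exact ⟨tensLie_mem n X, Algebra.subset_adjoin ⟨X, rfl⟩⟩)
  exact (this ha).2

theorem exists_compress_mulVec (w : Fin (irrepDim n) → ℂ) :
    ∃ a ∈ tensAlg n, compress n a *ᵥ irrepHw n = w := by
  obtain ⟨a, ha, h⟩ := (mem_tensSub n).1 ((mem_tensSub_iff n _).2 ⟨w, rfl⟩)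
  refine ⟨a, ha, ?_⟩
  rw [compress_mulVec_irrepHw, h, Matrix.mulVec_mulVec, isom_star_mul, Matrix.one_mulVec]

/-- The operators of the infinitesimal representation generate all operators. -/
theorem adjoin_irrepLie : Algebra.adjoin ℂ (Set.range (irrepLie n)) = ⊤ := by
  have hv : ∀ w w' : Fin (irrepDim n) → ℂ,
      vecMulVec w (star w') ∈ Algebra.adjoin ℂ (Set.range (irrepLie n)) := by
    intro w w'
    obtain ⟨a, ha, rfl⟩ := exists_compress_mulVec n w
    obtain ⟨b, hb, rfl⟩ := exists_compress_mulVec n w'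
    rw [← vecMulVec_mul_vecMulVec_star, ← compress_star]
    refine mul_mem (mul_mem (compress_mem_adjoin n ha) ?_)
      (compress_mem_adjoin n (star_mem_tensAlg n hb))
    rw [irrepHw, ← compress_vecMulVec, vecMulVec_tensHw]
    exact compress_mem_adjoin n (single_tensBase_mem n)
  refine eq_top_iff.2 fun A _ => ?_
  rw [Matrix.matrix_eq_sum_single A]
  refine sum_mem fun i _ => sum_mem fun j _ => ?_
  have : Matrix.single i j (A i j) = (A i j) • vecMulVec (Pi.single i 1) (star (Pi.single j 1)) := by
    have h : star (Pi.single j 1 : Fin (irrepDim n) → ℂ) = Pi.single j 1 := by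
      rw [← Pi.single_star, star_one]
    rw [h, ← Matrix.single_eq_single_vecMulVec_single, Matrix.smul_single, smul_eq_mul, mul_one]
  rw [this]
  exact Subalgebra.smul_mem _ (hv _ _) _

theorem mul_star_tensGrp (g : SU3) : tensGrp n (g : Mat3) * (tensGrp n (g : Mat3))ᴴ = 1 := by
  rw [← tensGrp_star, ← tensGrp_mul, SU3_mul_star, tensGrp_one]

/-- The irreducible representation of `SU(3)`. -/
def irrepGrp : SU3 →* Matrix.unitaryGroup (Fin (irrepDim n)) ℂ where
  toFun g := ⟨compress n (tensGrp n (g : Mat3)), by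
    rw [Matrix.mem_unitaryGroup_iff, Matrix.star_eq_conjTranspose, ← compress_star,
      ← compress_mul, mul_star_tensGrp, compress_one]
    rw [← tensGrp_star, ← coe_inv_SU3]
    exact tensGrp_mem_tensStab n (coe_SU3_mem _)⟩
  map_one' := by
    apply Subtype.ext
    change compress n (tensGrp n 1) = 1
    rw [tensGrp_one, compress_one]
  map_mul' g h := by
    apply Subtype.ext
    change compress n (tensGrp n ((g : Mat3) * (h : Mat3))) = compress n _ * compress n _
    rw [tensGrp_mul, compress_mul n _ (tensGrp_mem_tensStab n (coe_SU3_mem h))]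

theorem coe_irrepGrp (g : SU3) : (irrepGrp n g : Matrix (Fin (irrepDim n)) (Fin (irrepDim n)) ℂ) =
    compress n (tensGrp n (g : Mat3)) := rfl

theorem irrepGrp_exp (X : Sl3) (g : SU3) (hX : star (X : Mat3) = -(X : Mat3))
    (hg : (g : Mat3) = NormedSpace.exp (X : Mat3)) :
    (irrepGrp n g : Matrix (Fin (irrepDim n)) (Fin (irrepDim n)) ℂ) =
      NormedSpace.exp (irrepLie n X) := by
  rw [coe_irrepGrp, hg, tensGrp_exp n hX, compress_exp n (tensLie_mem_tensStab n _),
    irrepLie_apply]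

end Irreducible

section General

open Matrix

/-- A subspace that is invariant under the group is invariant under the Lie algebra. -/
theorem lie_mulVec_mem_of_invariant {d : ℕ} {U : SU3 →* Matrix.unitaryGroup (Fin d) ℂ}
    {ρ : Sl3 →ₗ⁅ℂ⁆ Matrix (Fin d) (Fin d) ℂ}
    (hU : ∀ (X : Sl3) (g : SU3), star (X : Mat3) = -(X : Mat3) →
      (g : Mat3) = NormedSpace.exp (X : Mat3) →
      (U g : Matrix (Fin d) (Fin d) ℂ) = NormedSpace.exp (ρ X))
    {K : Submodule ℂ (Fin d → ℂ)}
    (hK : ∀ g : SU3, ∀ v ∈ K, (U g : Matrix (Fin d) (Fin d) ℂ) *ᵥ v ∈ K)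
    (X : Sl3) {v : Fin d → ℂ} (hv : v ∈ K) : ρ X *ᵥ v ∈ K := by
  let S : Submodule ℂ Sl3 := K.comap (((Matrix.mulVecBilin ℂ ℂ).flip v) ∘ₗ (ρ : Sl3 →ₗ[ℂ] _))
  refine mem_of_skew_mem S (fun X hX => ?_) X
  change ρ X *ᵥ v ∈ K
  rw [← Subspace.dualAnnihilator_dualCoannihilator_eq (W := K), Submodule.mem_dualCoannihilator]
  intro φ hφ
  rw [Submodule.mem_dualAnnihilator] at hφ
  have h := hasDerivAt_exp_mulVec (ρ X) v φ
  have h0 : ∀ t : ℝ, φ (NormedSpace.exp (t • ρ X) *ᵥ v) = 0 := fun t => by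
    have hs : star ((t • X : Sl3) : Mat3) = -((t • X : Sl3) : Mat3) := by
      change star (t • (X : Mat3)) = -(t • (X : Mat3))
      rw [star_smul, hX]
      simp
    have ht : ((t • X : Sl3) : Mat3).trace = 0 := (t • X : Sl3).2
    have := hU (t • X) (expSU3 _ hs ht) hs rfl
    have e : ρ (t • X) = t • ρ X := by
      have := map_smul ρ (t : ℂ) X
      exact_mod_cast this
    rw [e] at this
    rw [← this]
    exact hφ _ (hK _ v hv)
  simp only [h0] at h
  exact h.unique (hasDerivAt_const _ _)

theorem eq_bot_or_top_of_invariant {d : ℕ} {K : Submodule ℂ (Fin d → ℂ)}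
    (hK : ∀ A : Matrix (Fin d) (Fin d) ℂ, ∀ v ∈ K, A *ᵥ v ∈ K) : K = ⊥ ∨ K = ⊤ := by
  by_cases h : K = ⊥
  · exact Or.inl h
  · right
    obtain ⟨v, hv, hv0⟩ := (Submodule.ne_bot_iff K).1 h
    obtain ⟨i, hi⟩ := Function.ne_iff.1 hv0
    refine eq_top_iff.2 fun w _ => ?_
    have := hK (vecMulVec w (Pi.single i (v i)⁻¹)) v hv
    rwa [Matrix.vecMulVec_mulVec, single_dotProduct, inv_mul_cancel₀ hi, MulOpposite.op_one,
      one_smul] at this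

end General

theorem eq_bot_or_top_of_irrepLie_invariant {n : Bool → ℕ} {K : Submodule ℂ (Fin (irrepDim n) → ℂ)}
    (hK : ∀ X : Sl3, ∀ v ∈ K, (irrepLie n X).mulVec v ∈ K) : K = ⊥ ∨ K = ⊤ := by
  refine eq_bot_or_top_of_invariant fun A => ?_
  have hA : A ∈ Algebra.adjoin ℂ (Set.range (irrepLie n)) := by
    rw [adjoin_irrepLie]; trivial
  induction hA using Algebra.adjoin_induction with
  | mem x hx =>
    obtain ⟨X, rfl⟩ := hx
    exact hK X
  | algebraMap r =>
    intro v hv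
    rw [Algebra.algebraMap_eq_smul_one, Matrix.smul_mulVec, Matrix.one_mulVec]
    exact K.smul_mem _ hv
  | add x y _ _ hx hy =>
    intro v hv
    rw [Matrix.add_mulVec]
    exact add_mem (hx v hv) (hy v hv)
  | mul x y _ _ hx hy =>
    intro v hv
    rw [← Matrix.mulVec_mulVec]
    exact hx _ (hy v hv)

/-- The quark system with highest weight `(n true, n false)`. -/
def quark (n : Bool → ℕ) : QuarkSystem (n true) (n false) where
  dim := irrepDim n
  U := irrepGrp n
  ρ := irrepLie n
  U_exp := irrepGrp_exp n
  irreducible K hK := eq_bot_or_top_of_irrepLie_invariant fun X _ hv =>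
    lie_mulVec_mem_of_invariant (irrepGrp_exp n) hK X hv
  hw := irrepHw n
  hw_unit := by
    rw [irrepHw, Matrix.star_mulVec, Matrix.conjTranspose_conjTranspose, ← Matrix.dotProduct_mulVec,
      isom_mulVec_star n (tensHw_mem n), star_tensHw, tensHw]
    simp
  hw_raise i j h hij := by
    rw [irrepLie_apply, compress_mulVec_irrepHw, LieAlgebra.SpecialLinear.val_single,
      tensLie_single_mulVec_tensHw n hij, Matrix.mulVec_zero]
  hw_weight₁ := by
    have h : Matrix.single 0 0 (1 : ℂ) - Matrix.single 1 1 (1 : ℂ) =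
        (Matrix.diagonal ![1, -1, 0] : Mat3) := by
      ext i j
      fin_cases i <;> fin_cases j <;> simp
    rw [irrepLie_apply, compress_mulVec_irrepHw, LieAlgebra.SpecialLinear.val_singleSubSingle, h,
      tensLie_diagonal_mulVec_tensHw, Matrix.mulVec_smul, irrepHw]
    simp
  hw_weight₂ := by
    have h : Matrix.single 1 1 (1 : ℂ) - Matrix.single 2 2 (1 : ℂ) =
        (Matrix.diagonal ![0, 1, -1] : Mat3) := by
      ext i j
      fin_cases i <;> fin_cases j <;> simp
    rw [irrepLie_apply, compress_mulVec_irrepHw, LieAlgebra.SpecialLinear.val_singleSubSingle, h,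
      tensLie_diagonal_mulVec_tensHw, Matrix.mulVec_smul, irrepHw]
    simp

/-! ### Polynomial functions -/

section PolyFun

/-- A function of matrices that is given by a polynomial in the entries. -/
def IsPolyFun (F : Mat3 → ℂ) : Prop := ∃ f : Poly, ∀ X, polyFun f X = F X

theorem polyFun_add (f h : Poly) (X : Mat3) : polyFun (f + h) X = polyFun f X + polyFun h X :=
  map_add _ _ _

theorem polyFun_mul (f h : Poly) (X : Mat3) : polyFun (f * h) X = polyFun f X * polyFun h X :=
  map_mul _ _ _

theorem polyFun_C (c : ℂ) (X : Mat3) : polyFun (MvPolynomial.C c) X = c := MvPolynomial.eval_C _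

theorem polyFun_X (ij : Fin 3 × Fin 3) (X : Mat3) :
    polyFun (MvPolynomial.X ij) X = X ij.1 ij.2 := MvPolynomial.eval_X _

theorem IsPolyFun.const (c : ℂ) : IsPolyFun fun _ => c := ⟨MvPolynomial.C c, polyFun_C c⟩

theorem IsPolyFun.entry (i j : Fin 3) : IsPolyFun fun X => X i j :=
  ⟨MvPolynomial.X (i, j), polyFun_X (i, j)⟩

theorem IsPolyFun.add {F G : Mat3 → ℂ} (hF : IsPolyFun F) (hG : IsPolyFun G) :
    IsPolyFun fun X => F X + G X := by
  obtain ⟨f, hf⟩ := hF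
  obtain ⟨h, hh⟩ := hG
  exact ⟨f + h, fun X => by rw [polyFun_add, hf, hh]⟩

theorem IsPolyFun.mul {F G : Mat3 → ℂ} (hF : IsPolyFun F) (hG : IsPolyFun G) :
    IsPolyFun fun X => F X * G X := by
  obtain ⟨f, hf⟩ := hF
  obtain ⟨h, hh⟩ := hG
  exact ⟨f * h, fun X => by rw [polyFun_mul, hf, hh]⟩

theorem IsPolyFun.sum {κ : Type*} (s : Finset κ) {F : κ → Mat3 → ℂ} (h : ∀ k, IsPolyFun (F k)) :
    IsPolyFun fun X => ∑ k ∈ s, F k X := by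
  choose f hf using h
  exact ⟨∑ k ∈ s, f k, fun X => by simp only [polyFun, map_sum, ← hf]⟩

theorem IsPolyFun.prod {κ : Type*} (s : Finset κ) {F : κ → Mat3 → ℂ} (h : ∀ k, IsPolyFun (F k)) :
    IsPolyFun fun X => ∏ k ∈ s, F k X := by
  choose f hf using h
  exact ⟨∏ k ∈ s, f k, fun X => by simp only [polyFun, map_prod, ← hf]⟩

theorem hasDerivAt_polyFun (f : Poly) {γ : ℝ → Mat3} {γ' : Mat3} {t₀ : ℝ}
    (hγ : ∀ i j, HasDerivAt (fun t => γ t i j) (γ' i j) t₀) :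
    HasDerivAt (fun t => polyFun f (γ t))
      (Matrix.trace (gradMat f (γ t₀) * γ')) t₀ := by
  have e : ∀ f : Poly, Matrix.trace (gradMat f (γ t₀) * γ') =
      ∑ i, ∑ j, polyFun (MvPolynomial.pderiv (j, i) f) (γ t₀) * γ' j i := fun f => rfl
  rw [e]
  induction f using MvPolynomial.induction_on with
  | C c =>
    simpa [polyFun] using hasDerivAt_const t₀ c
  | add p q hp hq =>
    simp only [polyFun_add]
    refine (hp.fun_add hq).congr_deriv ?_
    simp only [map_add, polyFun_add, add_mul, Finset.sum_add_distrib]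
  | mul_X p ij hp =>
    obtain ⟨k, l⟩ := ij
    simp only [polyFun_mul, polyFun_X]
    refine (hp.fun_mul (hγ k l)).congr_deriv ?_
    · simp only [Derivation.leibniz, smul_eq_mul, polyFun_add, polyFun_mul, polyFun_X, add_mul,
        Finset.sum_add_distrib, MvPolynomial.pderiv_X, Finset.sum_mul]
      refine (add_comm _ _).trans (congrArg₂ (· + ·) ?_ ?_)
      · rw [Finset.sum_eq_single l, Finset.sum_eq_single k]
        · simp [polyFun]
        · intro j _ hj
          simp [polyFun, hj.symm]
        · simp
        · intro i _ hi
          refine Finset.sum_eq_zero fun j _ => ?_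
          simp [polyFun, hi.symm]
        · simp
      · refine Finset.sum_congr rfl fun i _ => Finset.sum_congr rfl fun j _ => ?_
        ring

end PolyFun

/-! ### Coherent states and Berezin symbols -/

section Berezin

open Matrix

/-- The eigenvalues of `weight (z true) (z false)`. -/
def weightEntries (z : Bool → ℝ) : Fin 3 → ℂ :=
  ![Complex.I / 3 * (2 * z true + z false : ℝ),
    Complex.I / 3 * (-z true + z false : ℝ), Complex.I / 3 * (-z true - 2 * z false : ℝ)]

/-- The polynomial in `X` that represents the highest weight projection of a slot on the orbit of
`weight (z true) (z false)`. -/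
def slotProj (z : Bool → ℝ) (b : Bool) (X : Mat3) : Mat3 :=
  let a := weightEntries z
  if b then ((a 0 - a 1) * (a 0 - a 2))⁻¹ • ((X - a 1 • 1) * (X - a 2 • 1))
  else (((a 2 - a 0) * (a 2 - a 1))⁻¹ • ((X - a 0 • 1) * (X - a 1 • 1)))ᵀ

theorem weight_eq_diagonal (z : Bool → ℝ) :
    weight (z true) (z false) = diagonal (weightEntries z) := by
  rw [weight, ← Matrix.diagonal_smul]
  congr 1
  funext i
  fin_cases i <;> simp [weightEntries]

theorem weightEntries_sub (z : Bool → ℝ) :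
    weightEntries z 0 - weightEntries z 1 = Complex.I * z true ∧
    weightEntries z 1 - weightEntries z 2 = Complex.I * z false ∧
    weightEntries z 0 - weightEntries z 2 = Complex.I * (z true + z false : ℝ) := by
  refine ⟨?_, ?_, ?_⟩ <;> simp [weightEntries] <;> ring

theorem lagrange_diagonal (a : Fin 3 → ℂ) :
    (a 0 ≠ a 1 → a 0 ≠ a 2 → ((a 0 - a 1) * (a 0 - a 2))⁻¹ •
      ((diagonal a - a 1 • 1) * (diagonal a - a 2 • 1)) = (Matrix.single 0 0 1 : Mat3)) ∧
    (a 2 ≠ a 0 → a 2 ≠ a 1 → ((a 2 - a 0) * (a 2 - a 1))⁻¹ •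
      ((diagonal a - a 0 • 1) * (diagonal a - a 1 • 1)) = (Matrix.single 2 2 1 : Mat3)) := by
  have e : ∀ c : ℂ, diagonal a - c • 1 = (diagonal (fun i => a i - c) : Mat3) := fun c => by
    ext i j
    by_cases h : i = j
    · subst h; simp
    · simp [h]
  simp only [e, Matrix.diagonal_mul_diagonal, ← Matrix.diagonal_smul]
  constructor
  · intro h1 h2
    have h1' := sub_ne_zero.2 h1
    have h2' := sub_ne_zero.2 h2
    ext i j
    fin_cases i <;> fin_cases j <;> simp
    field_simp
  · intro h1 h2
    have h1' := sub_ne_zero.2 h1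
    have h2' := sub_ne_zero.2 h2
    ext i j
    fin_cases i <;> fin_cases j <;> simp
    field_simp

theorem Ad_mul (g h : SU3) (X : Mat3) : Ad (g * h) X = Ad g (Ad h X) := by
  simp only [Ad, _root_.mul_inv_rev, Submonoid.coe_mul, Matrix.mul_assoc]

theorem Ad_sub_smul (g : SU3) (X : Mat3) (c : ℂ) : Ad g X - c • 1 = Ad g (X - c • 1) := by
  simp only [Ad, Matrix.mul_sub, Matrix.sub_mul, mul_smul_comm, smul_mul_assoc, Matrix.mul_one,
    coe_inv_SU3, SU3_mul_star]

theorem Ad_mul_Ad (g : SU3) (X Y : Mat3) : Ad g X * Ad g Y = Ad g (X * Y) := by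
  simp only [Ad, coe_inv_SU3]
  calc _ = (g : Mat3) * X * ((g : Mat3)ᴴ * (g : Mat3)) * Y * (g : Mat3)ᴴ := by
        simp only [Matrix.mul_assoc]
    _ = _ := by rw [SU3_star_mul, Matrix.mul_one]; simp only [Matrix.mul_assoc]

theorem smul_Ad (g : SU3) (X : Mat3) (c : ℂ) : c • Ad g X = Ad g (c • X) := by
  simp [Ad]

theorem slotProj_Ad {z : Bool → ℝ} (hz : ∀ b, 0 ≤ z b) {b : Bool} (hb : z b ≠ 0) (g : SU3) :
    slotProj z b (Ad g (weight (z true) (z false))) =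
      slotGrp b g * Matrix.single (slotBase b) (slotBase b) 1 * (slotGrp b g)ᴴ := by
  have hb' : 0 < z b := lt_of_le_of_ne (hz b) hb.symm
  have ht := hz true
  have hf := hz false
  obtain ⟨e01, e12, e02⟩ := weightEntries_sub z
  have ne : ∀ {r : ℝ} {c d : ℂ}, c - d = Complex.I * r → 0 < r → c ≠ d := by
    intro r c d h hr hcd
    rw [hcd, sub_self, eq_comm, mul_eq_zero] at h
    rcases h with h | h
    · exact Complex.I_ne_zero h
    · exact hr.ne' (Complex.ofReal_eq_zero.1 h)
  cases b
  · simp only [slotProj, slotGrp, slotBase, Bool.false_eq_true, if_false]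
    rw [Ad_sub_smul, Ad_sub_smul, Ad_mul_Ad, smul_Ad, weight_eq_diagonal,
      (lagrange_diagonal _).2 (ne e02 (by linarith)).symm (ne e12 hb').symm]
    have h : ((g : Mat3)ᴴᵀ)ᴴ = (g : Mat3)ᵀ := by
      ext i j; simp [Matrix.conjTranspose_apply]
    rw [Ad, Matrix.transpose_mul, Matrix.transpose_mul, coe_inv_SU3, h, Matrix.mul_assoc,
      Matrix.transpose_single]
  · simp only [slotProj, slotGrp, slotBase, if_true]
    rw [Ad_sub_smul, Ad_sub_smul, Ad_mul_Ad, smul_Ad, weight_eq_diagonal,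
      (lagrange_diagonal _).1 (ne e01 hb') (ne e02 (by linarith)), Ad, coe_inv_SU3]

end Berezin

section BerezinSymbol

open Matrix

/-- The point of the Weyl chamber with coordinates `z`. -/
abbrev chamberPt (z : Bool → ℝ) : Mat3 := weight (z true) (z false)

variable (n : Bool → ℕ) (z : Bool → ℝ)

/-- The coherent state projection on tensors, as a polynomial in the point of the orbit. -/
def coherent (X : Mat3) : Matrix (Idx n → Fin 3) (Idx n → Fin 3) ℂ :=
  kron fun k : Idx n => slotProj z k.1 X

/-- The chamber coordinates `z` are compatible with the highest weight `n`. -/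
structure Compatible : Prop where
  nonneg : ∀ b, 0 ≤ z b
  ne_zero : ∀ b, n b ≠ 0 → z b ≠ 0

theorem single_tensBase : Matrix.single (tensBase n) (tensBase n) (1 : ℂ) =
    kron fun k : Idx n => Matrix.single (slotBase k.1) (slotBase k.1) (1 : ℂ) := by
  ext I J
  simp only [kron_apply, Matrix.single_apply, Finset.prod_ite_zero, Finset.prod_const_one,
    Finset.mem_univ, true_imp_iff, forall_and, funext_iff, tensBase]

variable {n z}

theorem coherent_Ad (h : Compatible n z) (g : SU3) : coherent n z (Ad g (chamberPt z)) =
    tensGrp n (g : Mat3) * Matrix.single (tensBase n) (tensBase n) 1 * (tensGrp n (g : Mat3))ᴴ := by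
  rw [single_tensBase, tensGrp, kron_conjTranspose, kron_mul, kron_mul, coherent]
  congr 1
  funext k
  refine slotProj_Ad h.nonneg (h.ne_zero _ fun h0 => ?_) g
  exact Fin.elim0 (Fin.cast h0 k.2)

theorem coherent_Ad_eq_vecMulVec (h : Compatible n z) (g : SU3) :
    coherent n z (Ad g (chamberPt z)) = vecMulVec (tensGrp n (g : Mat3) *ᵥ tensHw n)
      (star (tensGrp n (g : Mat3) *ᵥ tensHw n)) := by
  rw [coherent_Ad h, ← vecMulVec_tensHw, vecMulVec_mul_vecMulVec_star]

variable (n) in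
/-- The operators of the irreducible representation. -/
abbrev IrrepOp : Type := Matrix (Fin (irrepDim n)) (Fin (irrepDim n)) ℂ

variable (n) in
/-- The unitary operator that represents `g`. -/
def irrepU : SU3 →* IrrepOp n := (Submonoid.subtype _).comp (irrepGrp n)

theorem irrepU_apply (g : SU3) : irrepU n g = compress n (tensGrp n (g : Mat3)) := rfl

theorem irrepU_inv (g : SU3) : irrepU n g⁻¹ = (irrepU n g)ᴴ := by
  rw [irrepU_apply, irrepU_apply, ← compress_star, ← tensGrp_star, coe_inv_SU3]

theorem irrepU_mul_inv (g : SU3) : irrepU n g * irrepU n g⁻¹ = 1 := by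
  rw [← map_mul, mul_inv_cancel, map_one]

theorem irrepU_inv_mul (g : SU3) : irrepU n g⁻¹ * irrepU n g = 1 := by
  rw [← map_mul, inv_mul_cancel, map_one]

/-- The coherent state vectors. -/
def coherentVec (n : Bool → ℕ) (g : SU3) : Fin (irrepDim n) → ℂ := irrepU n g *ᵥ irrepHw n

theorem coherentVec_one : coherentVec n 1 = irrepHw n := by
  rw [coherentVec, map_one, Matrix.one_mulVec]

theorem compress_coherent (h : Compatible n z) (g : SU3) :
    compress n (coherent n z (Ad g (chamberPt z))) =
      vecMulVec (coherentVec n g) (star (coherentVec n g)) := by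
  rw [coherent_Ad_eq_vecMulVec h, compress_vecMulVec, coherentVec, irrepU_apply,
    compress_mulVec_irrepHw]

variable (n z)

/-- The Berezin symbol. -/
def berezin : IrrepOp n →ₗ[ℂ] (orbit (chamberPt z) → ℂ) where
  toFun A X := trace (A * compress n (coherent n z X))
  map_add' A B := by
    funext X
    rw [Matrix.add_mul, Matrix.trace_add]
    rfl
  map_smul' c A := by
    funext X
    simp

variable {n z}

theorem berezin_apply (A : IrrepOp n) (X : orbit (chamberPt z)) :
    berezin n z A X = trace (A * compress n (coherent n z X)) := rfl

/-- The Berezin symbol as an expectation value. -/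
theorem berezin_orbitPt (h : Compatible n z) (A : IrrepOp n) (g : SU3) :
    berezin n z A (orbitPt _ g) = star (coherentVec n g) ⬝ᵥ (A *ᵥ coherentVec n g) := by
  rw [berezin_apply, orbitPt, compress_coherent h, Matrix.mul_vecMulVec, Matrix.trace_vecMulVec,
    dotProduct_comm]

theorem isBerezin_berezin (h : Compatible n z) : (quark n).IsBerezin _ (berezin n z) := by
  intro A g
  refine (berezin_orbitPt h A g).trans ?_
  have e : (quark n).conj g (quark n).hwProj =
      vecMulVec (coherentVec n g) (star (coherentVec n g)) := by
    change irrepU n g * vecMulVec (irrepHw n) (star (irrepHw n)) * irrepU n g⁻¹ = _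
    rw [irrepU_inv, vecMulVec_mul_vecMulVec_star]
    rfl
  rw [e]
  exact ((congrArg trace (Matrix.mul_vecMulVec (α := ℂ) (A : IrrepOp n) _ _)).trans
    ((Matrix.trace_vecMulVec _ _).trans (dotProduct_comm _ _))).symm

/-- The Berezin symbol of a compression, computed on tensors. -/
theorem berezin_compress (h : Compatible n z) (T : Matrix (Idx n → Fin 3) (Idx n → Fin 3) ℂ)
    (X : orbit (chamberPt z)) : berezin n z (compress n T) X = trace (T * coherent n z X) := by
  obtain ⟨_, g, rfl⟩ := X
  change berezin n z (compress n T) (orbitPt _ g) = trace (T * coherent n z (Ad g (chamberPt z)))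
  have h1 : isom n *ᵥ coherentVec n g = tensGrp n (g : Mat3) *ᵥ tensHw n := by
    rw [coherentVec, irrepU_apply, compress_mulVec_irrepHw, isom_mulVec_star]
    exact tensGrp_mem_tensStab n (coe_SU3_mem g) _ (tensHw_mem n)
  rw [berezin_orbitPt h, coherent_Ad_eq_vecMulVec h, Matrix.mul_vecMulVec, Matrix.trace_vecMulVec,
    ← h1, compress_apply, ← Matrix.mulVec_mulVec, ← Matrix.mulVec_mulVec, Matrix.dotProduct_mulVec,
    ← Matrix.star_mulVec, dotProduct_comm]

theorem isPolyFun_slotProj (b : Bool) (i j : Fin 3) : IsPolyFun fun X => slotProj z b X i j := by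
  have key : ∀ (c d e : ℂ) (i j : Fin 3),
      IsPolyFun fun X => (c • ((X - d • 1) * (X - e • 1)) : Mat3) i j := by
    intro c d e i j
    simp only [Matrix.smul_apply, Matrix.mul_apply, smul_eq_mul]
    have h : ∀ (d : ℂ) (i j : Fin 3), IsPolyFun fun X => (X - d • 1 : Mat3) i j := fun d i j =>
      (IsPolyFun.entry i j).add (IsPolyFun.const (-(d • (1 : Mat3) i j)))
    exact (IsPolyFun.const c).mul (IsPolyFun.sum _ fun k => (h d i k).mul (h e k j))
  cases b
  · exact key _ _ _ _ _
  · exact key _ _ _ _ _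

variable (n z)

theorem berezin_poly (A : IrrepOp n) :
    ∃ f : Poly, berezin n z A = restr (orbit (chamberPt z)) f := by
  have h : IsPolyFun fun X => trace (A * compress n (coherent n z X)) := by
    simp only [Matrix.trace, Matrix.diag, compress_apply, Matrix.mul_apply, coherent, kron_apply]
    refine IsPolyFun.sum _ fun i => IsPolyFun.sum _ fun j => (IsPolyFun.const _).mul ?_
    refine IsPolyFun.sum _ fun k => (IsPolyFun.sum _ fun l => ?_).mul (IsPolyFun.const _)
    exact (IsPolyFun.const _).mul (IsPolyFun.prod _ fun m => isPolyFun_slotProj _ _ _)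
  obtain ⟨f, hf⟩ := h
  exact ⟨f, funext fun X => (hf X).symm⟩

variable {n z}

theorem coherentVec_mul (k g : SU3) : coherentVec n (k * g) = irrepU n k *ᵥ coherentVec n g := by
  rw [coherentVec, map_mul, ← Matrix.mulVec_mulVec, coherentVec]

theorem berezin_equivariant (h : Compatible n z) (k g : SU3) (A : IrrepOp n) :
    berezin n z (irrepU n k * A * irrepU n k⁻¹) (orbitPt _ (k * g)) =
      berezin n z A (orbitPt _ g) := by
  rw [berezin_orbitPt h, berezin_orbitPt h, coherentVec_mul, Matrix.star_mulVec,
    ← Matrix.dotProduct_mulVec, Matrix.mulVec_mulVec, Matrix.mulVec_mulVec, ← irrepU_inv]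
  congr 2
  calc irrepU n k⁻¹ * (irrepU n k * A * irrepU n k⁻¹) * irrepU n k =
        (irrepU n k⁻¹ * irrepU n k) * A * (irrepU n k⁻¹ * irrepU n k) := by
        simp only [Matrix.mul_assoc]
    _ = A := by rw [irrepU_inv_mul, Matrix.one_mul, Matrix.mul_one]

theorem berezin_real (h : Compatible n z) (A : IrrepOp n) (X : orbit (chamberPt z)) :
    berezin n z (star A) X = star (berezin n z A X) := by
  obtain ⟨_, g, rfl⟩ := X
  change berezin n z (star A) (orbitPt _ g) = star (berezin n z A (orbitPt _ g))
  rw [berezin_orbitPt h, berezin_orbitPt h, Matrix.star_dotProduct, Matrix.star_mulVec,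
    Matrix.star_eq_conjTranspose, Matrix.conjTranspose_conjTranspose, ← Matrix.dotProduct_mulVec]

theorem dotProduct_star_coherentVec (g : SU3) :
    star (coherentVec n g) ⬝ᵥ coherentVec n g = 1 := by
  rw [coherentVec, Matrix.star_mulVec, ← Matrix.dotProduct_mulVec, Matrix.mulVec_mulVec,
    ← irrepU_inv, irrepU_inv_mul, Matrix.one_mulVec]
  exact (quark n).hw_unit

theorem berezin_one (h : Compatible n z) (X : orbit (chamberPt z)) : berezin n z 1 X = 1 := by
  obtain ⟨_, g, rfl⟩ := X
  change berezin n z 1 (orbitPt _ g) = 1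
  rw [berezin_orbitPt h, Matrix.one_mulVec, dotProduct_star_coherentVec]

open scoped Matrix.Norms.L2Operator in
theorem norm_berezin_le (h : Compatible n z) (A : IrrepOp n) (X : orbit (chamberPt z)) :
    ‖berezin n z A X‖ ≤ ‖A‖ := by
  obtain ⟨_, g, rfl⟩ := X
  change ‖berezin n z A (orbitPt _ g)‖ ≤ _
  rw [berezin_orbitPt h]
  have h1 := dotProduct_star_coherentVec (n := n) g
  set v := coherentVec n g
  let v' : EuclideanSpace ℂ (Fin (irrepDim n)) := WithLp.toLp 2 v
  have h2 : star v ⬝ᵥ (A *ᵥ v) = inner ℂ v'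
      (WithLp.toLp 2 (A *ᵥ v) : EuclideanSpace ℂ (Fin (irrepDim n))) := by
    rw [EuclideanSpace.inner_toLp_toLp, dotProduct_comm]
  have h3 : ‖v'‖ = 1 := by
    have h4 : inner ℂ v' v' = (1 : ℂ) := by
      rw [EuclideanSpace.inner_toLp_toLp, dotProduct_comm, h1]
    rw [inner_self_eq_norm_sq_to_K] at h4
    have h5 : ‖v'‖ ^ 2 = 1 := by
      have : ((‖v'‖ ^ 2 : ℝ) : ℂ) = 1 := by rw [Complex.ofReal_pow]; exact h4
      exact_mod_cast this
    nlinarith [norm_nonneg v']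
  rw [h2]
  refine (norm_inner_le_norm _ _).trans ?_
  rw [h3, one_mul]
  have := Matrix.l2_opNorm_mulVec A v'
  rw [h3, mul_one] at this
  exact this

end BerezinSymbol

section Infinitesimal

open Matrix

variable {n : Bool → ℕ} {z : Bool → ℝ}

/-- The conjugate transpose on `sl(3)`. -/
def slStar (X : Sl3) : Sl3 :=
  ⟨(X : Mat3)ᴴ, by rw [mem_sl, Matrix.trace_conjTranspose, mem_sl.1 X.2, star_zero]⟩

theorem irrepLie_star (X : Sl3) : irrepLie n (slStar X) = (irrepLie n X)ᴴ := by
  rw [irrepLie_apply, irrepLie_apply, ← compress_star, ← tensLie_star]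
  rfl

/-- The linear function `tr(X ·)`. -/
def linPoly (X : Mat3) : Poly := ∑ i, ∑ j, MvPolynomial.C (X i j) * MvPolynomial.X (j, i)

theorem polyFun_linPoly (X Y : Mat3) : polyFun (linPoly X) Y = trace (X * Y) := by
  simp [polyFun, linPoly, Matrix.trace, Matrix.mul_apply]

theorem gradMat_linPoly (X Y : Mat3) : gradMat (linPoly X) Y = X := by
  ext i j
  simp only [gradMat, of_apply, linPoly, map_sum, Derivation.leibniz, MvPolynomial.pderiv_C,
    MvPolynomial.pderiv_X, smul_zero, add_zero, smul_eq_mul, polyFun, MvPolynomial.eval_mul,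
    MvPolynomial.eval_C]
  rw [Finset.sum_eq_single i, Finset.sum_eq_single j]
  · simp
  · intro k _ hk
    simp [hk]
  · simp
  · intro k _ hk
    refine Finset.sum_eq_zero fun l _ => ?_
    simp [hk]
  · simp

theorem poisson_linPoly (X : Mat3) (f : Poly) (Y : Mat3) :
    poisson (linPoly X) f Y = trace (Y * (X * gradMat f Y - gradMat f Y * X)) := by
  rw [poisson, gradMat_linPoly]

/-- Equivariance, infinitesimally: the commutator with `ρ(X)` corresponds to the Poisson bracket
with `tr(X ·)`. -/
theorem berezin_lie (h : Compatible n z) {A : IrrepOp n} {f : Poly}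
    (hf : berezin n z A = restr (orbit (chamberPt z)) f) (X : Sl3) (Y : orbit (chamberPt z)) :
    berezin n z (irrepLie n X * A - A * irrepLie n X) Y = poisson (linPoly (X : Mat3)) f Y := by
  rw [poisson_linPoly]
  set D : Mat3 := gradMat f Y with hD
  let φ : Sl3 →ₗ[ℂ] ℂ :=
    { toFun := fun X => berezin n z (irrepLie n X * A - A * irrepLie n X) Y -
        trace ((Y : Mat3) * ((X : Mat3) * D - D * (X : Mat3)))
      map_add' := fun X X' => by
        have e : ((X + X' : Sl3) : Mat3) = (X : Mat3) + (X' : Mat3) := rfl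
        rw [map_add, e, Matrix.add_mul, Matrix.mul_add, add_sub_add_comm, map_add, Pi.add_apply,
          Matrix.add_mul, Matrix.mul_add D, add_sub_add_comm ((X : Mat3) * D), Matrix.mul_add,
          Matrix.trace_add]
        ring
      map_smul' := fun c X => by
        have e : ((c • X : Sl3) : Mat3) = c • (X : Mat3) := rfl
        rw [map_smul, e, smul_mul_assoc, mul_smul_comm, ← smul_sub, map_smul, Pi.smul_apply,
          smul_mul_assoc, mul_smul_comm, ← smul_sub, mul_smul_comm, Matrix.trace_smul, ← smul_sub]
        rfl }
  suffices hk : X ∈ LinearMap.ker φ from sub_eq_zero.1 (LinearMap.mem_ker.1 hk)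
  refine mem_of_skew_mem _ (fun X hX => ?_) X
  rw [LinearMap.mem_ker]
  refine sub_eq_zero.2 ?_
  obtain ⟨Y, g₀, rfl⟩ := Y
  have hs : ∀ t : ℝ, star ((t • X : Sl3) : Mat3) = -((t • X : Sl3) : Mat3) := fun t => by
    change star (t • (X : Mat3)) = -(t • (X : Mat3))
    rw [star_smul, hX]
    simp
  let g : ℝ → SU3 := fun t => expSU3 ((t • X : Sl3) : Mat3) (hs t) (t • X : Sl3).2
  have hg : ∀ t, (g t : Mat3) = NormedSpace.exp (t • (X : Mat3)) := fun t => rfl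
  have hg' : ∀ t, (((g t)⁻¹ : SU3) : Mat3) = NormedSpace.exp (t • (-(X : Mat3))) := fun t => by
    rw [coe_inv_SU3, hg, ← Matrix.exp_conjTranspose]
    congr 1
    have := hs t
    rw [Matrix.star_eq_conjTranspose] at this
    rw [smul_neg]
    exact this
  have hρ : (irrepLie n X)ᴴ = -irrepLie n X := by
    rw [← irrepLie_star, ← map_neg]
    congr 1
    exact Subtype.ext hX
  have hU : ∀ t, irrepU n (g t) = NormedSpace.exp (t • irrepLie n X) := fun t => by
    have e : irrepLie n (t • X) = t • irrepLie n X := by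
      have := map_smul (irrepLie n) (t : ℂ) X
      exact_mod_cast this
    rw [← e]
    exact irrepGrp_exp n (t • X) (g t) (hs t) rfl
  have hU' : ∀ t, (irrepU n (g t))ᴴ = NormedSpace.exp (t • (-irrepLie n X)) := fun t => by
    rw [hU, ← Matrix.exp_conjTranspose, Matrix.conjTranspose_smul, hρ]
    rfl
  set c := coherentVec n g₀
  have h1 : ∀ t, polyFun f (Ad (g t) (Ad g₀ (chamberPt z))) =
      trace (A * (NormedSpace.exp (t • irrepLie n X) * vecMulVec c (star c) *
        NormedSpace.exp (t • (-irrepLie n X)))) := fun t => by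
    rw [← Ad_mul, ← hU', ← hU, vecMulVec_mul_vecMulVec_star, Matrix.mul_vecMulVec,
      Matrix.trace_vecMulVec, dotProduct_comm, ← coherentVec_mul, ← berezin_orbitPt h, hf]
    rfl
  have h2 := hasDerivAt_exp_conj (irrepLie n X) (vecMulVec c (star c))
    ((Matrix.traceLinearMap _ ℂ ℂ) ∘ₗ LinearMap.mulLeft ℂ A)
  have h3 : HasDerivAt (fun t => polyFun f (Ad (g t) (Ad g₀ (chamberPt z))))
      (trace (D * ((X : Mat3) * Ad g₀ (chamberPt z) - Ad g₀ (chamberPt z) * (X : Mat3)))) 0 := by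
    have e0 : Ad (g 0) (Ad g₀ (chamberPt z)) = Ad g₀ (chamberPt z) := by
      rw [Ad, hg, hg']; simp
    have h4 := hasDerivAt_polyFun f (γ := fun t => Ad (g t) (Ad g₀ (chamberPt z)))
      (γ' := (X : Mat3) * Ad g₀ (chamberPt z) - Ad g₀ (chamberPt z) * (X : Mat3)) (t₀ := 0)
      (fun i j => by
        have := hasDerivAt_exp_conj (X : Mat3) (Ad g₀ (chamberPt z))
          (Matrix.entryLinearMap ℂ ℂ i j)
        simp only [Ad, hg, hg']
        exact this)
    simp only [e0] at h4
    exact h4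
  have h5 := h3.unique (h2.congr_of_eventuallyEq (Eventually.of_forall h1))
  change berezin n z _ (orbitPt _ g₀) = _
  rw [berezin_apply]
  change trace (_ * compress n (coherent n z (Ad g₀ (chamberPt z)))) = _
  rw [compress_coherent h]
  change _ = trace (A * (irrepLie n X * vecMulVec c (star c) - vecMulVec c (star c) * irrepLie n X))
    at h5
  change _ = trace (Ad g₀ (chamberPt z) * _)
  set Q := vecMulVec c (star c)
  set x := Ad g₀ (chamberPt z)
  set ρ := irrepLie n X
  have e1 : trace ((ρ * A - A * ρ) * Q) = -trace (A * (ρ * Q - Q * ρ)) := by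
    rw [Matrix.sub_mul, Matrix.mul_sub, Matrix.trace_sub, Matrix.trace_sub,
      Matrix.mul_assoc ρ, Matrix.trace_mul_comm ρ, Matrix.mul_assoc, Matrix.mul_assoc]
    ring
  have e2 : trace (x * ((X : Mat3) * D - D * (X : Mat3))) =
      -trace (D * ((X : Mat3) * x - x * (X : Mat3))) := by
    rw [Matrix.mul_sub, Matrix.mul_sub, Matrix.trace_sub, Matrix.trace_sub,
      ← Matrix.mul_assoc x D, Matrix.trace_mul_comm (x * D), ← Matrix.mul_assoc x,
      Matrix.trace_mul_comm (x * (X : Mat3)), Matrix.trace_mul_comm (X : Mat3) (x * D),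
      Matrix.mul_assoc x D, Matrix.trace_mul_comm x, Matrix.mul_assoc D]
    ring
  rw [e1, e2, h5]

end Infinitesimal

section Injective

open Matrix

variable {n : Bool → ℕ} {z : Bool → ℝ}

theorem irrepHw_ne_zero : irrepHw n ≠ 0 := by
  intro h
  have := (quark n).hw_unit
  change star (irrepHw n) ⬝ᵥ irrepHw n = 1 at this
  rw [h, dotProduct_zero] at this
  exact zero_ne_one this

theorem irrepLie_upper_mulVec_irrepHw {X : Sl3} (hX : ∀ i j, j < i → (X : Mat3) i j = 0) :
    ∃ c : ℂ, irrepLie n X *ᵥ irrepHw n = c • irrepHw n := by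
  have e : (X : Mat3) = diagonal (fun i => (X : Mat3) i i) + Matrix.single 0 1 ((X : Mat3) 0 1) +
      Matrix.single 0 2 ((X : Mat3) 0 2) + Matrix.single 1 2 ((X : Mat3) 1 2) := by
    ext i j
    fin_cases i <;> fin_cases j <;> simp [hX]
  refine ⟨(n true : ℂ) * (X : Mat3) 0 0 - (n false : ℂ) * (X : Mat3) 2 2, ?_⟩
  rw [irrepLie_apply, compress_mulVec_irrepHw, e, map_add, map_add, map_add, Matrix.add_mulVec,
    Matrix.add_mulVec, Matrix.add_mulVec, tensLie_single_mulVec_tensHw n (by decide),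
    tensLie_single_mulVec_tensHw n (by decide), tensLie_single_mulVec_tensHw n (by decide),
    add_zero, add_zero, add_zero, tensLie_diagonal_mulVec_tensHw, Matrix.mulVec_smul, irrepHw, ← e]

theorem irrepLie_strictUpper_mulVec_irrepHw {X : Sl3} (hX : ∀ i j, j ≤ i → (X : Mat3) i j = 0) :
    irrepLie n X *ᵥ irrepHw n = 0 := by
  have e : (X : Mat3) = Matrix.single 0 1 ((X : Mat3) 0 1) +
      Matrix.single 0 2 ((X : Mat3) 0 2) + Matrix.single 1 2 ((X : Mat3) 1 2) := by
    ext i j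
    fin_cases i <;> fin_cases j <;> simp [hX]
  rw [irrepLie_apply, compress_mulVec_irrepHw, e, map_add, map_add, Matrix.add_mulVec,
    Matrix.add_mulVec, tensLie_single_mulVec_tensHw n (by decide),
    tensLie_single_mulVec_tensHw n (by decide), tensLie_single_mulVec_tensHw n (by decide),
    add_zero, add_zero, Matrix.mulVec_zero]

theorem exists_lower_add_upper (X : Sl3) : ∃ Y Z : Sl3, X = Y + Z ∧
    (∀ i j, i ≤ j → (Y : Mat3) i j = 0) ∧ ∀ i j, j < i → (Z : Mat3) i j = 0 := by
  let Y : Sl3 := ⟨Matrix.of fun i j => if j < i then (X : Mat3) i j else 0, by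
    rw [mem_sl]; simp [Matrix.trace]⟩
  refine ⟨Y, X - Y, by abel, fun i j hij => ?_, fun i j hij => ?_⟩
  · simp [Y, not_lt.2 hij]
  · change (X : Mat3) i j - (Y : Mat3) i j = 0
    simp [Y, hij]

theorem irrepLie_mul_mulVec (X Y : Sl3) (w : Fin (irrepDim n) → ℂ) :
    irrepLie n X *ᵥ (irrepLie n Y *ᵥ w) =
      irrepLie n Y *ᵥ (irrepLie n X *ᵥ w) + irrepLie n ⁅X, Y⁆ *ᵥ w := by
  rw [LieHom.map_lie, LieRing.of_associative_ring_bracket, Matrix.sub_mulVec,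
    ← Matrix.mulVec_mulVec, ← Matrix.mulVec_mulVec]
  abel

/-- The highest weight vector generates the representation under lowering operators. -/
theorem eq_top_of_lowering_invariant {Z : Submodule ℂ (Fin (irrepDim n) → ℂ)}
    (h0 : irrepHw n ∈ Z) (hZ : ∀ X : Sl3, (∀ i j, i ≤ j → (X : Mat3) i j = 0) →
      ∀ w ∈ Z, irrepLie n X *ᵥ w ∈ Z) : Z = ⊤ := by
  let P : Submodule ℂ (Fin (irrepDim n) → ℂ) → Prop := fun Z => irrepHw n ∈ Z ∧
    ∀ X : Sl3, (∀ i j, i ≤ j → (X : Mat3) i j = 0) → ∀ w ∈ Z, irrepLie n X *ᵥ w ∈ Z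
  let L : Submodule ℂ (Fin (irrepDim n) → ℂ) := sInf {Z | P Z}
  have hL0 : irrepHw n ∈ L := Submodule.mem_sInf.2 fun Z hZ => hZ.1
  have hL : ∀ X : Sl3, (∀ i j, i ≤ j → (X : Mat3) i j = 0) → ∀ w ∈ L, irrepLie n X *ᵥ w ∈ L :=
    fun X hX w hw => Submodule.mem_sInf.2 fun Z hZ =>
      hZ.2 X hX w (Submodule.mem_sInf.1 hw Z hZ)
  let L' : Submodule ℂ (Fin (irrepDim n) → ℂ) :=
    { carrier := {w | w ∈ L ∧ ∀ X : Sl3, (∀ i j, j < i → (X : Mat3) i j = 0) →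
        irrepLie n X *ᵥ w ∈ L}
      add_mem' := fun {v w} hv hw => ⟨add_mem hv.1 hw.1, fun X hX => by
        rw [Matrix.mulVec_add]
        exact add_mem (hv.2 X hX) (hw.2 X hX)⟩
      zero_mem' := ⟨zero_mem _, fun X _ => by rw [Matrix.mulVec_zero]; exact zero_mem _⟩
      smul_mem' := fun c w hw => ⟨L.smul_mem c hw.1, fun X hX => by
        rw [Matrix.mulVec_smul]
        exact L.smul_mem c (hw.2 X hX)⟩ }
  have hL' : P L' := by
    refine ⟨⟨hL0, fun X hX => ?_⟩, fun F hF w hw => ⟨hL F hF w hw.1, fun X hX => ?_⟩⟩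
    · obtain ⟨c, hc⟩ := irrepLie_upper_mulVec_irrepHw (n := n) hX
      rw [hc]
      exact L.smul_mem c hL0
    · obtain ⟨Y, V, hYV, hY, hV⟩ := exists_lower_add_upper ⁅X, F⁆
      rw [irrepLie_mul_mulVec, hYV, map_add, Matrix.add_mulVec]
      exact add_mem (hL F hF _ (hw.2 X hX)) (add_mem (hL Y hY w hw.1) (hw.2 V hV))
  have hLL' : L ≤ L' := sInf_le hL'
  have hinv : ∀ X : Sl3, ∀ v ∈ L, irrepLie n X *ᵥ v ∈ L := by
    intro X v hv
    obtain ⟨Y, V, hYV, hY, hV⟩ := exists_lower_add_upper X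
    rw [hYV, map_add, Matrix.add_mulVec]
    exact add_mem (hL Y hY v hv) ((hLL' hv).2 V hV)
  have hLZ : L ≤ Z := sInf_le ⟨h0, hZ⟩
  rcases eq_bot_or_top_of_irrepLie_invariant hinv with h | h
  · rw [h] at hL0
    exact absurd ((Submodule.mem_bot ℂ).1 hL0) irrepHw_ne_zero
  · exact eq_top_iff.2 (h ▸ hLZ)

theorem berezin_injective (h : Compatible n z) : Function.Injective (berezin n z) := by
  rw [injective_iff_map_eq_zero]
  have hN : ∀ A : IrrepOp n, berezin n z A = 0 → ∀ X : Sl3,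
      berezin n z (irrepLie n X * A - A * irrepLie n X) = 0 := by
    intro A hA X
    funext Y
    have hf : berezin n z A = restr (orbit (chamberPt z)) 0 := by
      rw [hA]
      funext Y
      simp [restr, polyFun]
    rw [berezin_lie h hf]
    have : gradMat 0 Y = 0 := by
      ext i j
      simp [gradMat, polyFun]
    rw [poisson_linPoly, this]
    simp
  have hv : ∀ A : IrrepOp n, berezin n z A = 0 → star (irrepHw n) ⬝ᵥ (A *ᵥ irrepHw n) = 0 := by
    intro A hA
    have := berezin_orbitPt h A 1
    rw [hA, coherentVec_one] at this
    exact this.symm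
  have move : ∀ (A : IrrepOp n) (X : Sl3) (u w : Fin (irrepDim n) → ℂ),
      star u ⬝ᵥ (A *ᵥ (irrepLie n X *ᵥ w)) = star (irrepLie n (slStar X) *ᵥ u) ⬝ᵥ (A *ᵥ w) -
        star u ⬝ᵥ ((irrepLie n X * A - A * irrepLie n X) *ᵥ w) := by
    intro A X u w
    rw [irrepLie_star, Matrix.star_mulVec, Matrix.conjTranspose_conjTranspose,
      ← Matrix.dotProduct_mulVec, Matrix.sub_mulVec, dotProduct_sub, Matrix.mulVec_mulVec,
      Matrix.mulVec_mulVec]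
    abel
  have hright : ∀ w, ∀ A : IrrepOp n, berezin n z A = 0 →
      star (irrepHw n) ⬝ᵥ (A *ᵥ w) = 0 := by
    let Z : Submodule ℂ (Fin (irrepDim n) → ℂ) :=
      { carrier := {w | ∀ A : IrrepOp n, berezin n z A = 0 → star (irrepHw n) ⬝ᵥ (A *ᵥ w) = 0}
        add_mem' := fun {v w} hv hw A hA => by
          rw [Matrix.mulVec_add, dotProduct_add, hv A hA, hw A hA, add_zero]
        zero_mem' := fun A _ => by rw [Matrix.mulVec_zero, dotProduct_zero]
        smul_mem' := fun c w hw A hA => by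
          rw [Matrix.mulVec_smul, dotProduct_smul, hw A hA, smul_zero] }
    have hZ : Z = ⊤ := eq_top_of_lowering_invariant hv fun X hX w hw A hA => by
      rw [move, irrepLie_strictUpper_mulVec_irrepHw, star_zero, zero_dotProduct, zero_sub,
        neg_eq_zero]
      · exact hw _ (hN A hA X)
      · intro i j hij
        change star ((X : Mat3) j i) = 0
        rw [hX j i hij, star_zero]
    intro w
    have : w ∈ Z := hZ ▸ Submodule.mem_top
    exact this
  have hleft : ∀ u, ∀ A : IrrepOp n, berezin n z A = 0 → ∀ w, star u ⬝ᵥ (A *ᵥ w) = 0 := by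
    let Z : Submodule ℂ (Fin (irrepDim n) → ℂ) :=
      { carrier := {u | ∀ A : IrrepOp n, berezin n z A = 0 → ∀ w, star u ⬝ᵥ (A *ᵥ w) = 0}
        add_mem' := fun {v w} hv hw A hA x => by
          rw [star_add, add_dotProduct, hv A hA, hw A hA, add_zero]
        zero_mem' := fun A _ x => by rw [star_zero, zero_dotProduct]
        smul_mem' := fun c w hw A hA x => by
          rw [star_smul, smul_dotProduct, hw A hA, smul_zero] }
    have hZ : Z = ⊤ := eq_top_of_lowering_invariant (fun A hA w => hright w A hA)
      fun X _ u hu A hA w => by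
        have e : slStar (slStar X) = X := Subtype.ext (Matrix.conjTranspose_conjTranspose _)
        have := move A (slStar X) u w
        rw [e, hu A hA, hu _ (hN A hA _), sub_zero] at this
        exact this.symm
    intro w
    have : w ∈ Z := hZ ▸ Submodule.mem_top
    exact this
  intro A hA
  ext i j
  have := hleft (Pi.single i 1) A hA (Pi.single j 1)
  rw [← Pi.single_star, star_one, single_one_dotProduct, Matrix.mulVec_single_one] at this
  exact this

end Injective

section Normalization

open Matrix

variable {n : Bool → ℕ} {z : Bool → ℝ}

/-- Schur's lemma. -/
theorem exists_eq_smul_one_of_commute {A : IrrepOp n}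
    (hA : ∀ g : SU3, irrepU n g * A = A * irrepU n g) : ∃ c : ℂ, A = c • 1 := by
  have : Nontrivial (Fin (irrepDim n) → ℂ) := ⟨⟨_, _, irrepHw_ne_zero⟩⟩
  obtain ⟨c, hc⟩ := Module.End.exists_eigenvalue (Matrix.toLin' A)
  refine ⟨c, ?_⟩
  have hmem : ∀ v, v ∈ Module.End.eigenspace (Matrix.toLin' A) c ↔ A *ᵥ v = c • v := fun v => by
    rw [Module.End.mem_eigenspace_iff, Matrix.toLin'_apply]
  have hinv : ∀ g, ∀ v ∈ Module.End.eigenspace (Matrix.toLin' A) c,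
      irrepU n g *ᵥ v ∈ Module.End.eigenspace (Matrix.toLin' A) c := fun g v hv => by
    rw [hmem] at hv ⊢
    rw [Matrix.mulVec_mulVec, ← hA, ← Matrix.mulVec_mulVec, hv, Matrix.mulVec_smul]
  have hirr : Module.End.eigenspace (Matrix.toLin' A) c = ⊥ ∨
      Module.End.eigenspace (Matrix.toLin' A) c = ⊤ := (quark n).irreducible _ hinv
  rcases hirr with h | h
  · exact absurd h hc
  · refine Matrix.ext_of_mulVec_single fun i => ?_
    have : (Pi.single i 1 : Fin (irrepDim n) → ℂ) ∈ Module.End.eigenspace (Matrix.toLin' A) c := by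
      rw [h]; exact Submodule.mem_top
    rw [(hmem _).1 this, Matrix.smul_mulVec, Matrix.one_mulVec]

instance : IsProbabilityMeasure haarSU3 := ⟨by
  have := Measure.haarMeasure_self (G := SU3) (K₀ := ⊤)
  exact this⟩

instance : haarSU3.IsMulLeftInvariant := by
  unfold haarSU3
  infer_instance

theorem continuous_coherentVec : Continuous fun g : SU3 => coherentVec n g := by
  have h : Continuous fun g : SU3 => compress n (tensGrp n (g : Mat3)) := by
    have h1 : Continuous fun g : SU3 => tensGrp n (g : Mat3) := by
      refine continuous_matrix fun I J => ?_
      change Continuous fun g : SU3 => ∏ k : Idx n, slotGrp k.1 (g : Mat3) (I k) (J k)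
      refine continuous_finsetProd _ fun k _ => ?_
      obtain ⟨b, k⟩ := k
      cases b
      · exact (continuous_subtype_val.matrix_elem _ _).star
      · exact continuous_subtype_val.matrix_elem _ _
    simp only [compress_apply]
    fun_prop
  exact h.matrix_mulVec continuous_const

theorem integral_berezin (h : Compatible n z) (A : IrrepOp n) :
    ∫ g, berezin n z A (orbitPt _ g) ∂haarSU3 = trace A / (irrepDim n : ℂ) := by
  let Q : SU3 → IrrepOp n := fun g => vecMulVec (coherentVec n g) (star (coherentVec n g))
  have hQc : ∀ i j, Integrable (fun g => Q g i j) haarSU3 := fun i j => by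
    have : Continuous fun g => Q g i j := by
      have h1 := continuous_coherentVec (n := n)
      exact ((continuous_apply i).comp h1).mul ((continuous_apply j).comp h1).star
    exact this.integrable_of_hasCompactSupport (HasCompactSupport.of_compactSpace _)
  let M : IrrepOp n := Matrix.of fun i j => ∫ g, Q g i j ∂haarSU3
  have hint : ∀ B : IrrepOp n, ∫ g, trace (B * Q g) ∂haarSU3 = trace (B * M) := fun B => by
    have e : ∀ C : IrrepOp n, trace (B * C) = ∑ i, ∑ j, B i j * C j i := fun _ => rfl
    simp only [e]
    refine (integral_finsetSum _ fun i _ => integrable_finsetSum _ fun j _ =>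
      (hQc j i).const_mul _).trans (Finset.sum_congr rfl fun i _ => ?_)
    refine (integral_finsetSum _ fun j _ => (hQc j i).const_mul _).trans
      (Finset.sum_congr rfl fun j _ => ?_)
    exact integral_const_mul _ _
  have hB : ∀ B : IrrepOp n, ∀ g, berezin n z B (orbitPt _ g) = trace (B * Q g) := fun B g => by
    rw [berezin_orbitPt h, Matrix.mul_vecMulVec, Matrix.trace_vecMulVec, dotProduct_comm]
  have hinv : ∀ (k : SU3) (B : IrrepOp n),
      trace (irrepU n k * B * irrepU n k⁻¹ * M) = trace (B * M) := fun k B => by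
    rw [← hint, ← hint, ← integral_mul_left_eq_self _ k]
    refine integral_congr_ae (Eventually.of_forall fun g => ?_)
    change trace (irrepU n k * B * irrepU n k⁻¹ * Q (k * g)) = trace (B * Q g)
    rw [← hB, ← hB, berezin_equivariant h]
  have hcomm : ∀ k : SU3, irrepU n k * M = M * irrepU n k := by
    intro k
    have h1 : irrepU n k⁻¹ * M * irrepU n k = M := by
      refine Matrix.ext_iff_trace_mul_left.2 fun B => ?_
      rw [← hinv k B]
      rw [← Matrix.mul_assoc B, Matrix.trace_mul_comm _ (irrepU n k)]
      simp only [Matrix.mul_assoc]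
    calc irrepU n k * M = irrepU n k * (irrepU n k⁻¹ * M * irrepU n k) := by rw [h1]
      _ = (irrepU n k * irrepU n k⁻¹) * M * irrepU n k := by simp only [Matrix.mul_assoc]
      _ = _ := by rw [irrepU_mul_inv, Matrix.one_mul]
  obtain ⟨c, hc⟩ := exists_eq_smul_one_of_commute hcomm
  have h1 : trace ((1 : IrrepOp n) * M) = 1 := by
    rw [← hint]
    simp only [← hB, berezin_one h]
    simp
  rw [hc, mul_smul_comm, Matrix.one_mul, Matrix.trace_smul, Matrix.trace_one, Fintype.card_fin,
    smul_eq_mul] at h1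
  have hd : (irrepDim n : ℂ) ≠ 0 := fun h0 => by
    rw [h0, mul_zero] at h1
    exact zero_ne_one h1
  simp only [hB]
  rw [hint, hc, mul_smul_comm, Matrix.mul_one, Matrix.trace_smul, smul_eq_mul, eq_div_iff hd,
    mul_right_comm, h1, one_mul]

theorem irrepDim_ne_zero : (irrepDim n : ℂ) ≠ 0 := by
  have : Nonempty (Fin (irrepDim n)) := by
    by_contra h
    rw [not_nonempty_iff] at h
    exact irrepHw_ne_zero (n := n) (funext fun i => h.elim i)
  exact_mod_cast (Fin.pos_iff_nonempty.2 this).ne'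

end Normalization

section Rescaled

open Matrix

variable {n : Bool → ℕ} {z : Bool → ℝ}

variable (n z) in
/-- The Berezin symbol, rescaled by `1 + κ` on traceless operators. -/
def rescaled (κ : ℝ) : IrrepOp n →ₗ[ℂ] (orbit (chamberPt z) → ℂ) where
  toFun A Y := (1 + κ : ℂ) * berezin n z A Y - κ * (trace A / (irrepDim n : ℂ))
  map_add' A B := by
    funext Y
    simp only [map_add, Pi.add_apply, Matrix.trace_add]
    ring
  map_smul' c A := by
    funext Y
    simp only [map_smul, Pi.smul_apply, Matrix.trace_smul, smul_eq_mul, RingHom.id_apply]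
    ring

theorem rescaled_apply (κ : ℝ) (A : IrrepOp n) (Y : orbit (chamberPt z)) :
    rescaled n z κ A Y = (1 + κ : ℂ) * berezin n z A Y - κ * (trace A / (irrepDim n : ℂ)) := rfl

theorem integrable_berezin (h : Compatible n z) (A : IrrepOp n) :
    Integrable (fun g => berezin n z A (orbitPt _ g)) haarSU3 := by
  simp only [berezin_orbitPt h]
  have h1 := continuous_coherentVec (n := n)
  have : Continuous fun g : SU3 => star (coherentVec n g) ⬝ᵥ (A *ᵥ coherentVec n g) :=
    h1.star.dotProduct (continuous_const.matrix_mulVec h1)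
  exact this.integrable_of_hasCompactSupport (HasCompactSupport.of_compactSpace _)

theorem one_add_ne_zero {κ : ℝ} (hκ : 0 ≤ κ) : (1 + κ : ℂ) ≠ 0 := by
  have : (1 + κ : ℝ) ≠ 0 := by positivity
  exact_mod_cast this

theorem integral_rescaled (h : Compatible n z) (κ : ℝ) (A : IrrepOp n) :
    ∫ g, rescaled n z κ A (orbitPt _ g) ∂haarSU3 = trace A / (irrepDim n : ℂ) := by
  simp only [rescaled_apply]
  rw [integral_sub ((integrable_berezin h A).const_mul _) (integrable_const _), integral_const_mul,
    integral_berezin h, integral_const]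
  simp
  ring

theorem rescaled_injective (h : Compatible n z) {κ : ℝ} (hκ : 0 ≤ κ) :
    Function.Injective (rescaled n z κ) := by
  rw [injective_iff_map_eq_zero]
  intro A hA
  have h1 := integral_rescaled h κ A
  rw [hA] at h1
  simp only [Pi.zero_apply, integral_zero] at h1
  refine (injective_iff_map_eq_zero _).1 (berezin_injective h) A (funext fun Y => ?_)
  have h2 := congrFun hA Y
  rw [rescaled_apply, ← h1, mul_zero, sub_zero] at h2
  exact (mul_eq_zero.1 h2).resolve_left (one_add_ne_zero hκ)

theorem rescaled_poly (κ : ℝ) (A : IrrepOp n) :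
    ∃ f : Poly, rescaled n z κ A = restr (orbit (chamberPt z)) f := by
  obtain ⟨f, hf⟩ := berezin_poly n z A
  refine ⟨MvPolynomial.C (1 + κ : ℂ) * f -
    MvPolynomial.C (κ * (trace A / (irrepDim n : ℂ))), ?_⟩
  funext Y
  rw [rescaled_apply, hf]
  simp [restr, polyFun]

theorem rescaled_equivariant (h : Compatible n z) (κ : ℝ) (k g : SU3) (A : IrrepOp n) :
    rescaled n z κ (irrepU n k * A * irrepU n k⁻¹) (orbitPt _ (k * g)) =
      rescaled n z κ A (orbitPt _ g) := by
  rw [rescaled_apply, berezin_equivariant h, Matrix.trace_mul_comm, ← Matrix.mul_assoc,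
    irrepU_inv_mul, Matrix.one_mul, rescaled_apply]

theorem rescaled_real (h : Compatible n z) (κ : ℝ) (A : IrrepOp n) (Y : orbit (chamberPt z)) :
    rescaled n z κ (star A) Y = star (rescaled n z κ A Y) := by
  rw [rescaled_apply, rescaled_apply, berezin_real h, Matrix.star_eq_conjTranspose,
    Matrix.trace_conjTranspose]
  simp

theorem isSymbolCorrespondence_rescaled (h : Compatible n z) {κ : ℝ} (hκ : 0 ≤ κ) :
    (quark n).IsSymbolCorrespondence (chamberPt z) (rescaled n z κ) where
  poly := rescaled_poly κ
  injective := rescaled_injective h hκ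
  equivariant := rescaled_equivariant h κ
  real := rescaled_real h κ
  normalized := integral_rescaled h κ

variable (n) in
/-- The irreducible representation of `U(sl(3))`. -/
def irrepRep : USl3 →ₐ[ℂ] IrrepOp n := UniversalEnvelopingAlgebra.lift ℂ (irrepLie n)

theorem irrepRep_ι (X : Sl3) : irrepRep n (UniversalEnvelopingAlgebra.ι ℂ X) = irrepLie n X :=
  UniversalEnvelopingAlgebra.lift_ι_apply ℂ _ X

theorem irrepRep_surjective : Function.Surjective (irrepRep n) := by
  rw [← AlgHom.range_eq_top, eq_top_iff, ← adjoin_irrepLie]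
  refine Algebra.adjoin_le ?_
  rintro _ ⟨X, rfl⟩
  exact ⟨_, irrepRep_ι X⟩

theorem irrepRep_adAct (X : Sl3) (u : USl3) :
    irrepRep n (adAct X u) = irrepLie n X * irrepRep n u - irrepRep n u * irrepLie n X := by
  rw [adAct, map_sub, map_mul, map_mul, irrepRep_ι]

theorem exists_irrepRep_eq_smul_one {u : USl3} (hu : ∀ X : Sl3, adAct X u = 0) :
    ∃ c : ℂ, irrepRep n u = c • 1 := by
  have h : Algebra.adjoin ℂ (Set.range (irrepLie n)) ≤
      Subalgebra.centralizer ℂ {irrepRep n u} := by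
    refine Algebra.adjoin_le ?_
    rintro _ ⟨X, rfl⟩
    refine Set.mem_centralizer_iff.2 ?_
    rintro _ rfl
    have := irrepRep_adAct (n := n) X u
    rw [hu, map_zero, eq_comm, sub_eq_zero] at this
    exact this.symm
  rw [adjoin_irrepLie] at h
  refine exists_eq_smul_one_of_commute fun g => ?_
  exact (Subalgebra.mem_centralizer_iff ℂ |>.1 (h (Algebra.mem_top (x := irrepU n g))) _ rfl).symm

theorem trace_irrepRep_adAct (X : Sl3) (u : USl3) : trace (irrepRep n (adAct X u)) = 0 := by
  rw [irrepRep_adAct, Matrix.trace_sub, Matrix.trace_mul_comm, sub_self]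

theorem trace_irrepRep_of_nontrivial {N : Submodule ℂ USl3} (hN : IsAdIrreducible N)
    (hnt : ¬ ∀ X : Sl3, ∀ u ∈ N, adAct X u = 0) {u : USl3} (hu : u ∈ N) :
    trace (irrepRep n u) = 0 := by
  obtain ⟨hst, -, hirr⟩ := hN
  let N' : Submodule ℂ USl3 := Submodule.span ℂ {v | ∃ X : Sl3, ∃ u ∈ N, adAct X u = v}
  have hle : N' ≤ N := Submodule.span_le.2 (by
    rintro _ ⟨X, u, hu, rfl⟩
    exact hst X u hu)
  have hst' : IsAdStable N' := fun X u hu => Submodule.subset_span ⟨X, u, hle hu, rfl⟩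
  rcases hirr N' hle hst' with h | h
  · refine absurd (fun X u hu => ?_) hnt
    have : adAct X u ∈ N' := Submodule.subset_span ⟨X, u, hu, rfl⟩
    rwa [h, Submodule.mem_bot] at this
  · rw [← h] at hu
    have hle' : N' ≤ LinearMap.ker (Matrix.traceLinearMap _ ℂ ℂ ∘ₗ (irrepRep n).toLinearMap) :=
      Submodule.span_le.2 (by
        rintro _ ⟨X, u, -, rfl⟩
        exact trace_irrepRep_adAct X u)
    exact hle' hu

/-- The rescaled universal correspondence on the orbit of `ξ`; it is used for `ξ = chamberPt z`. -/
def univSymbol (ξ : Mat3) (n : Bool → ℕ) (z : Bool → ℝ) (κ : ℝ) : USl3 →ₗ[ℂ] (orbit ξ → ℂ) where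
  toFun u Y := (1 + κ : ℂ) * trace (irrepRep n u * compress n (coherent n z Y)) -
    κ * (trace (irrepRep n u) / (irrepDim n : ℂ))
  map_add' u v := by
    funext Y
    simp only [map_add, Pi.add_apply, Matrix.trace_add, Matrix.add_mul]
    ring
  map_smul' c u := by
    funext Y
    simp only [map_smul, Pi.smul_apply, Matrix.trace_smul, smul_eq_mul, RingHom.id_apply,
      smul_mul_assoc]
    ring

theorem univSymbol_chamberPt (κ : ℝ) (u : USl3) :
    univSymbol (chamberPt z) n z κ u = rescaled n z κ (irrepRep n u) := rfl

theorem isUniversal_univSymbol {ξ ω : Mat3} (hξ : ξ = chamberPt z) (h : Compatible n z)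
    (hω : ω = dominantWeight (n true) (n false)) {κ : ℝ} (hκ : 0 ≤ κ) :
    IsUniversal ξ ω (univSymbol ξ n z κ) := by
  subst hξ
  exact ⟨_, _, hω, quark n, rescaled n z κ, isSymbolCorrespondence_rescaled h hκ, fun u => rfl⟩

theorem univSymbol_rescaledBerezin {ξ ω : Mat3} (hξ : ξ = chamberPt z) (h : Compatible n z)
    (hω : ω = dominantWeight (n true) (n false)) (κ : ℝ) :
    ∃ b : USl3 →ₗ[ℂ] (orbit ξ → ℂ), IsUniversalBerezin ξ ω b ∧
      ∀ N : Submodule ℂ USl3, IsAdIrreducible N →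
        ((∀ X : Sl3, ∀ u ∈ N, adAct X u = 0) → ∀ u ∈ N, univSymbol ξ n z κ u = b u) ∧
        (¬ (∀ X : Sl3, ∀ u ∈ N, adAct X u = 0) → ∀ u ∈ N,
          univSymbol ξ n z κ u = ((1 + κ : ℝ) : ℂ) • b u) := by
  subst hξ
  refine ⟨berezin n z ∘ₗ (irrepRep n).toLinearMap,
    ⟨_, _, hω, quark n, berezin n z, isBerezin_berezin h, fun u => rfl⟩, fun N hN => ⟨?_, ?_⟩⟩
  · intro ht u hu
    obtain ⟨c, hc⟩ := exists_irrepRep_eq_smul_one (n := n) (fun X => ht X u hu)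
    funext Y
    rw [univSymbol_chamberPt, rescaled_apply]
    change _ = berezin n z (irrepRep n u) Y
    rw [hc, map_smul, Pi.smul_apply, berezin_one h, Matrix.trace_smul, Matrix.trace_one,
      Fintype.card_fin, smul_eq_mul, smul_eq_mul, mul_div_assoc, div_self irrepDim_ne_zero]
    ring
  · intro ht u hu
    funext Y
    rw [univSymbol_chamberPt, rescaled_apply, trace_irrepRep_of_nontrivial hN ht hu, zero_div,
      mul_zero, sub_zero, Complex.ofReal_add, Complex.ofReal_one]
    rfl

end Rescaled

section PureSymbols

open Matrix

variable {n : Bool → ℕ} {z : Bool → ℝ}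

variable (z) in
/-- The symbol of an operator on a single slot. -/
def slotSymbol (b : Bool) (W : Mat3) (Y : Mat3) : ℂ := trace (W * slotProj z b Y)

theorem slotProj_trace_mul (hz : ∀ b, 0 ≤ z b) {b : Bool} (hb : z b ≠ 0) (g : SU3) (W : Mat3) :
    slotSymbol z b W (Ad g (chamberPt z)) =
      trace (W * (slotGrp b g * Matrix.single (slotBase b) (slotBase b) 1 * (slotGrp b g)ᴴ)) := by
  rw [slotSymbol, slotProj_Ad hz hb]

theorem slotSymbol_one (hz : ∀ b, 0 ≤ z b) {b : Bool} (hb : z b ≠ 0) (Y : orbit (chamberPt z)) :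
    slotSymbol z b 1 Y = 1 := by
  obtain ⟨_, g, rfl⟩ := Y
  refine (slotProj_trace_mul hz hb g 1).trans ?_
  rw [Matrix.one_mul, Matrix.trace_mul_comm, ← Matrix.mul_assoc, ← slotGrp_star, ← slotGrp_mul,
    SU3_star_mul, slotGrp_one, Matrix.one_mul, Matrix.trace_single_eq_same]

/-- The linear functions on the orbit in terms of the slot symbols. -/
theorem trace_mul_orbit (hz : ∀ b, 0 ≤ z b) (W : Mat3) (Y : orbit (chamberPt z)) :
    trace (W * (Y : Mat3)) = ∑ b, Complex.I * z b * slotSymbol z b (slotLie b W) Y +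
      weightEntries z 1 * trace W := by
  obtain ⟨_, g, rfl⟩ := Y
  have ht : Complex.I * z true * slotSymbol z true (slotLie true W) (Ad g (chamberPt z)) =
      Complex.I * z true * trace (W * ((g : Mat3) * Matrix.single 0 0 1 * (g : Mat3)ᴴ)) := by
    by_cases hb : z true = 0
    · simp [hb]
    · rw [slotProj_trace_mul hz hb]
      simp [slotLie, slotGrp, slotBase]
  have hf : Complex.I * z false * slotSymbol z false (slotLie false W) (Ad g (chamberPt z)) =
      -(Complex.I * z false) * trace (W * ((g : Mat3) * Matrix.single 2 2 1 * (g : Mat3)ᴴ)) := by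
    by_cases hb : z false = 0
    · simp [hb]
    · rw [slotProj_trace_mul hz hb]
      have h1 : slotGrp false (g : Mat3) * Matrix.single (slotBase false) (slotBase false) 1 *
          (slotGrp false (g : Mat3))ᴴ = ((g : Mat3) * Matrix.single 2 2 1 * (g : Mat3)ᴴ)ᵀ := by
        have h : ((g : Mat3)ᴴᵀ)ᴴ = (g : Mat3)ᵀ := by
          ext i j; simp [Matrix.conjTranspose_apply]
        rw [Matrix.transpose_mul, Matrix.transpose_mul, Matrix.transpose_single]
        simp [slotGrp, slotBase, h, Matrix.mul_assoc]
      have h2 : slotLie false W = -Wᵀ := by simp [slotLie]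
      rw [h1, h2, Matrix.neg_mul, Matrix.trace_neg, ← Matrix.transpose_mul, Matrix.trace_transpose,
        Matrix.trace_mul_comm]
      ring
  obtain ⟨e01, e12, -⟩ := weightEntries_sub z
  have hD : diagonal (weightEntries z) = (Complex.I * z true) • Matrix.single 0 0 (1 : ℂ) +
      (-(Complex.I * z false)) • Matrix.single 2 2 (1 : ℂ) + weightEntries z 1 • (1 : Mat3) := by
    rw [← e01, ← e12]
    ext i j
    fin_cases i <;> fin_cases j <;> simp
  rw [Fintype.sum_bool]
  change trace (W * Ad g (chamberPt z)) = _ + _ + _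
  have hc : chamberPt z = diagonal (weightEntries z) := weight_eq_diagonal z
  rw [ht, hf, hc, hD, Ad, coe_inv_SU3]
  simp only [Matrix.mul_add, Matrix.add_mul, mul_smul_comm, smul_mul_assoc, Matrix.trace_add,
    Matrix.trace_smul, Matrix.mul_one, SU3_mul_star, smul_eq_mul]

/-- A matrix for each slot. -/
abbrev SlotData : Type := Bool → ℕ → Mat3

variable (n z) in
/-- The product of the symbols of single slot operators. -/
def pureSymbol (M : SlotData) (Y : orbit (chamberPt z)) : ℂ :=
  ∏ b, ∏ k ∈ Finset.range (n b), slotSymbol z b (M b k) Y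

variable (n) in
/-- The compression of a product of single slot operators. -/
def pureOp (M : SlotData) : IrrepOp n := compress n (kron fun k : Idx n => M k.1 k.2)

theorem berezin_pureOp (h : Compatible n z) (M : SlotData) :
    berezin n z (pureOp n M) = pureSymbol n z M := by
  funext Y
  rw [pureOp, berezin_compress h, coherent, kron_mul, trace_kron, Fintype.prod_sigma]
  refine Finset.prod_congr rfl fun b _ => ?_
  rw [Finset.prod_range]
  rfl

open scoped Matrix.Norms.L2Operator in
theorem norm_compress_le (T : Matrix (Idx n → Fin 3) (Idx n → Fin 3) ℂ) :
    ‖compress n T‖ ≤ ‖T‖ := by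
  have h1 : ‖isom n‖ * ‖isom n‖ ≤ 1 := by
    rw [← Matrix.l2_opNorm_conjTranspose_mul_self, isom_star_mul]
    by_cases hd : Nonempty (Fin (irrepDim n))
    · exact (norm_one).le
    · rw [not_nonempty_iff] at hd
      rw [Subsingleton.elim (1 : IrrepOp n) 0, norm_zero]
      exact zero_le_one
  calc ‖compress n T‖ ≤ ‖(isom n)ᴴ * T‖ * ‖isom n‖ := Matrix.l2_opNorm_mul _ _
    _ ≤ ‖(isom n)ᴴ‖ * ‖T‖ * ‖isom n‖ :=
        mul_le_mul_of_nonneg_right (Matrix.l2_opNorm_mul _ _) (norm_nonneg _)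
    _ = ‖T‖ * (‖isom n‖ * ‖isom n‖) := by rw [Matrix.l2_opNorm_conjTranspose]; ring
    _ ≤ ‖T‖ * 1 := mul_le_mul_of_nonneg_left h1 (norm_nonneg _)
    _ = ‖T‖ := mul_one _

open scoped Matrix.Norms.L2Operator in
theorem norm_pureOp_le (M : SlotData) :
    ‖pureOp n M‖ ≤ ∏ b, ∏ k ∈ Finset.range (n b), ‖M b k‖ := by
  refine (norm_compress_le _).trans ((norm_kron_le _).trans_eq ?_)
  rw [Fintype.prod_sigma]
  refine Finset.prod_congr rfl fun b _ => ?_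
  rw [Finset.prod_range]

/-- Replace the matrix of the slot `(b, k)`. -/
def SlotData.set (M : SlotData) (b : Bool) (k : ℕ) (W : Mat3) : SlotData :=
  Function.update M b (Function.update (M b) k W)

theorem SlotData.set_same (M : SlotData) (b : Bool) (k : ℕ) (W : Mat3) : M.set b k W b k = W := by
  simp [SlotData.set]

theorem SlotData.set_of_ne (M : SlotData) {b : Bool} {k : ℕ} (W : Mat3) {b' : Bool} {k' : ℕ}
    (h : ¬ (b' = b ∧ k' = k)) : M.set b k W b' k' = M b' k' := by
  by_cases hb : b' = b
  · subst hb
    have hk : k' ≠ k := fun hk => h ⟨rfl, hk⟩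
    simp [SlotData.set, hk]
  · simp [SlotData.set, hb]

theorem pureOp_mul_irrepLie (M : SlotData) (X : Sl3) :
    pureOp n M * irrepLie n X =
      ∑ b, ∑ k ∈ Finset.range (n b), pureOp n (M.set b k (M b k * slotLie b (X : Mat3))) := by
  have key : ∀ k : Idx n, pureOp n (M.set k.1 k.2 (M k.1 k.2 * slotLie k.1 (X : Mat3))) =
      compress n ((kron fun k : Idx n => M k.1 k.2) * slot k (slotLie k.1 (X : Mat3))) := by
    intro k
    rw [kron_mul_slot, pureOp]
    congr 2
    funext l
    by_cases h : l = k
    · subst h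
      rw [SlotData.set_same, Function.update_self]
    · rw [Function.update_of_ne h, SlotData.set_of_ne]
      rintro ⟨h1, h2⟩
      obtain ⟨b, k⟩ := k
      obtain ⟨b', k'⟩ := l
      obtain rfl : b' = b := h1
      exact h (congrArg (Sigma.mk b') (Fin.ext h2))
  rw [irrepLie_apply, pureOp, ← compress_mul n _ (tensLie_mem_tensStab n _), tensLie_apply,
    Matrix.mul_sum, map_sum, ← Finset.sum_congr rfl fun k _ => key k, Fintype.sum_sigma]
  refine Finset.sum_congr rfl fun b _ => ?_
  rw [Finset.sum_range]

theorem pureSymbol_set (M : SlotData) {b : Bool} {k : ℕ} (hk : k < n b) (W : Mat3)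
    (Y : orbit (chamberPt z)) : pureSymbol n z (M.set b k W) Y * slotSymbol z b (M b k) Y =
      slotSymbol z b W Y * pureSymbol n z M Y := by
  have h : ∀ M : SlotData, pureSymbol n z M Y = slotSymbol z b (M b k) Y *
      (∏ l ∈ (Finset.range (n b)).erase k, slotSymbol z b (M b l) Y) *
      ∏ b' ∈ Finset.univ.erase b, ∏ l ∈ Finset.range (n b'), slotSymbol z b' (M b' l) Y := by
    intro M
    rw [Finset.mul_prod_erase _ (fun l => slotSymbol z b (M b l) Y) (Finset.mem_range.2 hk),
      Finset.mul_prod_erase _ (fun b' => ∏ l ∈ Finset.range (n b'), slotSymbol z b' (M b' l) Y)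
        (Finset.mem_univ b)]
    rfl
  have h1 : ∀ l ∈ (Finset.range (n b)).erase k, slotSymbol z b (M.set b k W b l) Y =
      slotSymbol z b (M b l) Y := fun l hl => by
    rw [SlotData.set_of_ne]
    exact fun h => Finset.ne_of_mem_erase hl h.2
  have h2 : ∀ b' ∈ Finset.univ.erase b,
      ∏ l ∈ Finset.range (n b'), slotSymbol z b' (M.set b k W b' l) Y =
      ∏ l ∈ Finset.range (n b'), slotSymbol z b' (M b' l) Y := fun b' hb' =>
    Finset.prod_congr rfl fun l _ => by
      rw [SlotData.set_of_ne]
      exact fun h => Finset.ne_of_mem_erase hb' h.1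
  rw [h, h M, SlotData.set_same, Finset.prod_congr rfl h1, Finset.prod_congr rfl h2]
  ring

end PureSymbols

section SymbolSpace

open Matrix

/-- The highest weight `s m`. -/
def scaled (s : ℕ) (m : Bool → ℕ) : Bool → ℕ := fun b => s * m b

/-- The chamber coordinates of `r⁻¹ m`. -/
def coords (m : Bool → ℕ) (r : ℝ) : Bool → ℝ := fun b => (m b : ℝ) / r

variable {m : Bool → ℕ} {r : ℝ}

theorem coords_nonneg (hr : 0 < r) (b : Bool) : 0 ≤ coords m r b :=
  div_nonneg (Nat.cast_nonneg _) hr.le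

theorem coords_ne_zero (hr : 0 < r) {b : Bool} (hb : m b ≠ 0) : coords m r b ≠ 0 :=
  div_ne_zero (Nat.cast_ne_zero.2 hb) hr.ne'

theorem compatible_scaled (hr : 0 < r) (s : ℕ) : Compatible (scaled s m) (coords m r) :=
  ⟨coords_nonneg hr, fun _ hb => coords_ne_zero hr (right_ne_zero_of_mul hb)⟩

theorem prod_scaled_eq {α : Type*} [CommMonoid α] (F : Bool → ℕ → α) {D s : ℕ} (hs : D ≤ s)
    (hF : ∀ b k, m b ≠ 0 → D ≤ k → F b k = 1) :
    ∏ b, ∏ k ∈ Finset.range (scaled s m b), F b k =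
      ∏ b, ∏ k ∈ Finset.range (scaled D m b), F b k := by
  refine Finset.prod_congr rfl fun b _ => (Finset.prod_subset ?_ fun k hk hk' => ?_).symm
  · exact Finset.range_subset_range.2 (Nat.mul_le_mul_right _ hs)
  · rw [Finset.mem_range, scaled] at hk hk'
    have hb : m b ≠ 0 := fun h => by simp [h] at hk
    refine hF b k hb ?_
    calc D = D * 1 := (mul_one D).symm
      _ ≤ D * m b := Nat.mul_le_mul_left D (Nat.one_le_iff_ne_zero.2 hb)
      _ ≤ k := not_lt.1 hk'

theorem pureSymbol_scaled (hr : 0 < r) {M : SlotData} {D s : ℕ} (hM : ∀ b k, D ≤ k → M b k = 1)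
    (hs : D ≤ s) : pureSymbol (scaled s m) (coords m r) M =
      pureSymbol (scaled D m) (coords m r) M := by
  funext Y
  refine prod_scaled_eq (fun b k => slotSymbol (coords m r) b (M b k) Y) hs fun b k hb hk => ?_
  rw [hM b k hk, slotSymbol_one (coords_nonneg hr) (coords_ne_zero hr hb)]

variable (m r) in
/-- The functions on the orbit that are spanned by products of slot symbols. -/
def symbolSpace : Submodule ℂ (orbit (chamberPt (coords m r)) → ℂ) :=
  Submodule.span ℂ {F | ∃ (D : ℕ) (M : SlotData), (∀ b k, D ≤ k → M b k = 1) ∧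
    F = pureSymbol (scaled D m) (coords m r) M}

theorem pureSymbol_mem (hr : 0 < r) {M : SlotData} {D s : ℕ} (hM : ∀ b k, D ≤ k → M b k = 1)
    (hs : D ≤ s) : pureSymbol (scaled s m) (coords m r) M ∈ symbolSpace m r := by
  rw [pureSymbol_scaled hr hM hs]
  exact Submodule.subset_span ⟨D, M, hM, rfl⟩

theorem set_eq_one {M : SlotData} {D : ℕ} (hM : ∀ b k, D ≤ k → M b k = 1) {b : Bool} {k E : ℕ}
    (hD : D ≤ E) (hk : k < E) (W : Mat3) : ∀ b' k', E ≤ k' → M.set b k W b' k' = 1 := by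
  intro b' k' hk'
  rw [SlotData.set_of_ne, hM b' k' (hD.trans hk')]
  rintro ⟨-, rfl⟩
  exact absurd hk (not_lt.2 hk')

theorem slotSymbol_mul_pureSymbol_mem (hr : 0 < r) {b : Bool} (hb : m b ≠ 0) (W : Mat3)
    {M : SlotData} {D : ℕ} (hM : ∀ b k, D ≤ k → M b k = 1) :
    (fun Y : orbit (chamberPt (coords m r)) => slotSymbol (coords m r) b W Y *
      pureSymbol (scaled D m) (coords m r) M Y) ∈ symbolSpace m r := by
  have h := pureSymbol_mem (m := m) hr (set_eq_one hM (b := b) (Nat.le_succ D) (Nat.lt_succ_self D) W)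
    le_rfl
  convert h using 1
  funext Y
  have hk : D < scaled (D + 1) m b := by
    calc D < (D + 1) * 1 := by omega
      _ ≤ (D + 1) * m b := Nat.mul_le_mul_left _ (Nat.one_le_iff_ne_zero.2 hb)
  have := pureSymbol_set (z := coords m r) M hk W Y
  rw [hM b D le_rfl, slotSymbol_one (coords_nonneg hr) (coords_ne_zero hr hb), mul_one,
    pureSymbol_scaled hr hM (Nat.le_succ D)] at this
  exact this.symm

theorem slotSymbol_mul_mem (hr : 0 < r) {b : Bool} (hb : m b ≠ 0) (W : Mat3)
    {F : orbit (chamberPt (coords m r)) → ℂ} (hF : F ∈ symbolSpace m r) :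
    (fun Y : orbit (chamberPt (coords m r)) => slotSymbol (coords m r) b W Y * F Y) ∈
      symbolSpace m r := by
  induction hF using Submodule.span_induction with
  | mem F h =>
    obtain ⟨D, M, hM, rfl⟩ := h
    exact slotSymbol_mul_pureSymbol_mem hr hb W hM
  | zero =>
    convert zero_mem (symbolSpace m r) using 1
    funext Y
    exact mul_zero _
  | add F G _ _ hF hG =>
    convert add_mem hF hG using 1
    funext Y
    exact mul_add _ _ _
  | smul c F _ hF =>
    convert Submodule.smul_mem _ c hF using 1
    funext Y
    exact mul_left_comm _ _ _

theorem const_mem (c : ℂ) (hr : 0 < r) :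
    (fun _ : orbit (chamberPt (coords m r)) => c) ∈ symbolSpace m r := by
  have h := Submodule.smul_mem _ c (pureSymbol_mem (m := m) hr (M := fun _ _ => 1) (D := 0) (s := 0)
    (fun _ _ _ => rfl) le_rfl)
  convert h using 1
  funext Y
  simp [pureSymbol, scaled]

theorem restr_mem (hr : 0 < r) (f : Poly) :
    restr (orbit (chamberPt (coords m r))) f ∈ symbolSpace m r := by
  induction f using MvPolynomial.induction_on with
  | C c =>
    convert const_mem (m := m) c hr using 1
    funext Y
    exact polyFun_C _ _
  | add p q hp hq =>
    convert add_mem hp hq using 1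
    funext Y
    exact polyFun_add _ _ _
  | mul_X p ij hp =>
    have e : restr (orbit (chamberPt (coords m r))) (p * MvPolynomial.X ij) =
        ∑ b, (Complex.I * coords m r b) • (fun Y : orbit (chamberPt (coords m r)) =>
          slotSymbol (coords m r) b (slotLie b (Matrix.single ij.2 ij.1 1)) Y *
            restr (orbit (chamberPt (coords m r))) p Y) +
        (weightEntries (coords m r) 1 * trace (Matrix.single ij.2 ij.1 (1 : ℂ))) •
          restr (orbit (chamberPt (coords m r))) p := by
      funext Y
      have h1 : (Y : Mat3) ij.1 ij.2 = trace (Matrix.single ij.2 ij.1 1 * (Y : Mat3)) := by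
        rw [Matrix.trace_single_mul, one_smul]
      have h2 := trace_mul_orbit (coords_nonneg hr) (Matrix.single ij.2 ij.1 1) Y
      change polyFun (p * MvPolynomial.X ij) Y = _
      rw [polyFun_mul, polyFun_X, h1, h2, Fintype.sum_bool, Fintype.sum_bool]
      simp only [Pi.add_apply, Pi.smul_apply, smul_eq_mul, restr]
      ring
    rw [e]
    refine add_mem (sum_mem fun b _ => ?_) (Submodule.smul_mem _ _ hp)
    by_cases hb : m b = 0
    · simp [coords, hb]
    · exact Submodule.smul_mem _ _ (slotSymbol_mul_mem hr hb _ hp)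

end SymbolSpace

section Leading

open Matrix

variable {m : Bool → ℕ} {r : ℝ}

theorem berezin_pureOp_mul_irrepLie (hr : 0 < r) {M : SlotData} {D s : ℕ}
    (hM : ∀ b k, D ≤ k → M b k = 1) (hs : D ≤ s) (X : Sl3) (Y : orbit (chamberPt (coords m r))) :
    berezin (scaled s m) (coords m r) (pureOp (scaled s m) M * irrepLie (scaled s m) X) Y =
      -(Complex.I * s * r) * trace ((X : Mat3) * (Y : Mat3)) * pureSymbol (scaled s m) (coords m r) M Y +
      ∑ b, (∑ k ∈ Finset.range (scaled D m b), pureSymbol (scaled s m) (coords m r)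
          (M.set b k (M b k * slotLie b (X : Mat3))) Y -
        scaled D m b * (slotSymbol (coords m r) b (slotLie b (X : Mat3)) Y *
          pureSymbol (scaled s m) (coords m r) M Y)) := by
  have h1 : ∀ b, ∑ k ∈ Finset.range (scaled s m b), pureSymbol (scaled s m) (coords m r)
        (M.set b k (M b k * slotLie b (X : Mat3))) Y =
      (scaled s m b : ℂ) * (slotSymbol (coords m r) b (slotLie b (X : Mat3)) Y *
          pureSymbol (scaled s m) (coords m r) M Y) +
      (∑ k ∈ Finset.range (scaled D m b), pureSymbol (scaled s m) (coords m r)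
          (M.set b k (M b k * slotLie b (X : Mat3))) Y -
        scaled D m b * (slotSymbol (coords m r) b (slotLie b (X : Mat3)) Y *
          pureSymbol (scaled s m) (coords m r) M Y)) := by
    intro b
    have hle : scaled D m b ≤ scaled s m b := Nat.mul_le_mul_right _ hs
    rw [← Finset.sum_range_add_sum_Ico _ hle]
    have h2 : ∀ k ∈ Finset.Ico (scaled D m b) (scaled s m b), pureSymbol (scaled s m) (coords m r)
        (M.set b k (M b k * slotLie b (X : Mat3))) Y =
        slotSymbol (coords m r) b (slotLie b (X : Mat3)) Y *
          pureSymbol (scaled s m) (coords m r) M Y := by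
      intro k hk
      rw [Finset.mem_Ico] at hk
      have hb : m b ≠ 0 := fun h => by simp [scaled, h] at hk
      have hDk : D ≤ k := calc
        D = D * 1 := (mul_one D).symm
        _ ≤ D * m b := Nat.mul_le_mul_left D (Nat.one_le_iff_ne_zero.2 hb)
        _ ≤ k := hk.1
      have := pureSymbol_set (z := coords m r) M hk.2 (M b k * slotLie b (X : Mat3)) Y
      rw [hM b k hDk, slotSymbol_one (coords_nonneg hr) (coords_ne_zero hr hb), mul_one,
        Matrix.one_mul] at this
      rw [hM b k hDk, Matrix.one_mul, this]
    rw [Finset.sum_congr rfl h2, Finset.sum_const, Nat.card_Ico, nsmul_eq_mul, Nat.cast_sub hle]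
    ring
  have hr' : (r : ℂ) ≠ 0 := by exact_mod_cast hr.ne'
  have h3 := trace_mul_orbit (coords_nonneg (m := m) hr) (X : Mat3) Y
  rw [mem_sl.1 X.2, mul_zero, add_zero, Fintype.sum_bool] at h3
  rw [pureOp_mul_irrepLie, map_sum, Finset.sum_apply]
  have h4 : ∀ b, berezin (scaled s m) (coords m r) (∑ k ∈ Finset.range (scaled s m b),
      pureOp (scaled s m) (M.set b k (M b k * slotLie b (X : Mat3)))) Y =
      ∑ k ∈ Finset.range (scaled s m b), pureSymbol (scaled s m) (coords m r)
        (M.set b k (M b k * slotLie b (X : Mat3))) Y := by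
    intro b
    rw [map_sum, Finset.sum_apply]
    exact Finset.sum_congr rfl fun k _ => congrFun (berezin_pureOp (compatible_scaled hr s) _) Y
  simp only [h4, h1]
  rw [Finset.sum_add_distrib]
  congr 1
  rw [h3, Fintype.sum_bool]
  simp only [coords, scaled, Complex.ofReal_div, Complex.ofReal_natCast, Nat.cast_mul]
  field_simp
  linear_combination ((s : ℂ) * pureSymbol (scaled s m) (coords m r) M Y *
    (m true * slotSymbol (coords m r) true (slotLie true (X : Mat3)) Y +
      m false * slotSymbol (coords m r) false (slotLie false (X : Mat3)) Y)) * Complex.I_sq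

theorem pureOp_one (n : Bool → ℕ) : pureOp n (fun _ _ => 1) = 1 := by
  rw [pureOp, kron_one, compress_one]

theorem berezin_irrepLie (hr : 0 < r) (s : ℕ) (X : Sl3) (Y : orbit (chamberPt (coords m r))) :
    berezin (scaled s m) (coords m r) (irrepLie (scaled s m) X) Y =
      -(Complex.I * s * r) * trace ((X : Mat3) * (Y : Mat3)) := by
  have h := berezin_pureOp_mul_irrepLie (m := m) hr (M := fun _ _ => 1) (D := 0) (s := s)
    (fun _ _ _ => rfl) (Nat.zero_le s) X Y
  have h1 : pureSymbol (scaled s m) (coords m r) (fun _ _ => 1) Y = 1 := by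
    rw [← berezin_pureOp (compatible_scaled hr s), pureOp_one, berezin_one (compatible_scaled hr s)]
  rw [pureOp_one, Matrix.one_mul, h1] at h
  rw [h]
  simp [scaled]

end Leading

section Sequences

open Matrix

variable {m : Bool → ℕ} {r : ℝ}

variable (m) in
/-- Sequences of operators, one for each weight of the ray. -/
abbrev OpSeq : Type := ∀ s : ℕ, IrrepOp (scaled s m)

variable (r) in
/-- The operators `A s` have Berezin symbol `F` for large `s`. -/
def HasSymbol (A : OpSeq m) (F : orbit (chamberPt (coords m r)) → ℂ) : Prop :=
  ∀ᶠ s in atTop, berezin (scaled s m) (coords m r) (A s) = F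

open scoped Matrix.Norms.L2Operator in
/-- `‖A s‖ = O(s⁻ᵏ)`. -/
def DecaysLike (k : ℕ) (A : OpSeq m) : Prop :=
  (fun s => ‖A s‖) =O[atTop] fun s : ℕ => ((s : ℝ)⁻¹) ^ k

theorem DecaysLike.congr {k : ℕ} {A B : OpSeq m} (hA : DecaysLike k A) (h : ∀ᶠ s in atTop, A s = B s) :
    DecaysLike k B :=
  Asymptotics.IsBigO.congr' hA (h.mono fun s hs => by simp only [hs]) EventuallyEq.rfl

open scoped Matrix.Norms.L2Operator in
theorem DecaysLike.add {k : ℕ} {A B : OpSeq m} (hA : DecaysLike k A) (hB : DecaysLike k B) :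
    DecaysLike k (A + B) :=
  (Asymptotics.IsBigO.of_norm_le (g := fun s => ‖A s‖ + ‖B s‖) fun s => by
    rw [norm_norm]; exact norm_add_le _ _).trans (Asymptotics.IsBigO.add hA hB)

open scoped Matrix.Norms.L2Operator in
theorem DecaysLike.neg {k : ℕ} {A : OpSeq m} (hA : DecaysLike k A) : DecaysLike k (-A) := by
  refine Asymptotics.IsBigO.congr_left hA fun s => ?_
  exact (norm_neg (A s)).symm

theorem DecaysLike.sub {k : ℕ} {A B : OpSeq m} (hA : DecaysLike k A) (hB : DecaysLike k B) :
    DecaysLike k (A - B) := by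
  rw [sub_eq_add_neg]
  exact hA.add hB.neg

open scoped Matrix.Norms.L2Operator in
theorem DecaysLike.mul {k l : ℕ} {A B : OpSeq m} (hA : DecaysLike k A) (hB : DecaysLike l B) :
    DecaysLike (k + l) (A * B) := by
  refine (Asymptotics.IsBigO.of_norm_le (g := fun s => ‖A s‖ * ‖B s‖) fun s => ?_).trans
    ((Asymptotics.IsBigO.mul hA hB).congr_right fun s => (pow_add _ _ _).symm)
  rw [norm_norm]
  exact norm_mul_le _ _

open scoped Matrix.Norms.L2Operator in
theorem DecaysLike.const_smul {k : ℕ} {A : OpSeq m} (hA : DecaysLike k A) (c : ℂ) :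
    DecaysLike k (c • A) := by
  refine Asymptotics.IsBigO.congr_left (Asymptotics.IsBigO.const_mul_left hA ‖c‖) fun s => ?_
  exact (norm_smul c (A s)).symm

open scoped Matrix.Norms.L2Operator in
theorem decaysLike_zero (k : ℕ) : DecaysLike k (0 : OpSeq m) := by
  refine Asymptotics.IsBigO.congr_left (Asymptotics.isBigO_zero _ _) fun s => ?_
  exact (norm_zero (E := IrrepOp (scaled s m))).symm

variable (r) in
/-- Multiplication by the semiclassical parameter `i / (s r)`. -/
def epsMul : OpSeq m →ₗ[ℂ] OpSeq m where
  toFun A s := (Complex.I / (s * r)) • A s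
  map_add' _ _ := funext fun _ => smul_add _ _ _
  map_smul' c A := funext fun s => smul_comm (Complex.I / (s * r)) c (A s)

theorem epsMul_mul (A B : OpSeq m) : epsMul r A * B = epsMul r (A * B) :=
  funext fun _ => smul_mul_assoc _ _ _

theorem mul_epsMul (A B : OpSeq m) : A * epsMul r B = epsMul r (A * B) :=
  funext fun _ => mul_smul_comm _ _ _

open scoped Matrix.Norms.L2Operator in
theorem DecaysLike.eps_mul {k : ℕ} {A : OpSeq m} (hA : DecaysLike k A) :
    DecaysLike (k + 1) (epsMul r A) := by
  have h := (Asymptotics.isBigO_refl (fun s : ℕ => (s : ℝ)⁻¹) atTop).const_mul_left |r|⁻¹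
  refine Asymptotics.IsBigO.congr (Asymptotics.IsBigO.mul hA h) (fun s => ?_) fun s => (pow_succ _ _).symm
  change _ = ‖(Complex.I / (s * r)) • A s‖
  rw [norm_smul, norm_div, norm_mul, Complex.norm_I, Complex.norm_natCast, Complex.norm_real,
    Real.norm_eq_abs]
  ring

theorem DecaysLike.of_le {k l : ℕ} (hkl : l ≤ k) {A : OpSeq m} (hA : DecaysLike k A) :
    DecaysLike l A := by
  refine Asymptotics.IsBigO.trans hA (Asymptotics.IsBigO.of_bound 1 ?_)
  filter_upwards [eventually_ge_atTop 1] with s hs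
  have h1 : (1 : ℝ) ≤ s := by exact_mod_cast hs
  rw [Real.norm_of_nonneg (by positivity), Real.norm_of_nonneg (by positivity), one_mul]
  exact pow_le_pow_of_le_one (by positivity) (inv_le_one_of_one_le₀ h1) hkl

theorem HasSymbol.add {A B : OpSeq m} {F G : orbit (chamberPt (coords m r)) → ℂ}
    (hA : HasSymbol r A F) (hB : HasSymbol r B G) : HasSymbol r (A + B) (F + G) := by
  filter_upwards [hA, hB] with s h1 h2
  rw [Pi.add_apply, map_add, h1, h2]

theorem HasSymbol.const_smul {A : OpSeq m} {F : orbit (chamberPt (coords m r)) → ℂ}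
    (hA : HasSymbol r A F) (c : ℂ) : HasSymbol r (c • A) (c • F) := by
  filter_upwards [hA] with s h1
  rw [Pi.smul_apply, map_smul, h1]

theorem HasSymbol.unique (hr : 0 < r) {A B : OpSeq m} {F : orbit (chamberPt (coords m r)) → ℂ}
    (hA : HasSymbol r A F) (hB : HasSymbol r B F) : ∀ᶠ s in atTop, A s = B s := by
  filter_upwards [hA, hB] with s h1 h2
  exact berezin_injective (compatible_scaled hr s) (h1.trans h2.symm)

theorem hasSymbol_zero : HasSymbol r (0 : OpSeq m) 0 :=
  Eventually.of_forall fun _ => map_zero _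

theorem hasSymbol_const (hr : 0 < r) (c : ℂ) : HasSymbol r (c • (1 : OpSeq m)) (fun _ => c) := by
  refine Eventually.of_forall fun s => funext fun Y => ?_
  rw [Pi.smul_apply, map_smul, Pi.smul_apply, Pi.one_apply, berezin_one (compatible_scaled hr s)]
  simp

variable (m) in
/-- The sequence of the operators `ρ(X)`. -/
def lieSeq (X : Sl3) : OpSeq m := fun s => irrepLie (scaled s m) X

theorem hasSymbol_lieSeq (hr : 0 < r) (X : Sl3) :
    HasSymbol r (epsMul r (lieSeq m X)) (restr _ (linPoly (X : Mat3))) := by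
  filter_upwards [eventually_ge_atTop 1] with s hs
  funext Y
  have h0 : (s : ℂ) ≠ 0 := by exact_mod_cast (by omega : s ≠ 0)
  have h1 : (r : ℂ) ≠ 0 := by exact_mod_cast hr.ne'
  change berezin _ _ ((Complex.I / (s * r)) • irrepLie (scaled s m) X) Y = polyFun _ _
  rw [map_smul, Pi.smul_apply, berezin_irrepLie hr, polyFun_linPoly, smul_eq_mul]
  field_simp
  rw [Complex.I_sq]
  ring

open scoped Matrix.Norms.L2Operator in
/-- Functions in the symbol space are symbols of bounded sequences of operators, whose products
with `ρ(X)` are known up to a lower order term. -/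
theorem exists_hasSymbol_mul_lieSeq (hr : 0 < r) (X : Sl3)
    {F : orbit (chamberPt (coords m r)) → ℂ} (hF : F ∈ symbolSpace m r) :
    ∃ A : OpSeq m, HasSymbol r A F ∧ DecaysLike 0 A ∧ ∃ g ∈ symbolSpace m r,
      ∀ᶠ s in atTop, berezin (scaled s m) (coords m r) (A s * irrepLie (scaled s m) X) =
        (-(Complex.I * s * r)) • (F * restr _ (linPoly (X : Mat3))) + g := by
  induction hF using Submodule.span_induction with
  | mem F h =>
    obtain ⟨D, M, hM, rfl⟩ := h
    refine ⟨fun s => pureOp (scaled s m) M, ?_, ?_, ?_⟩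
    · filter_upwards [eventually_ge_atTop D] with s hs
      rw [berezin_pureOp (compatible_scaled hr s), pureSymbol_scaled hr hM hs]
    · refine Asymptotics.IsBigO.of_bound
        (∏ b, ∏ k ∈ Finset.range (scaled D m b), ‖M b k‖) ?_
      filter_upwards [eventually_ge_atTop D] with s hs
      rw [norm_norm, pow_zero, norm_one, mul_one]
      refine (norm_pureOp_le M).trans_eq (prod_scaled_eq (fun b k => ‖M b k‖) hs fun b k _ hk => ?_)
      rw [hM b k hk, norm_one]
    · set E := D * (1 + m true + m false) with hE
      have hDE : D ≤ E := by
        calc D = D * 1 := (mul_one D).symm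
          _ ≤ E := Nat.mul_le_mul_left D (by omega)
      have hkE : ∀ b, ∀ k ∈ Finset.range (scaled D m b), k < E := fun b k hk => by
        refine (Finset.mem_range.1 hk).trans_le (Nat.mul_le_mul_left D ?_)
        cases b <;> omega
      refine ⟨∑ b, (∑ k ∈ Finset.range (scaled D m b), pureSymbol (scaled E m) (coords m r)
          (M.set b k (M b k * slotLie b (X : Mat3))) - (scaled D m b : ℂ) •
          fun Y : orbit (chamberPt (coords m r)) =>
          slotSymbol (coords m r) b (slotLie b (X : Mat3)) Y *
          pureSymbol (scaled D m) (coords m r) M Y), ?_, ?_⟩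
      · refine sum_mem fun b _ => sub_mem (sum_mem fun k hk => ?_) ?_
        · exact pureSymbol_mem hr (set_eq_one hM hDE (hkE b k hk) _) le_rfl
        · by_cases hb : m b = 0
          · simp [scaled, hb]
          · exact Submodule.smul_mem _ _ (slotSymbol_mul_pureSymbol_mem hr hb _ hM)
      · filter_upwards [eventually_ge_atTop E] with s hs
        funext Y
        rw [berezin_pureOp_mul_irrepLie hr hM (hDE.trans hs)]
        simp only [Pi.add_apply, Pi.smul_apply, Pi.mul_apply, Finset.sum_apply, Pi.sub_apply,
          smul_eq_mul]
        congr 1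
        · rw [pureSymbol_scaled hr hM (hDE.trans hs)]
          change _ = _ * (_ * polyFun _ _)
          rw [polyFun_linPoly]
          ring
        · refine Finset.sum_congr rfl fun b _ => ?_
          rw [pureSymbol_scaled hr hM (hDE.trans hs)]
          congr 1
          refine Finset.sum_congr rfl fun k hk => ?_
          rw [pureSymbol_scaled hr (set_eq_one hM hDE (hkE b k hk) _) hs]
  | zero =>
    refine ⟨0, hasSymbol_zero, decaysLike_zero 0, 0, zero_mem _, Eventually.of_forall fun s => ?_⟩
    rw [Pi.zero_apply, Matrix.zero_mul, map_zero, zero_mul, smul_zero, add_zero]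
  | add F G _ _ hF hG =>
    obtain ⟨A, hA, hA', g, hg, h1⟩ := hF
    obtain ⟨B, hB, hB', k, hk, h2⟩ := hG
    refine ⟨A + B, hA.add hB, hA'.add hB', g + k, add_mem hg hk, ?_⟩
    filter_upwards [h1, h2] with s h1 h2
    rw [Pi.add_apply, Matrix.add_mul, map_add, h1, h2, add_mul, smul_add]
    abel
  | smul c F _ hF =>
    obtain ⟨A, hA, hA', g, hg, h1⟩ := hF
    refine ⟨c • A, hA.const_smul c, hA'.const_smul c, c • g, Submodule.smul_mem _ _ hg, ?_⟩
    filter_upwards [h1] with s h1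
    rw [Pi.smul_apply, smul_mul_assoc, map_smul, h1, smul_mul_assoc, smul_add, smul_comm]

theorem exists_hasSymbol (hr : 0 < r) {F : orbit (chamberPt (coords m r)) → ℂ}
    (hF : F ∈ symbolSpace m r) : ∃ A : OpSeq m, HasSymbol r A F ∧ DecaysLike 0 A := by
  obtain ⟨A, h1, h2, -⟩ := exists_hasSymbol_mul_lieSeq hr 0 hF
  exact ⟨A, h1, h2⟩

theorem HasSymbol.decaysLike (hr : 0 < r) {F : orbit (chamberPt (coords m r)) → ℂ}
    (hF : F ∈ symbolSpace m r) {A : OpSeq m} (hA : HasSymbol r A F) : DecaysLike 0 A := by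
  obtain ⟨B, h1, h2⟩ := exists_hasSymbol hr hF
  exact h2.congr (h1.unique hr hA)

theorem exists_mul_lieSeq (hr : 0 < r) (X : Sl3) {F : orbit (chamberPt (coords m r)) → ℂ}
    (hF : F ∈ symbolSpace m r) {A B : OpSeq m} (hA : HasSymbol r A F)
    (hB : HasSymbol r B (F * restr _ (linPoly (X : Mat3)))) :
    ∃ g ∈ symbolSpace m r, ∃ G : OpSeq m, HasSymbol r G g ∧ DecaysLike 0 G ∧
      ∀ᶠ s in atTop, (A * epsMul r (lieSeq m X)) s = (B + epsMul r G) s := by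
  obtain ⟨A', hA', -, g, hg, h1⟩ := exists_hasSymbol_mul_lieSeq hr X hF
  obtain ⟨G, hG, hG'⟩ := exists_hasSymbol hr hg
  refine ⟨g, hg, G, hG, hG', ?_⟩
  filter_upwards [h1, hB, hG, HasSymbol.unique hr hA' hA, eventually_ge_atTop 1] with s h1 h2 h3 h4 hs
  have h0 : (s : ℂ) ≠ 0 := by exact_mod_cast (by omega : s ≠ 0)
  have hr' : (r : ℂ) ≠ 0 := by exact_mod_cast hr.ne'
  have e : A s * irrepLie (scaled s m) X = (-(Complex.I * s * r)) • B s + G s := by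
    refine berezin_injective (compatible_scaled hr s) ?_
    rw [← h4, h1, map_add, map_smul, h2, h3]
  change A s * (Complex.I / (s * r)) • irrepLie (scaled s m) X = B s + (Complex.I / (s * r)) • G s
  rw [mul_smul_comm, e, smul_add, smul_smul]
  congr 1
  have : Complex.I / (s * r) * -(Complex.I * s * r) = 1 := by
    field_simp
    rw [Complex.I_sq, neg_neg]
  rw [this, one_smul]

theorem restr_mul (S : Set Mat3) (f h : Poly) : restr S (f * h) = restr S f * restr S h :=
  funext fun _ => polyFun_mul _ _ _

theorem restr_add (S : Set Mat3) (f h : Poly) : restr S (f + h) = restr S f + restr S h :=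
  funext fun _ => polyFun_add _ _ _

theorem exists_restr_eq (hr : 0 < r) {F : orbit (chamberPt (coords m r)) → ℂ}
    (hF : F ∈ symbolSpace m r) : ∃ f : Poly, F = restr _ f := by
  obtain ⟨A, hA, -⟩ := exists_hasSymbol hr hF
  obtain ⟨s, hs⟩ := hA.exists
  obtain ⟨f, hf⟩ := berezin_poly (scaled s m) (coords m r) (A s)
  exact ⟨f, hs.symm.trans hf⟩

theorem mul_restr_mem (hr : 0 < r) {F : orbit (chamberPt (coords m r)) → ℂ}
    (hF : F ∈ symbolSpace m r) (f : Poly) : F * restr _ f ∈ symbolSpace m r := by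
  obtain ⟨h, rfl⟩ := exists_restr_eq hr hF
  rw [← restr_mul]
  exact restr_mem hr _

/-- The traceless part of an elementary matrix. -/
def entrySl (ij : Fin 3 × Fin 3) : Sl3 :=
  ⟨Matrix.single ij.2 ij.1 1 - (trace (Matrix.single ij.2 ij.1 (1 : ℂ)) / 3) • (1 : Mat3), by
    rw [mem_sl, Matrix.trace_sub, Matrix.trace_smul, Matrix.trace_one]
    simp⟩

theorem coe_entrySl (ij : Fin 3 × Fin 3) : (entrySl ij : Mat3) =
    Matrix.single ij.2 ij.1 1 - (trace (Matrix.single ij.2 ij.1 (1 : ℂ)) / 3) • (1 : Mat3) := rfl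

theorem trace_orbit {z : Bool → ℝ} (Y : orbit (chamberPt z)) : trace (Y : Mat3) = 0 := by
  obtain ⟨_, g, rfl⟩ := Y
  change trace ((g : Mat3) * chamberPt z * (g : Mat3)ᴴ) = 0
  rw [Matrix.trace_mul_comm, ← Matrix.mul_assoc, SU3_star_mul, Matrix.one_mul, chamberPt, weight,
    Matrix.trace_smul, Matrix.trace_diagonal, Fin.sum_univ_three]
  simp
  ring

theorem restr_X {z : Bool → ℝ} (ij : Fin 3 × Fin 3) :
    restr (orbit (chamberPt z)) (MvPolynomial.X ij) = restr _ (linPoly (entrySl ij : Mat3)) := by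
  funext Y
  change polyFun _ _ = polyFun _ _
  rw [polyFun_X, polyFun_linPoly, coe_entrySl, Matrix.sub_mul, Matrix.trace_sub, smul_mul_assoc,
    Matrix.trace_smul, Matrix.one_mul, trace_orbit, smul_zero, sub_zero, Matrix.trace_single_mul,
    one_smul]

/-- The product of operators is the product of symbols up to `O(1/s)`. -/
theorem decaysLike_mul_sub (hr : 0 < r) {F : orbit (chamberPt (coords m r)) → ℂ}
    (hF : F ∈ symbolSpace m r) {A : OpSeq m} (hA : HasSymbol r A F) (h : Poly) :
    ∀ {H C : OpSeq m}, HasSymbol r H (restr _ h) → HasSymbol r C (F * restr _ h) →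
      DecaysLike 1 (A * H - C) := by
  induction h using MvPolynomial.induction_on with
  | C c =>
    intro H C hH hC
    have e : restr (orbit (chamberPt (coords m r))) (MvPolynomial.C c) = fun _ => c :=
      funext fun Y => polyFun_C _ _
    rw [e] at hH hC
    have e' : (F * fun _ => c) = c • F := funext fun Y => mul_comm _ _
    rw [e'] at hC
    refine (decaysLike_zero 1).congr ?_
    filter_upwards [hH.unique hr (hasSymbol_const hr c), hC.unique hr (hA.const_smul c)] with s h1 h2
    simp [h1, h2]
  | add p q hp hq =>
    intro H C hH hC
    obtain ⟨P, hP, -⟩ := exists_hasSymbol hr (restr_mem (m := m) hr p)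
    obtain ⟨Q, hQ, -⟩ := exists_hasSymbol hr (restr_mem (m := m) hr q)
    obtain ⟨P', hP', -⟩ := exists_hasSymbol hr (mul_restr_mem hr hF p)
    obtain ⟨Q', hQ', -⟩ := exists_hasSymbol hr (mul_restr_mem hr hF q)
    rw [restr_add] at hH hC
    rw [mul_add] at hC
    refine ((hp hP hP').add (hq hQ hQ')).congr ?_
    filter_upwards [hH.unique hr (hP.add hQ), hC.unique hr (hP'.add hQ')] with s h1 h2
    simp only [Pi.add_apply, Pi.sub_apply, Pi.mul_apply, h1, h2, mul_add]
    abel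
  | mul_X p ij hp =>
    intro H C hH hC
    obtain ⟨P, hP, -⟩ := exists_hasSymbol hr (restr_mem (m := m) hr p)
    obtain ⟨P', hP', -⟩ := exists_hasSymbol hr (mul_restr_mem hr hF p)
    rw [restr_mul, restr_X] at hH hC
    rw [← mul_assoc] at hC
    obtain ⟨-, -, G, -, hG, h1⟩ := exists_mul_lieSeq hr _ (restr_mem hr p) hP hH
    obtain ⟨-, -, K, -, hK, h2⟩ := exists_mul_lieSeq hr _ (mul_restr_mem hr hF p) hP' hC
    have hL := (hasSymbol_lieSeq (m := m) hr (entrySl ij)).decaysLike hr (restr_mem hr _)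
    have hA' := hA.decaysLike hr hF
    refine ((((hp hP hP').mul hL).sub (hA'.mul (hG.eps_mul (r := r)))).add
      (hK.eps_mul (r := r))).congr ?_
    filter_upwards [h1, h2] with s h1 h2
    simp only [Pi.add_apply, Pi.sub_apply, Pi.mul_apply] at h1 h2 ⊢
    rw [sub_mul, h2, mul_assoc, h1, mul_add]
    abel

end Sequences

section Bracket

open Matrix

variable {m : Bool → ℕ} {r : ℝ}

/-- The Poisson bracket of two polynomials, as a polynomial. -/
def poissonPoly (f h : Poly) : Poly :=
  ∑ i, ∑ j, MvPolynomial.X (i, j) * ∑ k,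
    (MvPolynomial.pderiv (k, j) f * MvPolynomial.pderiv (i, k) h -
      MvPolynomial.pderiv (k, j) h * MvPolynomial.pderiv (i, k) f)

theorem polyFun_poissonPoly (f h : Poly) (Y : Mat3) : polyFun (poissonPoly f h) Y = poisson f h Y := by
  simp [polyFun, poissonPoly, poisson, Matrix.trace, Matrix.mul_apply, gradMat]

theorem gradMat_add (p q : Poly) (Y : Mat3) : gradMat (p + q) Y = gradMat p Y + gradMat q Y := by
  ext i j
  simp [gradMat, polyFun]

theorem gradMat_mul (p q : Poly) (Y : Mat3) :
    gradMat (p * q) Y = polyFun p Y • gradMat q Y + polyFun q Y • gradMat p Y := by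
  ext i j
  simp [gradMat, polyFun]

theorem gradMat_C (c : ℂ) (Y : Mat3) : gradMat (MvPolynomial.C c) Y = 0 := by
  ext i j
  simp [gradMat, polyFun]

theorem gradMat_X (ij : Fin 3 × Fin 3) (Y : Mat3) :
    gradMat (MvPolynomial.X ij) Y = Matrix.single ij.2 ij.1 1 := by
  ext i j
  simp only [gradMat, of_apply, MvPolynomial.pderiv_X, Matrix.single_apply, polyFun]
  by_cases h : (j, i) = ij
  · subst h; simp
  · have h' : ¬ (ij.2 = i ∧ ij.1 = j) := fun h' => h (Prod.ext h'.2.symm h'.1.symm)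
    rw [if_neg h', Pi.single_eq_of_ne' h, map_zero]

theorem poisson_add (p q f : Poly) (Y : Mat3) : poisson (p + q) f Y = poisson p f Y + poisson q f Y := by
  simp only [poisson, gradMat_add, Matrix.add_mul, Matrix.mul_add, Matrix.mul_sub, Matrix.trace_add,
    Matrix.trace_sub]
  ring

theorem poisson_mul (p q f : Poly) (Y : Mat3) :
    poisson (p * q) f Y = polyFun p Y * poisson q f Y + polyFun q Y * poisson p f Y := by
  simp only [poisson, gradMat_mul, Matrix.add_mul, Matrix.mul_add, Matrix.mul_sub, Matrix.trace_add,
    Matrix.trace_sub, smul_mul_assoc, mul_smul_comm, Matrix.trace_smul, smul_eq_mul]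
  ring

theorem poisson_C (c : ℂ) (f : Poly) (Y : Mat3) : poisson (MvPolynomial.C c) f Y = 0 := by
  simp [poisson, gradMat_C]

theorem poisson_X (ij : Fin 3 × Fin 3) (f : Poly) (Y : Mat3) :
    poisson (MvPolynomial.X ij) f Y = poisson (linPoly (entrySl ij : Mat3)) f Y := by
  rw [poisson, poisson_linPoly, gradMat_X, coe_entrySl, Matrix.sub_mul, Matrix.mul_sub (gradMat f Y)]
  simp

theorem restr_poissonPoly_mul (S : Set Mat3) (p q f : Poly) : restr S (poissonPoly (p * q) f) =
    restr S p * restr S (poissonPoly q f) + restr S q * restr S (poissonPoly p f) := by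
  funext Y
  change polyFun _ _ = polyFun _ _ * polyFun _ _ + polyFun _ _ * polyFun _ _
  simp only [polyFun_poissonPoly, poisson_mul]

theorem epsMul_lieSeq_comm (hr : 0 < r) {f : Poly} {A C : OpSeq m} (hA : HasSymbol r A (restr _ f))
    (ij : Fin 3 × Fin 3) (hC : HasSymbol r C (restr _ (poissonPoly (MvPolynomial.X ij) f))) :
    ∀ᶠ s in atTop, (epsMul r (lieSeq m (entrySl ij)) * A - A * epsMul r (lieSeq m (entrySl ij))) s =
      epsMul r C s := by
  filter_upwards [hA, hC] with s h1 h2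
  have e : irrepLie (scaled s m) (entrySl ij) * A s - A s * irrepLie (scaled s m) (entrySl ij) =
      C s := by
    refine berezin_injective (compatible_scaled hr s) (funext fun Y => ?_)
    rw [berezin_lie (compatible_scaled hr s) h1, h2, ← poisson_X, ← polyFun_poissonPoly]
    rfl
  rw [epsMul_mul, mul_epsMul, ← map_sub]
  change (Complex.I / (s * r)) • (_ * _ - _ * _) = (Complex.I / (s * r)) • C s
  rw [← e]
  rfl

theorem HasSymbol.decaysLike_restr (hr : 0 < r) {f : Poly} {A : OpSeq m}
    (hA : HasSymbol r A (restr _ f)) : DecaysLike 0 A :=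
  hA.decaysLike hr (restr_mem hr f)

/-- The commutator of operators is the Poisson bracket of symbols up to `O(1/s²)`. -/
theorem decaysLike_comm_sub (hr : 0 < r) {f : Poly} {A : OpSeq m} (hA : HasSymbol r A (restr _ f))
    (h : Poly) : ∀ {H C : OpSeq m}, HasSymbol r H (restr _ h) →
      HasSymbol r C (restr _ (poissonPoly h f)) → DecaysLike 2 (H * A - A * H - epsMul r C) := by
  have hex : ∀ p : Poly, ∃ P : OpSeq m, HasSymbol r P (restr _ p) := fun p =>
    (exists_hasSymbol hr (restr_mem hr p)).imp fun _ h => h.1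
  have hA0 := hA.decaysLike_restr hr
  induction h using MvPolynomial.induction_on with
  | C c =>
    intro H C hH hC
    have e : restr (orbit (chamberPt (coords m r))) (MvPolynomial.C c) = fun _ => c :=
      funext fun Y => polyFun_C _ _
    have e' : restr (orbit (chamberPt (coords m r))) (poissonPoly (MvPolynomial.C c) f) = 0 :=
      funext fun Y => (polyFun_poissonPoly _ _ _).trans (poisson_C _ _ _)
    rw [e] at hH
    rw [e'] at hC
    refine (decaysLike_zero 2).congr ?_
    filter_upwards [hH.unique hr (hasSymbol_const hr c), hC.unique hr hasSymbol_zero] with s h1 h2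
    simp only [Pi.sub_apply, Pi.mul_apply, h1]
    change 0 = _ - (Complex.I / (s * r)) • C s
    simp [h2]
  | add p q hp hq =>
    intro H C hH hC
    obtain ⟨P, hP⟩ := hex p
    obtain ⟨Q, hQ⟩ := hex q
    obtain ⟨P', hP'⟩ := hex (poissonPoly p f)
    obtain ⟨Q', hQ'⟩ := hex (poissonPoly q f)
    have e : restr (orbit (chamberPt (coords m r))) (poissonPoly (p + q) f) =
        restr _ (poissonPoly p f) + restr _ (poissonPoly q f) := by
      funext Y
      change polyFun _ _ = polyFun _ _ + polyFun _ _
      simp only [polyFun_poissonPoly, poisson_add]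
    rw [restr_add] at hH
    rw [e] at hC
    refine ((hp hP hP').add (hq hQ hQ')).congr ?_
    filter_upwards [hH.unique hr (hP.add hQ), hC.unique hr (hP'.add hQ')] with s h1 h2
    have h3 : epsMul r C s = epsMul r P' s + epsMul r Q' s := by
      change (Complex.I / (s * r)) • C s = _
      rw [h2]
      exact smul_add _ _ _
    simp only [Pi.add_apply, Pi.sub_apply, Pi.mul_apply, h1, h3, add_mul, mul_add]
    abel
  | mul_X p ij hp =>
    intro H C hH hC
    obtain ⟨P, hP⟩ := hex p
    obtain ⟨P', hP'⟩ := hex (poissonPoly p f)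
    obtain ⟨L', hL'⟩ := hex (poissonPoly (MvPolynomial.X ij) f)
    obtain ⟨C₁, hC₁⟩ := hex (p * poissonPoly (MvPolynomial.X ij) f)
    obtain ⟨C₂, hC₂⟩ := hex (poissonPoly p f * MvPolynomial.X ij)
    have hL := hasSymbol_lieSeq (m := m) hr (entrySl ij)
    rw [← restr_X] at hL
    have hH' := hH
    rw [restr_mul, restr_X] at hH'
    obtain ⟨g, hg, G, hG, hG0, h1⟩ := exists_mul_lieSeq hr _ (restr_mem hr p) hP hH'
    obtain ⟨k, rfl⟩ := exists_restr_eq hr hg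
    have h2 := epsMul_lieSeq_comm hr hA ij hL'
    obtain ⟨K, hK⟩ := hex (f * k)
    have hK' : HasSymbol r K (restr _ k * restr _ f) := by
      rw [mul_comm, ← restr_mul]
      exact hK
    rw [restr_mul] at hC₁ hC₂ hK
    have d1 := decaysLike_mul_sub hr (restr_mem hr f) hA k hG hK
    have d2 := decaysLike_mul_sub hr (restr_mem hr k) hG f hA hK'
    have d3 := decaysLike_mul_sub hr (restr_mem hr p) hP _ hL' hC₁
    have d4 := decaysLike_mul_sub hr (restr_mem hr _) hP' _ hL hC₂
    have h3 := hC.unique hr (B := C₁ + C₂) (by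
      rw [restr_poissonPoly_mul, mul_comm (restr _ (MvPolynomial.X ij))]
      exact hC₁.add hC₂)
    have d5 := (((hp hP hP').mul (hL.decaysLike_restr hr)).add (d3.eps_mul (r := r))).add
      ((d4.eps_mul (r := r)).add ((d1.sub d2).eps_mul (r := r)))
    refine d5.congr ?_
    filter_upwards [h1, h2, h3] with s h1 h2 h3
    have h4 : epsMul r C s = epsMul r C₁ s + epsMul r C₂ s := by
      change (Complex.I / (s * r)) • C s = _
      rw [h3]
      exact smul_add _ _ _
    have h5 : H s = P s * epsMul r (lieSeq m (entrySl ij)) s - epsMul r G s := by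
      rw [eq_sub_iff_add_eq]
      exact h1.symm
    have h6 : epsMul r (A * G) s = A s * epsMul r G s := congrFun (mul_epsMul A G).symm s
    have h7 : epsMul r (G * A) s = epsMul r G s * A s := congrFun (epsMul_mul G A).symm s
    have h8 : epsMul r (P * L') s = P s * epsMul r L' s := congrFun (mul_epsMul P L').symm s
    have h9 : epsMul r (P' * epsMul r (lieSeq m (entrySl ij))) s =
        epsMul r P' s * epsMul r (lieSeq m (entrySl ij)) s := congrFun (epsMul_mul P' _).symm s
    simp only [map_sub, Pi.add_apply, Pi.sub_apply, Pi.mul_apply, h6, h7, h8, h9] at h2 ⊢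
    rw [← h2, h4, h5]
    noncomm_ring

end Bracket

section Correspondence

open Matrix

variable {n : Bool → ℕ} {z : Bool → ℝ}

open scoped Matrix.Norms.L2Operator in
theorem norm_trace_div_le (h : Compatible n z) (A : IrrepOp n) :
    ‖trace A / (irrepDim n : ℂ)‖ ≤ ‖A‖ := by
  rw [← integral_berezin h]
  refine (norm_integral_le_of_norm_le_const (C := ‖A‖)
    (Eventually.of_forall fun g => norm_berezin_le h A _)).trans_eq ?_
  simp

/-- The operator whose rescaled symbol is the Berezin symbol of `A`. -/
def unscale (κ : ℝ) (A : IrrepOp n) : IrrepOp n :=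
  (1 + κ : ℂ)⁻¹ • A + (κ / (1 + κ) * (trace A / (irrepDim n : ℂ)) : ℂ) • 1

theorem rescaled_unscale (h : Compatible n z) {κ : ℝ} (hκ : 0 ≤ κ) (A : IrrepOp n) :
    rescaled n z κ (unscale κ A) = berezin n z A := by
  funext Y
  have h1 := one_add_ne_zero hκ
  have h2 := irrepDim_ne_zero (n := n)
  rw [rescaled_apply, unscale, map_add, map_smul, map_smul, Pi.add_apply, Pi.smul_apply,
    Pi.smul_apply, berezin_one h, Matrix.trace_add, Matrix.trace_smul, Matrix.trace_smul,
    Matrix.trace_one, Fintype.card_fin]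
  simp only [smul_eq_mul]
  field_simp
  ring

open scoped Matrix.Norms.L2Operator in
theorem norm_unscale_sub_le (h : Compatible n z) {κ : ℝ} (hκ : 0 ≤ κ) (A : IrrepOp n) :
    ‖unscale κ A - A‖ ≤ 2 * κ * ‖A‖ := by
  have h1 := one_add_ne_zero hκ
  set c := trace A / (irrepDim n : ℂ)
  have h2 : ‖(κ / (1 + κ) : ℂ)‖ ≤ κ := by
    have : ((1 + κ : ℝ) : ℂ) = 1 + κ := by push_cast; rfl
    rw [norm_div, ← this, Complex.norm_real, Complex.norm_real, Real.norm_of_nonneg hκ,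
      Real.norm_of_nonneg (by positivity)]
    exact div_le_self hκ (by linarith)
  have e : unscale κ A - A = (κ / (1 + κ) : ℂ) • (c • (1 : IrrepOp n) - A) := by
    have : (1 + κ : ℂ)⁻¹ = 1 - κ / (1 + κ) := by field_simp; ring
    rw [unscale, this, smul_sub, sub_smul, one_smul, smul_smul]
    abel
  have h3 : ‖(1 : IrrepOp n)‖ ≤ 1 := by
    by_cases hd : Nonempty (Fin (irrepDim n))
    · exact (norm_one).le
    · rw [not_nonempty_iff] at hd
      rw [Subsingleton.elim (1 : IrrepOp n) 0, norm_zero]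
      exact zero_le_one
  rw [e, norm_smul]
  have h4 : ‖c • (1 : IrrepOp n) - A‖ ≤ 2 * ‖A‖ := by
    refine (norm_sub_le _ _).trans ?_
    rw [norm_smul]
    have := mul_le_mul (norm_trace_div_le h A) h3 (norm_nonneg _) (norm_nonneg _)
    linarith
  calc _ ≤ κ * (2 * ‖A‖) := mul_le_mul h2 h4 (norm_nonneg _) hκ
    _ = _ := by ring

open scoped Matrix.Norms.L2Operator in
theorem norm_rescaled_sub_berezin_le (h : Compatible n z) {κ : ℝ} (hκ : 0 ≤ κ) (A : IrrepOp n)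
    (Y : orbit (chamberPt z)) : ‖rescaled n z κ A Y - berezin n z A Y‖ ≤ 2 * κ * ‖A‖ := by
  have e : rescaled n z κ A Y - berezin n z A Y =
      κ * (berezin n z A Y - trace A / (irrepDim n : ℂ)) := by
    rw [rescaled_apply]; ring
  rw [e, norm_mul, Complex.norm_real, Real.norm_of_nonneg hκ]
  have := (norm_sub_le _ _).trans (add_le_add (norm_berezin_le h A Y) (norm_trace_div_le h A))
  calc _ ≤ κ * (‖A‖ + ‖A‖) := mul_le_mul_of_nonneg_left this hκ
    _ = _ := by ring

theorem unscale_comm (κ : ℝ) (A B : IrrepOp n) :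
    unscale κ A * unscale κ B - unscale κ B * unscale κ A =
      ((1 + κ : ℂ)⁻¹ * (1 + κ : ℂ)⁻¹) • (A * B - B * A) := by
  simp only [unscale, add_mul, mul_add, smul_mul_assoc, mul_smul_comm, Matrix.one_mul,
    Matrix.mul_one, smul_sub, smul_smul, smul_add]
  module

theorem rescaled_unscale_comm {κ : ℝ} (hκ : 0 ≤ κ) (A B : IrrepOp n) :
    rescaled n z κ (unscale κ A * unscale κ B - unscale κ B * unscale κ A) =
      (1 + κ : ℂ)⁻¹ • berezin n z (A * B - B * A) := by
  have h1 := one_add_ne_zero hκ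
  funext Y
  rw [unscale_comm, rescaled_apply, map_smul, Matrix.trace_smul, Matrix.trace_sub,
    Matrix.trace_mul_comm, sub_self, smul_zero, zero_div, mul_zero, sub_zero, Pi.smul_apply,
    Pi.smul_apply, smul_eq_mul, smul_eq_mul]
  field_simp

theorem univSymbol_twistedProduct (h : Compatible n z) {κ : ℝ} (hκ : 0 ≤ κ) (A B : IrrepOp n) :
    twistedProduct (univSymbol (chamberPt z) n z κ) (rescaled n z κ A) (rescaled n z κ B) =
      rescaled n z κ (A * B) := by
  obtain ⟨u, rfl⟩ := irrepRep_surjective A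
  obtain ⟨v, rfl⟩ := irrepRep_surjective B
  rw [← univSymbol_chamberPt, ← univSymbol_chamberPt,
    (isUniversal_univSymbol rfl h rfl hκ).twistedProduct_eq, univSymbol_chamberPt, map_mul]

end Correspondence

section Limits

open Matrix

variable {m : Bool → ℕ} {r : ℝ}

variable (m r) in
/-- The rescaled universal correspondence for the weight `s m`, on the orbit of `r⁻¹ m`. -/
abbrev raySymbol (s : ℕ) : USl3 →ₗ[ℂ] (orbit (chamberPt (coords m r)) → ℂ) :=
  univSymbol (chamberPt (coords m r)) (scaled s m) (coords m r) (r / s)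

theorem exists_raySymbol_eq (hr : 0 < r) (f : Poly) :
    ∀ᶠ s in atTop, ∃ u, raySymbol m r s u = restr _ f := by
  obtain ⟨A, hA, -⟩ := exists_hasSymbol hr (restr_mem (m := m) hr f)
  filter_upwards [hA] with s hs
  obtain ⟨u, hu⟩ := irrepRep_surjective (unscale (r / s) (A s))
  exact ⟨u, by rw [univSymbol_chamberPt, hu, rescaled_unscale (compatible_scaled hr s) (by positivity),
    hs]⟩

theorem tendstoUniformly_of_isBigO {S : Type*} {F : ℕ → S → ℂ} {G : S → ℂ} {b : ℕ → ℝ}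
    (hb : b =O[atTop] fun s : ℕ => (s : ℝ)⁻¹) (h : ∀ᶠ s in atTop, ∀ Y, ‖F s Y - G Y‖ ≤ b s) :
    TendstoUniformly F G atTop := by
  have hb' : Tendsto b atTop (𝓝 0) := hb.trans_tendsto tendsto_inv_atTop_nhds_zero_nat
  rw [Metric.tendstoUniformly_iff]
  intro ε hε
  filter_upwards [h, hb'.eventually (gt_mem_nhds hε)] with s h1 h2 Y
  rw [dist_comm, dist_eq_norm]
  exact (h1 Y).trans_lt h2

open scoped Matrix.Norms.L2Operator in
theorem tendstoUniformly_twistedProduct (hr : 0 < r) (f h : Poly) :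
    TendstoUniformly (fun (s : ℕ) Y => twistedProduct (raySymbol m r s) (restr _ f) (restr _ h) Y)
      (fun Y => restr (orbit (chamberPt (coords m r))) (f * h) Y) atTop := by
  obtain ⟨A, hA, hA0⟩ := exists_hasSymbol hr (restr_mem (m := m) hr f)
  obtain ⟨B, hB, hB0⟩ := exists_hasSymbol hr (restr_mem (m := m) hr h)
  obtain ⟨C, hC, -⟩ := exists_hasSymbol hr (restr_mem (m := m) hr (f * h))
  have hC' := hC
  rw [restr_mul] at hC'
  have hd := decaysLike_mul_sub hr (restr_mem hr f) hA h hB hC'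
  have hκ : (fun s : ℕ => r / s) =O[atTop] fun s : ℕ => (s : ℝ)⁻¹ :=
    (Asymptotics.isBigO_refl _ _).const_mul_left r
  have hu : ∀ {A : OpSeq m}, DecaysLike 0 A →
      DecaysLike 1 ((fun s : ℕ => unscale (r / s) (A s)) - A) := by
    intro A hA
    refine Asymptotics.IsBigO.trans (Asymptotics.IsBigO.of_norm_le (g := fun s : ℕ =>
      2 * (r / s) * ‖A s‖) fun s => ?_) ?_
    · rw [norm_norm]
      exact norm_unscale_sub_le (compatible_scaled hr s) (by positivity) _
    · have := (hκ.const_mul_left 2).mul hA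
      simpa using this
  set A' : OpSeq m := fun s : ℕ => unscale (r / s) (A s) with hA'
  set B' : OpSeq m := fun s : ℕ => unscale (r / s) (B s) with hB'
  have hA'0 : DecaysLike 0 A' := by
    have := ((hu hA0).of_le zero_le_one).add hA0
    rwa [sub_add_cancel] at this
  have hd' : DecaysLike 1 (A' * B' - C) := by
    have e : A' * B' - C = A' * (B' - B) + (A' - A) * B + (A * B - C) := by noncomm_ring
    rw [e]
    exact ((hA'0.mul (hu hB0)).add ((hu hA0).mul hB0)).add hd
  have hB'0 : DecaysLike 0 B' := by
    have := ((hu hB0).of_le zero_le_one).add hB0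
    rwa [sub_add_cancel] at this
  refine tendstoUniformly_of_isBigO (b := fun s => 2 * (r / s) * ‖(A' * B') s‖ + ‖(A' * B' - C) s‖)
    ?_ ?_
  · refine Asymptotics.IsBigO.add ?_ ?_
    · have := (hκ.const_mul_left 2).mul (hA'0.mul hB'0)
      simpa using this
    · have : _ =O[_] _ := hd'
      simpa using this
  · filter_upwards [hA, hB, hC] with s h1 h2 h3 Y
    have hs := compatible_scaled (m := m) hr s
    have h0 : 0 ≤ r / s := by positivity
    rw [← h1, ← h2, ← h3, ← rescaled_unscale hs h0, ← rescaled_unscale hs h0 (B s),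
      univSymbol_twistedProduct hs h0]
    have e : rescaled (scaled s m) (coords m r) (r / s) (A' s * B' s) Y -
        berezin (scaled s m) (coords m r) (C s) Y =
        (rescaled (scaled s m) (coords m r) (r / s) (A' s * B' s) Y -
          berezin (scaled s m) (coords m r) (A' s * B' s) Y) +
        berezin (scaled s m) (coords m r) (A' s * B' s - C s) Y := by
      rw [map_sub, Pi.sub_apply]; ring
    change ‖rescaled (scaled s m) (coords m r) (r / s) (A' s * B' s) Y - _‖ ≤ _
    rw [e]
    exact (norm_add_le _ _).trans (add_le_add (norm_rescaled_sub_berezin_le hs h0 _ Y)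
      (norm_berezin_le hs _ Y))

open scoped Matrix.Norms.L2Operator in
theorem tendstoUniformly_starComm (hr : 0 < r) (f h : Poly) :
    TendstoUniformly (fun (s : ℕ) Y => (s : ℂ) * (r * starComm (raySymbol m r s) (restr _ f)
        (restr _ h) Y))
      (fun Y : orbit (chamberPt (coords m r)) => Complex.I * poisson f h Y) atTop := by
  obtain ⟨A, hA, hA0⟩ := exists_hasSymbol hr (restr_mem (m := m) hr f)
  obtain ⟨B, hB, hB0⟩ := exists_hasSymbol hr (restr_mem (m := m) hr h)
  obtain ⟨C, hC, hC0⟩ := exists_hasSymbol hr (restr_mem (m := m) hr (poissonPoly f h))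
  have hd := decaysLike_comm_sub hr hB f hA hC
  have hκ : (fun s : ℕ => r / s) =O[atTop] fun s : ℕ => (s : ℝ)⁻¹ :=
    (Asymptotics.isBigO_refl _ _).const_mul_left r
  refine tendstoUniformly_of_isBigO (b := fun s => s * r * ‖(A * B - B * A - epsMul r C) s‖ +
    r / s * ‖C s‖) ?_ ?_
  · refine Asymptotics.IsBigO.add ?_ ?_
    · have h1 : (fun s : ℕ => (s : ℝ) * r) =O[atTop] fun s : ℕ => (s : ℝ) :=
        ((Asymptotics.isBigO_refl (fun s : ℕ => (s : ℝ)) atTop).const_mul_left r).congr_left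
          fun s => mul_comm _ _
      refine (h1.mul hd).congr' EventuallyEq.rfl ?_
      filter_upwards [eventually_ge_atTop 1] with s hs
      have h0 : (s : ℝ) ≠ 0 := by exact_mod_cast (by omega : s ≠ 0)
      field_simp
    · have := hκ.mul hC0
      simpa using this
  · filter_upwards [hA, hB, hC, eventually_ge_atTop 1] with s h1 h2 h3 hs1 Y
    have hs := compatible_scaled (m := m) hr s
    have h0 : 0 ≤ r / s := by positivity
    have hs0 : (s : ℂ) ≠ 0 := by exact_mod_cast (by omega : s ≠ 0)
    have hr0 : (r : ℂ) ≠ 0 := by exact_mod_cast hr.ne'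
    have hp : poisson f h Y = berezin (scaled s m) (coords m r) (C s) Y := by
      rw [h3, ← polyFun_poissonPoly]; rfl
    set D : IrrepOp (scaled s m) := (A * B - B * A - epsMul r C) s with hD
    have hD' : A s * B s - B s * A s = D + (Complex.I / (s * r)) • C s := by
      rw [hD]
      exact (sub_add_cancel _ _).symm
    have hcomm : starComm (raySymbol m r s) (restr _ f) (restr _ h) Y =
        (1 + (r / s : ℝ) : ℂ)⁻¹ * (berezin (scaled s m) (coords m r) D Y +
          Complex.I / (s * r) * berezin (scaled s m) (coords m r) (C s) Y) := by
      rw [starComm, ← h1, ← h2, ← rescaled_unscale hs h0, ← rescaled_unscale hs h0 (B s),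
        univSymbol_twistedProduct hs h0, univSymbol_twistedProduct hs h0, ← map_sub,
        rescaled_unscale_comm h0, hD', map_add, map_smul]
      rfl
    have h4 := one_add_ne_zero h0
    set d := berezin (scaled s m) (coords m r) D Y with hd
    set c := berezin (scaled s m) (coords m r) (C s) Y with hc
    have e : (s : ℂ) * (r * starComm (raySymbol m r s) (restr _ f) (restr _ h) Y) -
        Complex.I * poisson f h Y = (1 + (r / s : ℝ) : ℂ)⁻¹ *
          (s * r * d - Complex.I * (r / s : ℝ) * c) := by
      rw [hcomm, hp]
      field_simp
      ring
    have hn : ‖(1 + (r / s : ℝ) : ℂ)⁻¹‖ ≤ 1 := by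
      have : ((1 + r / s : ℝ) : ℂ) = 1 + (r / s : ℝ) := by push_cast; rfl
      rw [norm_inv, ← this, Complex.norm_real, Real.norm_of_nonneg (by positivity)]
      exact inv_le_one_of_one_le₀ (by linarith)
    rw [e, norm_mul]
    refine (mul_le_of_le_one_left (norm_nonneg _) hn).trans ((norm_sub_le _ _).trans ?_)
    rw [norm_mul, norm_mul, norm_mul, norm_mul, Complex.norm_I, Complex.norm_natCast,
      Complex.norm_real, Complex.norm_real, Real.norm_of_nonneg hr.le, Real.norm_of_nonneg h0, one_mul]
    exact add_le_add (mul_le_mul_of_nonneg_left (norm_berezin_le hs _ Y) (by positivity))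
      (mul_le_mul_of_nonneg_left (norm_berezin_le hs _ Y) h0)

end Limits

/-! ### Rational orbits -/

section Rational

open Matrix

theorem weight_inj {x y x' y' : ℝ} (h : weight x y = weight x' y') : x = x' ∧ y = y' := by
  have h0 := congrFun (congrFun h 0) 0
  have h2 := congrFun (congrFun h 2) 2
  simp only [weight, Matrix.smul_apply, Matrix.diagonal_apply_eq, smul_eq_mul] at h0 h2
  have hI : (Complex.I / 3) ≠ 0 := div_ne_zero Complex.I_ne_zero three_ne_zero
  have h0' := mul_left_cancel₀ hI h0
  have h2' := mul_left_cancel₀ hI h2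
  simp only [Matrix.cons_val] at h0' h2'
  have e0 : 2 * x + y = 2 * x' + y' := by exact_mod_cast h0'
  have e2 : -x - 2 * y = -x' - 2 * y' := by exact_mod_cast h2'
  constructor <;> linarith

theorem smul_weight (R x y : ℝ) : R • weight x y = weight (R * x) (R * y) := by
  ext i j
  by_cases hij : i = j
  · subst hij
    fin_cases i <;> simp [weight] <;> ring
  · simp [weight, Matrix.diagonal_apply_ne _ hij]

theorem mem_Fbar_iff {ξ : Mat3} : ξ ∈ Fbar ↔
    ∃ a b : ℝ, 0 ≤ a ∧ 0 ≤ b ∧ a ^ 2 + a * b + b ^ 2 = 3 / 2 ∧ ξ = weight a b := by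
  have hs : √(3 / 2 : ℝ) ^ 2 = 3 / 2 := Real.sq_sqrt (by norm_num)
  have hp : 0 < √(3 / 2 : ℝ) := Real.sqrt_pos.2 (by norm_num)
  constructor
  · rintro ⟨x, y, hx, hy, h, rfl⟩
    refine ⟨√(3 / 2) * x, √(3 / 2) * y, by positivity, by positivity, ?_, smul_weight _ _ _⟩
    linear_combination (x ^ 2 + x * y + y ^ 2) * hs + (3 / 2) * h
  · rintro ⟨a, b, ha, hb, h, rfl⟩
    refine ⟨a / √(3 / 2), b / √(3 / 2), by positivity, by positivity, ?_, ?_⟩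
    · have e : (a / √(3 / 2)) ^ 2 + a / √(3 / 2) * (b / √(3 / 2)) + (b / √(3 / 2)) ^ 2 =
          (a ^ 2 + a * b + b ^ 2) / √(3 / 2) ^ 2 := by ring
      rw [e, h, hs, div_self (by norm_num)]
    · rw [smul_weight, mul_div_cancel₀ _ hp.ne', mul_div_cancel₀ _ hp.ne']

/-- The squared norm of the weight `m`, up to a factor. -/
def sqNorm (m : Bool → ℕ) : ℕ := m true ^ 2 + m true * m false + m false ^ 2

theorem sq_mul_of_smul_eq {ξ : Mat3} (hξ : ξ ∈ Fbar) {R : ℝ} {p q : ℕ}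
    (h : R • ξ = dominantWeight p q) : 3 * R ^ 2 = 2 * ((p ^ 2 + p * q + q ^ 2 : ℕ) : ℝ) := by
  obtain ⟨a, b, -, -, hab, rfl⟩ := mem_Fbar_iff.1 hξ
  rw [smul_weight] at h
  obtain ⟨h1, h2⟩ := weight_inj h
  push_cast
  rw [← h1, ← h2]
  linear_combination (-2 * R ^ 2) * hab

/-- The integral radius is attained. -/
theorem intRadius_spec (ξ : Qbar) : 0 < intRadius ξ ∧
    ∃ m : Bool → ℕ, intRadius ξ • (ξ : Mat3) = dominantWeight (m true) (m false) := by
  classical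
  obtain ⟨hF, R₀, hR₀, p₀, q₀, h₀⟩ := ξ.2
  let S : Set ℝ := {R : ℝ | 0 < R ∧ ∃ p q : ℕ, R • (ξ : Mat3) = dominantWeight p q}
  have hex : ∃ N : ℕ, ∃ R ∈ S, 3 * R ^ 2 = 2 * (N : ℝ) :=
    ⟨_, R₀, ⟨hR₀, p₀, q₀, h₀⟩, sq_mul_of_smul_eq hF h₀⟩
  obtain ⟨R, hR, hN⟩ := Nat.find_spec hex
  have hmin : ∀ R' ∈ S, R ≤ R' := by
    rintro R' hR'
    obtain ⟨h0, p, q, h⟩ := hR'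
    have h1 := sq_mul_of_smul_eq hF h
    have h2 := Nat.find_min' hex ⟨R', ⟨h0, p, q, h⟩, h1⟩
    have h3 : ((Nat.find hex : ℕ) : ℝ) ≤ ((p ^ 2 + p * q + q ^ 2 : ℕ) : ℝ) := by exact_mod_cast h2
    exact le_of_sq_le_sq (by linarith) h0.le
  have he : intRadius ξ = R := (IsLeast.csInf_eq ⟨hR, hmin⟩ : sInf S = R)
  obtain ⟨h0, p, q, h⟩ := hR
  rw [he]
  exact ⟨h0, fun b => if b then p else q, by simpa using h⟩

/-- The dominant weight `r(ξ) ξ`. -/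
def label (ξ : Qbar) : Bool → ℕ := (intRadius_spec ξ).2.choose

theorem intRadius_pos (ξ : Qbar) : 0 < intRadius ξ := (intRadius_spec ξ).1

theorem intRadius_smul (ξ : Qbar) :
    intRadius ξ • (ξ : Mat3) = dominantWeight (label ξ true) (label ξ false) :=
  (intRadius_spec ξ).2.choose_spec

theorem intRadius_sq (ξ : Qbar) : 3 * intRadius ξ ^ 2 = 2 * (sqNorm (label ξ) : ℝ) :=
  sq_mul_of_smul_eq ξ.2.1 (intRadius_smul ξ)

theorem coe_eq_chamberPt (ξ : Qbar) : (ξ : Mat3) = chamberPt (coords (label ξ) (intRadius ξ)) := by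
  have h := congrArg (fun X => (intRadius ξ)⁻¹ • X) (intRadius_smul ξ)
  simp only [smul_smul, inv_mul_cancel₀ (intRadius_pos ξ).ne', one_smul] at h
  refine h.trans ?_
  rw [dominantWeight, smul_weight, chamberPt]
  simp only [coords, div_eq_inv_mul]

theorem mul_intRadius_smul (ξ : Qbar) (s : ℕ) : ((s : ℝ) * intRadius ξ) • (ξ : Mat3) =
    dominantWeight (scaled s (label ξ) true) (scaled s (label ξ) false) := by
  rw [mul_smul, intRadius_smul, dominantWeight, smul_weight, dominantWeight, scaled, scaled]
  push_cast
  rfl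

theorem intRadius_lt_iff (ξ ξ' : Qbar) :
    intRadius ξ < intRadius ξ' ↔ sqNorm (label ξ) < sqNorm (label ξ') := by
  rw [← sq_lt_sq₀ (intRadius_pos ξ).le (intRadius_pos ξ').le, ← Nat.cast_lt (α := ℝ)]
  have h1 := intRadius_sq ξ
  have h2 := intRadius_sq ξ'
  constructor <;> intro <;> linarith

theorem label_injective : Function.Injective label := by
  intro ξ ξ' h
  have h1 := intRadius_sq ξ
  rw [h, ← intRadius_sq ξ'] at h1
  have h2 : intRadius ξ = intRadius ξ' :=
    (sq_eq_sq₀ (intRadius_pos ξ).le (intRadius_pos ξ').le).1 (by linarith)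
  refine Subtype.ext ?_
  rw [coe_eq_chamberPt ξ, h, h2, ← coe_eq_chamberPt ξ']

theorem finite_sqNorm_le (K : ℕ) : {ξ : Qbar | sqNorm (label ξ) ≤ K}.Finite := by
  refine Set.Finite.of_finite_image (f := label) ?_ label_injective.injOn
  refine (Set.Finite.pi (ι := Bool) fun _ => Set.finite_Iic K).subset ?_
  rintro _ ⟨ξ, hξ, rfl⟩ b -
  rw [Set.mem_ofPred_eq, sqNorm] at hξ
  rw [Set.mem_Iic]
  have h1 := Nat.le_self_pow two_ne_zero (label ξ true)
  have h2 := Nat.le_self_pow two_ne_zero (label ξ false)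
  have h3 := Nat.zero_le (label ξ true * label ξ false)
  cases b
  · change label ξ false ≤ K
    omega
  · change label ξ true ≤ K
    omega

end Rational

section Density

/-- The point of the unit sphere in the direction of `weight x y`. -/
def directionPt (x y : ℝ) : Mat3 :=
  weight (x / √(2 / 3 * (x ^ 2 + x * y + y ^ 2))) (y / √(2 / 3 * (x ^ 2 + x * y + y ^ 2)))

theorem directionPt_smul {c : ℝ} (hc : 0 < c) (x y : ℝ) :
    directionPt (c * x) (c * y) = directionPt x y := by
  have e : √(2 / 3 * ((c * x) ^ 2 + c * x * (c * y) + (c * y) ^ 2)) =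
      c * √(2 / 3 * (x ^ 2 + x * y + y ^ 2)) := by
    rw [← Real.sqrt_sq hc.le, ← Real.sqrt_mul (sq_nonneg c), Real.sqrt_sq hc.le]
    congr 1
    ring
  rw [directionPt, e, mul_div_mul_left _ _ hc.ne', mul_div_mul_left _ _ hc.ne', directionPt]

theorem sq_pos_of_ne {x y : ℝ} (hx : 0 ≤ x) (hy : 0 ≤ y) (h : ¬ (x = 0 ∧ y = 0)) :
    0 < 2 / 3 * (x ^ 2 + x * y + y ^ 2) := by
  rcases hx.eq_or_lt with h1 | h1
  · have : 0 < y := lt_of_le_of_ne hy fun h2 => h ⟨h1.symm, h2.symm⟩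
    positivity
  · positivity

theorem directionPt_mem_Fbar {x y : ℝ} (hx : 0 ≤ x) (hy : 0 ≤ y) (h : ¬ (x = 0 ∧ y = 0)) :
    directionPt x y ∈ Fbar := by
  have h1 := sq_pos_of_ne hx hy h
  refine mem_Fbar_iff.2 ⟨_, _, by positivity, by positivity, ?_, rfl⟩
  have h2 := Real.sq_sqrt h1.le
  have h3 := (Real.sqrt_pos.2 h1).ne'
  set R := √(2 / 3 * (x ^ 2 + x * y + y ^ 2))
  have e : (x / R) ^ 2 + x / R * (y / R) + (y / R) ^ 2 = (x ^ 2 + x * y + y ^ 2) / R ^ 2 := by ring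
  rw [e, h2, div_eq_div_iff h1.ne' two_ne_zero]
  ring

theorem directionPt_mem_Qbar {p q : ℕ} (h : ¬ (p = 0 ∧ q = 0)) : directionPt p q ∈ Qbar := by
  have h' : ¬ ((p : ℝ) = 0 ∧ (q : ℝ) = 0) := by simpa using h
  have h1 := sq_pos_of_ne (Nat.cast_nonneg p) (Nat.cast_nonneg q) h'
  have h2 := Real.sqrt_pos.2 h1
  refine ⟨directionPt_mem_Fbar (Nat.cast_nonneg p) (Nat.cast_nonneg q) h', _, h2, p, q, ?_⟩
  rw [directionPt, smul_weight, mul_div_cancel₀ _ h2.ne', mul_div_cancel₀ _ h2.ne', dominantWeight]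

theorem label_ne_zero (ξ : Qbar) : ¬ (label ξ true = 0 ∧ label ξ false = 0) := by
  rintro ⟨h1, h2⟩
  have h3 := intRadius_sq ξ
  have h4 := intRadius_pos ξ
  rw [sqNorm, h1, h2] at h3
  simp at h3
  exact h4.ne' h3

theorem coe_eq_directionPt (ξ : Qbar) : (ξ : Mat3) = directionPt (label ξ true) (label ξ false) := by
  have h : √(2 / 3 * ((label ξ true : ℝ) ^ 2 + label ξ true * label ξ false + label ξ false ^ 2)) =
      intRadius ξ := by
    rw [← Real.sqrt_sq (intRadius_pos ξ).le]
    congr 1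
    have := intRadius_sq ξ
    rw [sqNorm] at this
    push_cast at this
    linarith
  rw [directionPt, h]
  exact coe_eq_chamberPt ξ

theorem directionPt_eq {x y x' y' : ℝ} (hx : 0 ≤ x) (hy : 0 ≤ y) (h : ¬ (x = 0 ∧ y = 0))
    (hx' : 0 ≤ x') (hy' : 0 ≤ y') (h' : ¬ (x' = 0 ∧ y' = 0))
    (he : directionPt x y = directionPt x' y') : x * y' = x' * y := by
  have h1 := Real.sqrt_pos.2 (sq_pos_of_ne hx hy h)
  have h2 := Real.sqrt_pos.2 (sq_pos_of_ne hx' hy' h')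
  obtain ⟨e1, e2⟩ := weight_inj he
  set R := √(2 / 3 * (x ^ 2 + x * y + y ^ 2))
  set R' := √(2 / 3 * (x' ^ 2 + x' * y' + y' ^ 2))
  rw [div_eq_div_iff h1.ne' h2.ne'] at e1 e2
  have : R * R' * (x * y') = R * R' * (x' * y) := by
    linear_combination R * y' * e1 - R * x' * e2
  exact mul_left_cancel₀ (mul_pos h1 h2).ne' this

theorem continuous_weight : Continuous fun t : ℝ × ℝ => weight t.1 t.2 := by
  unfold weight
  have h : Continuous fun t : ℝ × ℝ => (![((2 * t.1 + t.2 : ℝ) : ℂ), ((-t.1 + t.2 : ℝ) : ℂ),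
      ((-t.1 - 2 * t.2 : ℝ) : ℂ)] : Fin 3 → ℂ) := by
    refine continuous_pi fun i => ?_
    fin_cases i <;> simp <;> fun_prop
  exact h.matrix_diagonal.const_smul (Complex.I / 3)

theorem tendsto_directionPt {x y : ℝ} (hx : 0 ≤ x) (hy : 0 ≤ y) (h : ¬ (x = 0 ∧ y = 0)) (a b : ℝ) :
    Tendsto (fun n : ℕ => directionPt (x + a * (n : ℝ)⁻¹) (y + b * (n : ℝ)⁻¹)) atTop
      (𝓝 (directionPt x y)) := by
  have h1 := sq_pos_of_ne hx hy h
  have h2 := Real.sqrt_pos.2 h1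
  have hc : ContinuousAt (fun t : ℝ => directionPt (x + a * t) (y + b * t)) 0 := by
    unfold directionPt
    refine ContinuousAt.comp (f := fun t : ℝ =>
      ((x + a * t) / √(2 / 3 * ((x + a * t) ^ 2 + (x + a * t) * (y + b * t) + (y + b * t) ^ 2)),
        (y + b * t) / √(2 / 3 * ((x + a * t) ^ 2 + (x + a * t) * (y + b * t) + (y + b * t) ^ 2))))
      continuous_weight.continuousAt ?_
    refine ContinuousAt.prodMk ?_ ?_ <;>
    · refine ContinuousAt.div (by fun_prop) (by fun_prop) ?_
      simp only [mul_zero, add_zero]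
      exact h2.ne'
  have := hc.tendsto.comp (tendsto_inv_atTop_nhds_zero_nat (𝕜 := ℝ))
  simp only [mul_zero, add_zero] at this
  exact this

/-- Every rational orbit is an accumulation point of rational orbits. -/
theorem nhdsWithin_Qbar_neBot (ξ : Qbar) : (𝓝[≠] ξ).NeBot := by
  have hm := label_ne_zero ξ
  set p := label ξ true
  set q := label ξ false
  obtain ⟨a, b, hab⟩ : ∃ a b : ℕ, p * b ≠ a * q := by
    by_cases hq : q = 0
    · exact ⟨0, 1, by simpa using fun hp => hm ⟨hp, hq⟩⟩
    · exact ⟨1, 0, by simpa using fun h => hq h.symm⟩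
  have hne : ∀ n : ℕ, 1 ≤ n → ¬ (n * p + a = 0 ∧ n * q + b = 0) := by
    rintro n - ⟨h1, h2⟩
    have ha : a = 0 := by omega
    have hb : b = 0 := by omega
    exact hab (by simp [ha, hb])
  let u : ℕ → Qbar := fun n => if h : 1 ≤ n then
    ⟨directionPt ((n * p + a : ℕ) : ℝ) ((n * q + b : ℕ) : ℝ), directionPt_mem_Qbar (hne n h)⟩ else ξ
  have hu : ∀ n (h : 1 ≤ n), (u n : Mat3) = directionPt ((n * p + a : ℕ) : ℝ) ((n * q + b : ℕ) : ℝ) :=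
    fun n h => by simp [u, h]
  have hm' : ¬ ((p : ℝ) = 0 ∧ (q : ℝ) = 0) := by simpa using hm
  have ht : Tendsto u atTop (𝓝 ξ) := by
    rw [tendsto_subtype_rng, coe_eq_directionPt ξ]
    refine (tendsto_directionPt (Nat.cast_nonneg p) (Nat.cast_nonneg q) hm' a b).congr' ?_
    filter_upwards [eventually_ge_atTop 1] with n hn
    have hn0 : (0 : ℝ) < n := by exact_mod_cast hn
    rw [hu n hn, ← directionPt_smul hn0]
    congr 1 <;>
    · push_cast
      field_simp
  have ht' : Tendsto u atTop (𝓝[≠] ξ) := by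
    refine tendsto_nhdsWithin_iff.2 ⟨ht, ?_⟩
    filter_upwards [eventually_ge_atTop 1] with n hn heq
    have h1 := congrArg Subtype.val (show u n = ξ from heq)
    rw [hu n hn, coe_eq_directionPt ξ] at h1
    have h2 := directionPt_eq (Nat.cast_nonneg _) (Nat.cast_nonneg _)
      (fun h => hne n hn (by exact_mod_cast h)) (Nat.cast_nonneg _) (Nat.cast_nonneg _) hm' h1
    have h3 : (n * p + a) * q = p * (n * q + b) := by exact_mod_cast h2
    exact hab (by nlinarith)
  exact ht'.neBot

theorem exists_sqNorm_gt (ξ : Qbar) {V : Set Qbar} (hV : V ∈ 𝓝 ξ) (K : ℕ) :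
    ∃ ξ' ∈ V, K < sqNorm (label ξ') := by
  have := nhdsWithin_Qbar_neBot ξ
  have h1 : ∀ᶠ x in 𝓝[≠] ξ, x ∈ V := nhdsWithin_le_nhds hV
  have h2 : ∀ᶠ x in 𝓝[≠] ξ, x ∉ {x : Qbar | sqNorm (label x) ≤ K} := by
    have hf := (finite_sqNorm_le K).subset (Set.sdiff_subset (t := {ξ}))
    have h3 : ({x : Qbar | sqNorm (label x) ≤ K} \ {ξ})ᶜ ∈ 𝓝 ξ :=
      hf.isClosed.isOpen_compl.mem_nhds (by simp)
    filter_upwards [nhdsWithin_le_nhds h3, self_mem_nhdsWithin] with x hx hx' hxK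
    exact hx ⟨hxK, hx'⟩
  obtain ⟨x, hx1, hx2⟩ := (h1.and h2).exists
  exact ⟨x, hx1, not_le.1 hx2⟩

end Density

section RadialChain

theorem infinite_range_sqNorm : (Set.range fun ξ : Qbar => sqNorm (label ξ)).Infinite := by
  refine Set.infinite_of_not_bddAbove ?_
  rintro ⟨K, hK⟩
  let ξ₀ : Qbar := ⟨directionPt (1 : ℕ) (0 : ℕ), directionPt_mem_Qbar (by simp)⟩
  obtain ⟨ξ, -, h⟩ := exists_sqNorm_gt ξ₀ univ_mem K
  exact absurd (hK ⟨ξ, rfl⟩) (not_le.2 h)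

/-- The values of `sqNorm` on the rational orbits, in increasing order. -/
def radialValue : ℕ → ℕ := Nat.nth fun N => N ∈ Set.range fun ξ : Qbar => sqNorm (label ξ)

theorem radialValue_strictMono : StrictMono radialValue := Nat.nth_strictMono infinite_range_sqNorm

theorem exists_radialValue_eq (ξ : Qbar) : ∃ n, radialValue n = sqNorm (label ξ) := by
  have h := Nat.range_nth_of_infinite infinite_range_sqNorm
  have : sqNorm (label ξ) ∈ Set.range radialValue := by
    refine Set.ext_iff.1 h _ |>.2 ?_
    exact ⟨ξ, rfl⟩
  exact this

/-- The chain of rational orbits of bounded radius. -/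
def radialChain : Chain where
  P n := (finite_sqNorm_le (radialValue n)).toFinset
  strict n := by
    rw [Finset.ssubset_iff_subset_ne]
    refine ⟨fun ξ hξ => ?_, fun h => ?_⟩
    · rw [Set.Finite.mem_toFinset] at hξ ⊢
      exact le_trans hξ (radialValue_strictMono n.lt_succ_self).le
    · obtain ⟨ξ, hξ⟩ := Nat.nth_mem_of_infinite infinite_range_sqNorm (n + 1)
      have h1 : ξ ∈ (finite_sqNorm_le (radialValue (n + 1))).toFinset := by
        rw [Set.Finite.mem_toFinset]
        exact hξ.le
      rw [← h, Set.Finite.mem_toFinset] at h1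
      exact absurd (radialValue_strictMono n.lt_succ_self) (not_lt.2 (hξ.symm.le.trans h1))
  exhaust ξ := by
    obtain ⟨n, hn⟩ := exists_radialValue_eq ξ
    refine ⟨n, ?_⟩
    rw [Set.Finite.mem_toFinset]
    exact hn.symm.le

theorem radialValue_index (ξ : Qbar) : radialValue (radialChain.index ξ) = sqNorm (label ξ) := by
  obtain ⟨n, hn⟩ := exists_radialValue_eq ξ
  have : radialChain.index ξ = n := by
    refine IsLeast.csInf_eq ⟨?_, fun k hk => ?_⟩
    · change ξ ∈ (finite_sqNorm_le (radialValue n)).toFinset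
      rw [Set.Finite.mem_toFinset]
      exact hn.symm.le
    · have hk' : ξ ∈ (finite_sqNorm_le (radialValue k)).toFinset := hk
      rw [Set.Finite.mem_toFinset] at hk'
      exact radialValue_strictMono.le_iff_le.1 (hn.trans_le hk')
  rw [this, hn]

theorem radialChain_isRadial : radialChain.IsRadial := fun ξ ξ' => by
  rw [intRadius_lt_iff, ← radialValue_index, ← radialValue_index, radialValue_strictMono.lt_iff_lt]

end RadialChain

section Glue

open Matrix

theorem tau_Ad (g : SU3) (X : Mat3) : tau (Ad g X) = tau X := by
  have h : (Ad g X).det = X.det := by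
    rw [Ad, Matrix.det_mul, Matrix.det_mul, mul_right_comm, ← Matrix.det_mul, coe_inv_SU3,
      SU3_mul_star, Matrix.det_one, one_mul]
  rw [tau, tau, h]

theorem det_weight (a b : ℝ) : (weight a b).det =
    (Complex.I / 3) ^ 3 * (((2 * a + b) * (-a + b) * (-a - 2 * b) : ℝ) : ℂ) := by
  rw [weight, Matrix.det_smul, Matrix.det_diagonal, Fintype.card_fin, Fin.prod_univ_three]
  simp

theorem tau_injOn : Set.InjOn tau Fbar := by
  intro ξ hξ ξ' hξ' h
  obtain ⟨a, b, ha, hb, hN, rfl⟩ := mem_Fbar_iff.1 hξ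
  obtain ⟨c, d, hc, hd, hN', rfl⟩ := mem_Fbar_iff.1 hξ'
  have h6 : (6 * (√6 : ℝ) * Complex.I : ℂ) ≠ 0 :=
    mul_ne_zero (mul_ne_zero (by norm_num) (by simp)) Complex.I_ne_zero
  have h1 := mul_left_cancel₀ h6 h
  rw [det_weight, det_weight] at h1
  have h2 := mul_left_cancel₀ (pow_ne_zero 3 (div_ne_zero Complex.I_ne_zero three_ne_zero)) h1
  have h3 : (2 * a + b) * (-a + b) * (-a - 2 * b) = (2 * c + d) * (-c + d) * (-c - 2 * d) := by
    exact_mod_cast h2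
  have key : ∀ {a b c d : ℝ}, 0 ≤ a → 0 ≤ b → a ^ 2 + a * b + b ^ 2 = c ^ 2 + c * d + d ^ 2 →
      (2 * a + b) * (-a + b) * (-a - 2 * b) = (2 * c + d) * (-c + d) * (-c - 2 * d) →
      2 * c + d ≤ 2 * a + b ∧ -a - 2 * b ≤ -c - 2 * d := by
    intro a b c d ha hb h1 h2
    have e1 : ((2 * c + d) - (2 * a + b)) * ((2 * c + d) - (-a + b)) * ((2 * c + d) - (-a - 2 * b)) =
        0 := by
      linear_combination (-3 * (2 * c + d)) * h1 - h2
    have e2 : ((-c - 2 * d) - (2 * a + b)) * ((-c - 2 * d) - (-a + b)) *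
        ((-c - 2 * d) - (-a - 2 * b)) = 0 := by
      linear_combination (-3 * (-c - 2 * d)) * h1 - h2
    constructor
    · rcases mul_eq_zero.1 e1 with h | h
      · rcases mul_eq_zero.1 h with h | h <;> linarith
      · linarith
    · rcases mul_eq_zero.1 e2 with h | h
      · rcases mul_eq_zero.1 h with h | h <;> linarith
      · linarith
  obtain ⟨k1, k2⟩ := key ha hb (hN.trans hN'.symm) h3
  obtain ⟨k3, k4⟩ := key hc hd (hN'.trans hN.symm) h3.symm
  have e1 : a = c := by linarith
  have e2 : b = d := by linarith
  rw [e1, e2]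

theorem tau_orbit {ξ X : Mat3} (hX : X ∈ orbit ξ) : tau X = tau ξ := by
  obtain ⟨g, rfl⟩ := hX
  exact tau_Ad g ξ

theorem tau_Qbar_inj {ξ ξ' : Qbar} (h : tau ξ = tau ξ') : ξ = ξ' :=
  Subtype.ext (tau_injOn ξ.2.1 ξ'.2.1 h)

theorem glue_self {P : Finset Qbar} {ξ : Qbar} {X : Mat3} (hX : X ∈ orbit (ξ : Mat3)) :
    glue P ξ X = 1 := by
  rw [glue, tau_orbit hX]
  refine div_self (Finset.prod_ne_zero_iff.2 fun ξ' hξ' => sub_ne_zero.2 fun h => ?_)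
  exact Finset.ne_of_mem_erase hξ' (tau_Qbar_inj h).symm

theorem glue_of_ne {P : Finset Qbar} {ξ ξ' : Qbar} (hne : ξ' ≠ ξ) (hP : ξ' ∈ P) {X : Mat3}
    (hX : X ∈ orbit (ξ' : Mat3)) : glue P ξ X = 0 := by
  classical
  rw [glue, Finset.prod_eq_zero (i := ξ'), zero_div]
  · exact Finset.mem_erase.2 ⟨hne, hP⟩
  · rw [tau_orbit hX, sub_self]

theorem sum_glue {P : Finset Qbar} {ξ : Qbar} (hP : ξ ∈ P) {X : Mat3}
    (hX : X ∈ orbit (ξ : Mat3)) (F : Qbar → ℂ) : ∑ ξ' ∈ P, glue P ξ' X * F ξ' = F ξ := by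
  rw [Finset.sum_eq_single_of_mem ξ hP, glue_self hX, one_mul]
  intro ξ' _ hne
  rw [glue_of_ne hne.symm hP hX, zero_mul]

theorem extend_of_mem {S : Set Mat3} (f : S → ℂ) {X : Mat3} (hX : X ∈ S) :
    extend f X = f ⟨X, hX⟩ := dif_pos hX

end Glue

/-! ### Independence of the irreducible representations -/

section Independence

open Matrix Polynomial

variable {n n' : Bool → ℕ}

theorem compress_aeval {A : Matrix (Idx n → Fin 3) (Idx n → Fin 3) ℂ} (hA : A ∈ tensStab n)
    (p : ℂ[X]) : compress n (aeval A p) = aeval (compress n A) p := by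
  rw [aeval_eq_sum_range, aeval_eq_sum_range, map_sum]
  exact Finset.sum_congr rfl fun k _ => by rw [map_smul, compress_pow n hA]

theorem aeval_mulVec {d : ℕ} {A : Matrix (Fin d) (Fin d) ℂ} {v : Fin d → ℂ} {c : ℂ}
    (h : A *ᵥ v = c • v) (p : ℂ[X]) : aeval A p *ᵥ v = p.eval c • v := by
  have hk : ∀ k : ℕ, A ^ k *ᵥ v = c ^ k • v := by
    intro k
    induction k with
    | zero => simp
    | succ k ih => rw [pow_succ, ← Matrix.mulVec_mulVec, h, Matrix.mulVec_smul, ih, smul_smul, pow_succ']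
  rw [aeval_eq_sum_range, eval_eq_sum_range, Matrix.sum_mulVec, Finset.sum_smul]
  exact Finset.sum_congr rfl fun k _ => by rw [Matrix.smul_mulVec, hk, smul_smul]

theorem irrepLie_diagonal_mulVec_irrepHw {d : Fin 3 → ℂ} {X : Sl3} (hX : (X : Mat3) = diagonal d) :
    irrepLie n X *ᵥ irrepHw n = ((n true : ℂ) * d 0 - (n false : ℂ) * d 2) • irrepHw n := by
  rw [irrepLie_apply, compress_mulVec_irrepHw, hX, tensLie_diagonal_mulVec_tensHw,
    Matrix.mulVec_smul, irrepHw]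

theorem aeval_irrepLie_diagonal {d : Fin 3 → ℂ} {X : Sl3} (hX : (X : Mat3) = diagonal d) :
    aeval (irrepLie n X) (∏ J : Idx n → Fin 3,
      (Polynomial.X - Polynomial.C (∑ k : Idx n, slotDiag k.1 d (J k)))) = 0 := by
  rw [irrepLie_apply, ← compress_aeval (tensLie_mem_tensStab n _), hX, tensLie_diagonal]
  set e : (Idx n → Fin 3) → ℂ := fun I => ∑ k : Idx n, slotDiag k.1 d (I k)
  have h1 : aeval (diagonal e) (∏ J, (Polynomial.X - Polynomial.C (e J))) =
      diagonal (aeval e (∏ J, (Polynomial.X - Polynomial.C (e J)))) :=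
    aeval_algHom_apply (Matrix.diagonalAlgHom ℂ) e _
  have h2 : aeval e (∏ J, (Polynomial.X - Polynomial.C (e J))) = 0 := by
    funext I
    have h3 := (aeval_algHom_apply (Pi.evalAlgHom ℂ (fun _ : Idx n → Fin 3 => ℂ) I) e
      (∏ J, (Polynomial.X - Polynomial.C (e J)))).symm
    refine h3.trans ?_
    rw [map_prod]
    exact Finset.prod_eq_zero (Finset.mem_univ I) (by simp)
  rw [h1, h2]
  simp

/-- If the representation with highest weight `n` factors through the one with highest weight `n'`,
then `n` is dominated by `n'`. -/
theorem weight_le_of_ker_le (h : ∀ u, irrepRep n' u = 0 → irrepRep n u = 0) {d : Fin 3 → ℝ}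
    (hd : ∑ i, d i = 0) (h0 : ∀ i, d i ≤ d 0) (h2 : ∀ i, d 2 ≤ d i) :
    n true * d 0 - n false * d 2 ≤ n' true * d 0 - n' false * d 2 := by
  have hX : (diagonal fun i => (d i : ℂ)) ∈ LieAlgebra.SpecialLinear.sl (Fin 3) ℂ := by
    rw [mem_sl, Matrix.trace_diagonal]
    exact_mod_cast hd
  set X : Sl3 := ⟨_, hX⟩
  have hX' : (X : Mat3) = diagonal fun i => (d i : ℂ) := rfl
  set p : ℂ[X] := ∏ J : Idx n' → Fin 3,
      (Polynomial.X - Polynomial.C (∑ k : Idx n', slotDiag k.1 (fun i => (d i : ℂ)) (J k)))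
  have h1 := h (aeval (UniversalEnvelopingAlgebra.ι ℂ X) p) (by
    rw [← aeval_algHom_apply, irrepRep_ι, aeval_irrepLie_diagonal hX'])
  rw [← aeval_algHom_apply, irrepRep_ι] at h1
  have h3 := aeval_mulVec (irrepLie_diagonal_mulVec_irrepHw (n := n) hX') p
  rw [h1, Matrix.zero_mulVec, eq_comm] at h3
  have h4 := (smul_eq_zero.1 h3).resolve_right (irrepHw_ne_zero)
  rw [eval_prod, Finset.prod_eq_zero_iff] at h4
  obtain ⟨J, -, hJ⟩ := h4
  rw [eval_sub, eval_X, eval_C, sub_eq_zero] at hJ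
  have h5 : (n true * d 0 - n false * d 2 : ℝ) =
      ∑ k : Idx n', if k.1 then d (J k) else -d (J k) := by
    have : ((n true * d 0 - n false * d 2 : ℝ) : ℂ) =
        ((∑ k : Idx n', if k.1 then d (J k) else -d (J k) : ℝ) : ℂ) := by
      push_cast
      rw [hJ]
      refine Finset.sum_congr rfl fun k _ => ?_
      rw [slotDiag]
      split_ifs <;> simp
    exact_mod_cast this
  rw [h5]
  calc ∑ k : Idx n', (if k.1 then d (J k) else -d (J k)) ≤ ∑ k : Idx n', if k.1 then d 0 else -d 2 := by
        refine Finset.sum_le_sum fun k _ => ?_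
        split_ifs
        · exact h0 _
        · exact neg_le_neg (h2 _)
    _ = n' true * d 0 - n' false * d 2 := by
        rw [Fintype.sum_sigma, Fintype.sum_bool]
        simp [sub_eq_add_neg]

instance : Nonempty (Fin (irrepDim n)) := by
  rw [← Fin.pos_iff_nonempty, Nat.pos_iff_ne_zero]
  exact fun h => irrepDim_ne_zero (n := n) (by rw [h, Nat.cast_zero])

theorem exists_separating_or_ker_le (n n' : Bool → ℕ) :
    (∃ u, irrepRep n u = 1 ∧ irrepRep n' u = 0) ∨ ∀ u, irrepRep n' u = 0 → irrepRep n u = 0 := by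
  let T : TwoSidedIdeal (IrrepOp n) := TwoSidedIdeal.mk'
    {A | ∃ u, irrepRep n u = A ∧ irrepRep n' u = 0} ⟨0, map_zero _, map_zero _⟩
    (by
      rintro _ _ ⟨u, rfl, hu⟩ ⟨v, rfl, hv⟩
      exact ⟨u + v, map_add _ _ _, by rw [map_add, hu, hv, add_zero]⟩)
    (by
      rintro _ ⟨u, rfl, hu⟩
      exact ⟨-u, map_neg _ _, by rw [map_neg, hu, neg_zero]⟩)
    (by
      rintro A _ ⟨u, rfl, hu⟩
      obtain ⟨v, rfl⟩ := irrepRep_surjective A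
      exact ⟨v * u, map_mul _ _ _, by rw [map_mul, hu, mul_zero]⟩)
    (by
      rintro _ A ⟨u, rfl, hu⟩
      obtain ⟨v, rfl⟩ := irrepRep_surjective A
      exact ⟨u * v, map_mul _ _ _, by rw [map_mul, hu, zero_mul]⟩)
  have hT : ∀ A, A ∈ T ↔ ∃ u, irrepRep n u = A ∧ irrepRep n' u = 0 := fun A =>
    TwoSidedIdeal.mem_mk' _ _ _ _ _ _ A
  by_cases h : ∃ u, irrepRep n' u = 0 ∧ irrepRep n u ≠ 0
  · obtain ⟨u, h1, h2⟩ := h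
    left
    exact (hT 1).1 (IsSimpleRing.one_mem_of_ne_zero_mem T h2 ((hT _).2 ⟨u, rfl, h1⟩))
  · right
    intro u hu
    by_contra hne
    exact h ⟨u, hu, hne⟩

theorem eq_of_ker_le (h : ∀ u, irrepRep n' u = 0 → irrepRep n u = 0) : n = n' := by
  have h' : ∀ u, irrepRep n u = 0 → irrepRep n' u = 0 := by
    refine (exists_separating_or_ker_le n' n).resolve_left ?_
    rintro ⟨u, h1, h2⟩
    have h3 := h (1 - u) (by rw [map_sub, map_one, h1, sub_self])
    rw [map_sub, map_one, h2, sub_zero] at h3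
    exact one_ne_zero h3
  have key : ∀ {n n' : Bool → ℕ}, (∀ u, irrepRep n' u = 0 → irrepRep n u = 0) →
      2 * n true + n false ≤ 2 * n' true + n' false ∧
      n true + 2 * n false ≤ n' true + 2 * n' false := by
    intro n n' h
    have h1 := weight_le_of_ker_le h (d := ![2, -1, -1]) (by simp [Fin.sum_univ_three]; norm_num)
      (fun i => by fin_cases i <;> simp <;> norm_num) (fun i => by fin_cases i <;> simp <;> norm_num)
    have h2 := weight_le_of_ker_le h (d := ![1, 1, -2]) (by simp [Fin.sum_univ_three]; norm_num)
      (fun i => by fin_cases i <;> simp <;> norm_num) (fun i => by fin_cases i <;> simp <;> norm_num)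
    simp only [Matrix.cons_val] at h1 h2
    constructor
    · have : (2 * n true + n false : ℝ) ≤ 2 * n' true + n' false := by linarith
      exact_mod_cast this
    · have : (n true + 2 * n false : ℝ) ≤ n' true + 2 * n' false := by linarith
      exact_mod_cast this
  have h1 := key h
  have h2 := key h'
  funext b
  cases b <;> omega

theorem exists_separating (h : n ≠ n') : ∃ u, irrepRep n u = 1 ∧ irrepRep n' u = 0 :=
  (exists_separating_or_ker_le n n').resolve_right fun hk => h (eq_of_ker_le hk)

/-- Elements of `U(sl(3))` act independently on finitely many irreducible representations. -/
theorem exists_irrepRep_eq {ι : Type*} (P : Finset ι) (n : ι → Bool → ℕ)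
    (hn : Set.InjOn n P) (v : ι → USl3) :
    ∃ u, ∀ i ∈ P, irrepRep (n i) u = irrepRep (n i) (v i) := by
  classical
  have hsep : ∀ i, ∀ Q : Finset ι, (∀ j ∈ Q, n i ≠ n j) →
      ∃ u, irrepRep (n i) u = 1 ∧ ∀ j ∈ Q, irrepRep (n j) u = 0 := by
    intro i Q
    induction Q using Finset.induction_on with
    | empty => exact fun _ => ⟨1, map_one _, by simp⟩
    | insert k Q _ ih =>
      intro h
      obtain ⟨u, h1, h2⟩ := ih fun j hj => h j (Finset.mem_insert_of_mem hj)
      obtain ⟨v, h3, h4⟩ := exists_separating (h k (Finset.mem_insert_self _ _))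
      refine ⟨u * v, by rw [map_mul, h1, h3, one_mul], fun j hj => ?_⟩
      rcases Finset.mem_insert.1 hj with rfl | hj
      · rw [map_mul, h4, mul_zero]
      · rw [map_mul, h2 j hj, zero_mul]
  have hs : ∀ i, ∃ u, i ∈ P → irrepRep (n i) u = 1 ∧ ∀ j ∈ P.erase i, irrepRep (n j) u = 0 := by
    intro i
    by_cases hi : i ∈ P
    · obtain ⟨u, hu⟩ := hsep i (P.erase i) fun j hj heq =>
        Finset.ne_of_mem_erase hj (hn hi (Finset.mem_of_mem_erase hj) heq).symm
      exact ⟨u, fun _ => hu⟩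
    · exact ⟨0, fun h => absurd h hi⟩
  choose e he using hs
  refine ⟨∑ i ∈ P, e i * v i, fun i hi => ?_⟩
  rw [map_sum, Finset.sum_eq_single_of_mem i hi, map_mul, (he i hi).1, one_mul]
  intro j hj hne
  rw [map_mul, (he j hj).2 i (Finset.mem_erase.2 ⟨hne.symm, hi⟩), zero_mul]

end Independence

/-! ### The Magoo sphere of rescaled Berezin symbols -/

section PoissonType

/-- The radial Magoo sphere of rescaled Berezin symbols. -/
def rescaledSphere : MagooSphere where
  chain := radialChain
  w ξ s := univSymbol (ξ : Mat3) (scaled s (label ξ)) (coords (label ξ) (intRadius ξ))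
    (intRadius ξ / s)
  universal ξ s _ := isUniversal_univSymbol (coe_eq_chamberPt ξ)
    (compatible_scaled (intRadius_pos ξ) s) (mul_intRadius_smul ξ s)
    (div_nonneg (intRadius_pos ξ).le (Nat.cast_nonneg s))

theorem rescaledSphere_isRescaledBerezin : rescaledSphere.IsRescaledBerezin := fun ξ s _ =>
  univSymbol_rescaledBerezin (coe_eq_chamberPt ξ) (compatible_scaled (intRadius_pos ξ) s)
    (mul_intRadius_smul ξ s) (intRadius ξ / s)

theorem rescaledSphere_exists (ξ : Qbar) (f : Poly) :
    ∀ᶠ s in atTop, ∃ u, rescaledSphere.w ξ s u = restr (orbit (ξ : Mat3)) f := by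
  have key : ∀ {ξ' : Mat3}, ξ' = chamberPt (coords (label ξ) (intRadius ξ)) →
      ∀ᶠ s : ℕ in atTop, ∃ u, univSymbol ξ' (scaled s (label ξ)) (coords (label ξ) (intRadius ξ))
        (intRadius ξ / s) u = restr (orbit ξ') f := by
    rintro _ rfl
    exact exists_raySymbol_eq (intRadius_pos ξ) f
  exact key (coe_eq_chamberPt ξ)

theorem rescaledSphere_tendsto_twistedProduct (ξ : Qbar) (f h : Poly) :
    TendstoUniformly (fun (s : ℕ) Y => twistedProduct (rescaledSphere.w ξ s)
        (restr (orbit (ξ : Mat3)) f) (restr (orbit (ξ : Mat3)) h) Y)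
      (fun Y => restr (orbit (ξ : Mat3)) (f * h) Y) atTop := by
  have key : ∀ {ξ' : Mat3}, ξ' = chamberPt (coords (label ξ) (intRadius ξ)) →
      TendstoUniformly (fun (s : ℕ) Y => twistedProduct (univSymbol ξ' (scaled s (label ξ))
        (coords (label ξ) (intRadius ξ)) (intRadius ξ / s)) (restr (orbit ξ') f)
        (restr (orbit ξ') h) Y) (fun Y => restr (orbit ξ') (f * h) Y) atTop := by
    rintro _ rfl
    exact tendstoUniformly_twistedProduct (intRadius_pos ξ) f h
  exact key (coe_eq_chamberPt ξ)

theorem rescaledSphere_tendsto_starComm (ξ : Qbar) (f h : Poly) :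
    TendstoUniformly (fun (s : ℕ) Y => (s : ℂ) * (intRadius ξ * starComm (rescaledSphere.w ξ s)
        (restr (orbit (ξ : Mat3)) f) (restr (orbit (ξ : Mat3)) h) Y))
      (fun Y : orbit (ξ : Mat3) => Complex.I * poisson f h Y) atTop := by
  have key : ∀ {ξ' : Mat3}, ξ' = chamberPt (coords (label ξ) (intRadius ξ)) →
      TendstoUniformly (fun (s : ℕ) Y => (s : ℂ) * (intRadius ξ * starComm (univSymbol ξ'
        (scaled s (label ξ)) (coords (label ξ) (intRadius ξ)) (intRadius ξ / s)) (restr (orbit ξ') f)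
        (restr (orbit ξ') h) Y))
        (fun Y : orbit ξ' => Complex.I * poisson f h Y) atTop := by
    rintro _ rfl
    exact tendstoUniformly_starComm (intRadius_pos ξ) f h
  exact key (coe_eq_chamberPt ξ)

/-- The correspondences of one level can be prescribed independently on finitely many orbits. -/
theorem rescaledSphere_exists_common {s : ℕ} (hs : 1 ≤ s) (P : Finset Qbar) (v : Qbar → USl3) :
    ∃ u, ∀ ξ ∈ P, rescaledSphere.w ξ s u = rescaledSphere.w ξ s (v ξ) := by
  obtain ⟨u, hu⟩ := exists_irrepRep_eq P (fun ξ => scaled s (label ξ)) (fun ξ _ ξ' _ h => by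
    refine label_injective (funext fun b => ?_)
    exact Nat.eq_of_mul_eq_mul_left hs (congrFun h b)) v
  refine ⟨u, fun ξ hξ => funext fun Y => ?_⟩
  change _ * Matrix.trace (irrepRep _ u * _) - _ * (Matrix.trace (irrepRep _ u) / _) =
    _ * Matrix.trace (irrepRep _ (v ξ) * _) - _ * (Matrix.trace (irrepRep _ (v ξ)) / _)
  rw [hu ξ hξ]

end PoissonType

namespace MagooSphere

variable (M : MagooSphere)

theorem pencil_apply {n s : ℕ} (u : USl3) {ξ : Qbar} (hξ : ξ ∈ M.chain.P n) (Y : orbit (ξ : Mat3)) :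
    M.pencil n s u ⟨Y, ξ, hξ, Y.2⟩ = M.w ξ s u Y := by
  change ∑ ξ' ∈ M.chain.P n, glue (M.chain.P n) ξ' Y * extend (M.w ξ' s u) Y = _
  rw [sum_glue hξ Y.2 fun ξ' => extend (M.w ξ' s u) Y, extend_of_mem _ Y.2]

theorem pencil_eq_restr_iff {n s : ℕ} {u : USl3} {f : Poly} :
    M.pencil n s u = restr (M.X n) f ↔
      ∀ ξ ∈ M.chain.P n, M.w ξ s u = restr (orbit (ξ : Mat3)) f := by
  constructor
  · intro h ξ hξ
    funext Y
    rw [← M.pencil_apply u hξ, h]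
    rfl
  · intro h
    funext ⟨x, ξ, hξ, hx⟩
    rw [M.pencil_apply u hξ ⟨x, hx⟩, h ξ hξ]
    rfl

theorem prod_apply {n s : ℕ} (hs : 1 ≤ s) {f h : Poly} (hf : ∃ u, M.pencil n s u = restr (M.X n) f)
    (hh : ∃ u, M.pencil n s u = restr (M.X n) h) {ξ : Qbar} (hξ : ξ ∈ M.chain.P n)
    (Y : orbit (ξ : Mat3)) : M.prod n s (restr (M.X n) f) (restr (M.X n) h) ⟨Y, ξ, hξ, Y.2⟩ =
      twistedProduct (M.w ξ s) (restr (orbit (ξ : Mat3)) f) (restr (orbit (ξ : Mat3)) h) Y := by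
  have H := And.intro hf hh
  have e : M.prod n s (restr (M.X n) f) (restr (M.X n) h) =
    M.pencil n s (H.1.choose * H.2.choose) := dif_pos H
  rw [e, M.pencil_apply _ hξ, ← M.pencil_eq_restr_iff.1 H.1.choose_spec ξ hξ,
    ← M.pencil_eq_restr_iff.1 H.2.choose_spec ξ hξ, (M.universal ξ s hs).twistedProduct_eq]

theorem bracket_apply {n s : ℕ} {f h : Poly} (hf : ∃ u, M.pencil n s u = restr (M.X n) f)
    (hh : ∃ u, M.pencil n s u = restr (M.X n) h) {ξ : Qbar} (hξ : ξ ∈ M.chain.P n)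
    (Y : orbit (ξ : Mat3)) : M.bracket n s (restr (M.X n) f) (restr (M.X n) h) ⟨Y, ξ, hξ, Y.2⟩ =
      intRadius ξ * starComm (M.w ξ s) (restr (orbit (ξ : Mat3)) f)
        (restr (orbit (ξ : Mat3)) h) Y := by
  have H := And.intro hf hh
  have e : M.bracket n s (restr (M.X n) f) (restr (M.X n) h) = fun x : M.X n => ∑ ξ ∈ M.chain.P n,
      glue (M.chain.P n) ξ x * (intRadius ξ : ℂ) *
      extend (starComm (M.w ξ s) (M.w ξ s H.1.choose) (M.w ξ s H.2.choose)) x := dif_pos H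
  rw [e]
  simp only [mul_assoc]
  rw [sum_glue hξ Y.2 fun ξ' => (intRadius ξ' : ℂ) *
    extend (starComm (M.w ξ' s) (M.w ξ' s H.1.choose) (M.w ξ' s H.2.choose)) Y,
    extend_of_mem _ Y.2, M.pencil_eq_restr_iff.1 H.1.choose_spec ξ hξ,
    M.pencil_eq_restr_iff.1 H.2.choose_spec ξ hξ]

theorem tendstoUniformly_of_orbits {n : ℕ} {F : ℕ → M.X n → ℂ} {G : M.X n → ℂ}
    (h : ∀ ξ (hξ : ξ ∈ M.chain.P n), TendstoUniformly
      (fun s (Y : orbit (ξ : Mat3)) => F s ⟨Y, ξ, hξ, Y.2⟩) (fun Y => G ⟨Y, ξ, hξ, Y.2⟩) atTop) :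
    TendstoUniformly F G atTop := by
  rw [Metric.tendstoUniformly_iff]
  intro ε hε
  have h1 : ∀ᶠ s in atTop, ∀ ξ ∈ (M.chain.P n).attach, ∀ Y : orbit (ξ : Mat3),
      dist (G ⟨Y, ξ.1, ξ.2, Y.2⟩) (F s ⟨Y, ξ.1, ξ.2, Y.2⟩) < ε :=
    (Filter.eventually_all_finset _).2 fun ξ _ => Metric.tendstoUniformly_iff.1 (h ξ.1 ξ.2) ε hε
  filter_upwards [h1] with s hs
  rintro ⟨x, ξ, hξ, hx⟩
  exact hs ⟨ξ, hξ⟩ (Finset.mem_attach _ _) ⟨x, hx⟩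

end MagooSphere

section PoissonType

theorem rescaledSphere_exists_pencil (n : ℕ) (f : Poly) : ∀ᶠ s in atTop,
    ∃ u, rescaledSphere.pencil n s u = restr (rescaledSphere.X n) f := by
  have h : ∀ᶠ s in atTop, ∀ ξ ∈ rescaledSphere.chain.P n,
      ∃ u, rescaledSphere.w ξ s u = restr (orbit (ξ : Mat3)) f :=
    (Filter.eventually_all_finset _).2 fun ξ _ => rescaledSphere_exists ξ f
  filter_upwards [h, eventually_ge_atTop 1] with s h hs
  choose! v hv using h
  obtain ⟨u, hu⟩ := rescaledSphere_exists_common hs (rescaledSphere.chain.P n) v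
  exact ⟨u, rescaledSphere.pencil_eq_restr_iff.2 fun ξ hξ => (hu ξ hξ).trans (hv ξ hξ)⟩

theorem rescaledSphere_isPoissonType : rescaledSphere.IsPoissonType := by
  intro f h n
  have hf := rescaledSphere_exists_pencil n f
  have hh := rescaledSphere_exists_pencil n h
  refine ⟨?_, ?_, ?_⟩
  · exact eventually_atTop.1 (hf.and hh)
  · refine rescaledSphere.tendstoUniformly_of_orbits fun ξ hξ => ?_
    rw [← tendstoUniformlyOn_univ]
    refine (tendstoUniformlyOn_univ.2 (rescaledSphere_tendsto_twistedProduct ξ f h)).congr ?_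
    filter_upwards [hf, hh, eventually_ge_atTop 1] with s h1 h2 hs Y _
    exact (rescaledSphere.prod_apply hs h1 h2 hξ Y).symm
  · refine rescaledSphere.tendstoUniformly_of_orbits fun ξ hξ => ?_
    rw [← tendstoUniformlyOn_univ]
    refine (tendstoUniformlyOn_univ.2 (rescaledSphere_tendsto_starComm ξ f h)).congr ?_
    filter_upwards [hf, hh] with s h1 h2 Y _
    exact congrArg (fun c => (s : ℂ) * c) (rescaledSphere.bracket_apply h1 h2 hξ Y).symm

end PoissonType

section NonUniform

open Matrix

open scoped Matrix.Norms.L2Operator in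
theorem norm_irrepLie_le (n : Bool → ℕ) (X : Sl3) : ‖irrepLie n X‖ ≤
    (n true + n false) * (‖slotLie true (X : Mat3)‖ + ‖slotLie false (X : Mat3)‖) := by
  rw [irrepLie_apply]
  refine (norm_compress_le _).trans ?_
  rw [tensLie_apply]
  refine (norm_sum_le _ _).trans ?_
  have h : ∀ k : Idx n, ‖slot k (slotLie k.1 (X : Mat3))‖ ≤
      ‖slotLie true (X : Mat3)‖ + ‖slotLie false (X : Mat3)‖ := by
    rintro ⟨b, k⟩
    refine (norm_slot_le _ _).trans ?_
    cases b
    · exact le_add_of_nonneg_left (norm_nonneg _)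
    · exact le_add_of_nonneg_right (norm_nonneg _)
  refine (Finset.sum_le_card_nsmul _ _ _ fun k _ => h k).trans_eq ?_
  rw [nsmul_eq_mul, Finset.card_univ, Fintype.card_sigma, Fintype.sum_bool]
  simp

theorem trace_irrepLie_entrySl_zero (n : Bool → ℕ) : trace (irrepLie n (entrySl (0, 0))) = 0 := by
  have hb : ∀ Y Z : Sl3, trace (irrepLie n ⁅Y, Z⁆) = 0 := fun Y Z => by
    rw [LieHom.map_lie, Ring.lie_def, Matrix.trace_sub, Matrix.trace_mul_comm, sub_self]
  let E (i j : Fin 3) (h : i ≠ j) : Sl3 := LieAlgebra.SpecialLinear.single i j h (1 : ℂ)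
  have e : entrySl (0, 0) = (1 / 3 : ℂ) • (⁅E 0 1 (by decide), E 1 0 (by decide)⁆ +
      ⁅E 0 2 (by decide), E 2 0 (by decide)⁆) := by
    refine Subtype.ext ?_
    change Matrix.single 0 0 1 - (trace (Matrix.single 0 0 (1 : ℂ)) / 3) • (1 : Mat3) =
      (1 / 3 : ℂ) • ((Matrix.single 0 1 1 * Matrix.single 1 0 1 -
        Matrix.single 1 0 1 * Matrix.single 0 1 1) +
      (Matrix.single 0 2 1 * Matrix.single 2 0 1 - Matrix.single 2 0 1 * Matrix.single 0 2 1))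
    ext i j
    fin_cases i <;> fin_cases j <;> simp <;> norm_num
  rw [e, map_smul, map_add, Matrix.trace_smul, Matrix.trace_add, hb, hb, add_zero, smul_zero]

theorem unscale_of_trace_eq_zero {n : Bool → ℕ} {A : IrrepOp n} (h : trace A = 0) (κ : ℝ) :
    unscale κ A = (1 + κ : ℂ)⁻¹ • A := by
  rw [unscale, h]
  simp

variable {m : Bool → ℕ} {r : ℝ}

/-- The operator with Berezin symbol the upper left matrix entry. -/
def entryOp (m : Bool → ℕ) (r : ℝ) (s : ℕ) : IrrepOp (scaled s m) :=
  (Complex.I / (s * r)) • irrepLie (scaled s m) (entrySl (0, 0))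

theorem trace_entryOp (s : ℕ) : trace (entryOp m r s) = 0 := by
  rw [entryOp, Matrix.trace_smul, trace_irrepLie_entrySl_zero, smul_zero]

theorem rescaled_entryOp (hr : 0 < r) {s : ℕ} (hs : 1 ≤ s) :
    rescaled (scaled s m) (coords m r) (r / s) (unscale (r / s) (entryOp m r s)) =
      restr _ (MvPolynomial.X (0, 0)) := by
  rw [rescaled_unscale (compatible_scaled hr s) (by positivity), restr_X]
  funext Y
  have h0 : (s : ℂ) ≠ 0 := by exact_mod_cast (by omega : s ≠ 0)
  have h1 : (r : ℂ) ≠ 0 := by exact_mod_cast hr.ne'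
  change _ = polyFun _ _
  rw [entryOp, map_smul, Pi.smul_apply, berezin_irrepLie hr, polyFun_linPoly, smul_eq_mul]
  field_simp
  rw [Complex.I_sq]
  ring

open scoped Matrix.Norms.L2Operator in
theorem norm_entryOp_le {s : ℕ} (hs : 1 ≤ s) (hr : 0 < r) (hm : (m true + m false : ℝ) ≤ 2 * r) :
    ‖entryOp m r s‖ ≤ 2 * (‖slotLie true (entrySl (0, 0) : Mat3)‖ +
      ‖slotLie false (entrySl (0, 0) : Mat3)‖) := by
  have hs0 : (0 : ℝ) < s := by exact_mod_cast hs
  have h := norm_irrepLie_le (scaled s m) (entrySl (0, 0))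
  set C := ‖slotLie true (entrySl (0, 0) : Mat3)‖ + ‖slotLie false (entrySl (0, 0) : Mat3)‖
  have hC : 0 ≤ C := by positivity
  rw [entryOp, norm_smul, norm_div, norm_mul, Complex.norm_I, Complex.norm_natCast,
    Complex.norm_real, Real.norm_of_nonneg hr.le, div_mul_eq_mul_div, one_mul,
    div_le_iff₀ (by positivity)]
  refine h.trans ?_
  simp only [scaled, Nat.cast_mul]
  calc ((s : ℝ) * m true + s * m false) * C = s * C * (m true + m false) := by ring
    _ ≤ s * C * (2 * r) := mul_le_mul_of_nonneg_left hm (by positivity)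
    _ = 2 * C * (s * r) := by ring

open scoped Matrix.Norms.L2Operator in
theorem norm_twistedProduct_entry_le (hr : 0 < r) {s : ℕ} (hs : 1 ≤ s)
    (hm : (m true + m false : ℝ) ≤ 2 * r) (Y : orbit (chamberPt (coords m r))) :
    ‖twistedProduct (raySymbol m r s) (restr _ (MvPolynomial.X (0, 0)))
      (restr _ (MvPolynomial.X (0, 0))) Y‖ ≤
      2 * (2 * (‖slotLie true (entrySl (0, 0) : Mat3)‖ +
        ‖slotLie false (entrySl (0, 0) : Mat3)‖)) ^ 2 / (1 + r / s) := by
  have hA := norm_entryOp_le hs hr hm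
  set C := 2 * (‖slotLie true (entrySl (0, 0) : Mat3)‖ + ‖slotLie false (entrySl (0, 0) : Mat3)‖)
  set κ : ℝ := r / s with hκ
  have h0 : 0 ≤ κ := by positivity
  have hc := compatible_scaled (m := m) hr s
  rw [← rescaled_entryOp hr hs, univSymbol_twistedProduct hc h0,
    unscale_of_trace_eq_zero (trace_entryOp s), smul_mul_smul_comm]
  set B := entryOp m r s * entryOp m r s with hB
  have hBn : ‖B‖ ≤ C ^ 2 := by
    rw [sq]
    exact (norm_mul_le _ _).trans (mul_le_mul hA hA (norm_nonneg _) ((norm_nonneg _).trans hA))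
  have hk : ((1 + κ : ℝ) : ℂ) = 1 + κ := by push_cast; rfl
  rw [map_smul, Pi.smul_apply, norm_smul, norm_mul, norm_inv, ← hk, Complex.norm_real,
    Real.norm_of_nonneg (by positivity)]
  have h1 : ‖rescaled (scaled s m) (coords m r) κ B Y‖ ≤ (1 + κ) * ‖B‖ + κ * ‖B‖ := by
    rw [rescaled_apply]
    refine (norm_sub_le _ _).trans ?_
    rw [norm_mul, norm_mul, ← hk, Complex.norm_real, Complex.norm_real,
      Real.norm_of_nonneg (by positivity), Real.norm_of_nonneg h0]
    exact add_le_add (mul_le_mul_of_nonneg_left (norm_berezin_le hc _ _) (by positivity))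
      (mul_le_mul_of_nonneg_left (norm_trace_div_le hc _) h0)
  have h2 : ‖rescaled (scaled s m) (coords m r) κ B Y‖ ≤ 2 * (1 + κ) * C ^ 2 := by
    nlinarith [norm_nonneg B]
  have hk0 : 0 < 1 + κ := by positivity
  calc _ ≤ (1 + κ)⁻¹ * (1 + κ)⁻¹ * (2 * (1 + κ) * C ^ 2) :=
        mul_le_mul_of_nonneg_left h2 (by positivity)
    _ = 2 * C ^ 2 / (1 + κ) := by field_simp

theorem label_le_intRadius (ξ : Qbar) : (label ξ true + label ξ false : ℝ) ≤ 2 * intRadius ξ := by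
  have h := intRadius_sq ξ
  rw [sqNorm] at h
  push_cast at h
  have h0 := intRadius_pos ξ
  refine le_of_sq_le_sq ?_ (by positivity)
  nlinarith [sq_nonneg ((label ξ true : ℝ) - label ξ false), sq_nonneg ((label ξ true : ℝ)),
    sq_nonneg ((label ξ false : ℝ))]

theorem norm_entry_sq_ge (ξ : Qbar) :
    1 / 6 ≤ ‖polyFun (MvPolynomial.X (0, 0) * MvPolynomial.X (0, 0)) (ξ : Mat3)‖ := by
  obtain ⟨a, b, ha, hb, hab, h⟩ := mem_Fbar_iff.1 ξ.2.1
  rw [h, polyFun_mul, polyFun_X]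
  have e : weight a b 0 0 = Complex.I / 3 * ((2 * a + b : ℝ) : ℂ) := by
    simp [weight]
  have hn : ‖weight a b 0 0‖ = (2 * a + b) / 3 := by
    rw [e, norm_mul, norm_div, Complex.norm_I, Complex.norm_real, Real.norm_of_nonneg (by positivity)]
    norm_num
    ring
  rw [norm_mul]
  change _ ≤ ‖weight a b 0 0‖ * ‖weight a b 0 0‖
  rw [hn]
  nlinarith [mul_nonneg ha hb, sq_nonneg a]

open scoped Matrix.Norms.L2Operator in
theorem rescaledSphere_not_isUniformPoissonOn (ξ : Qbar) {V : Set Qbar} (hV : V ∈ 𝓝 ξ) :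
    ¬ rescaledSphere.IsUniformPoissonOn V := by
  intro hU
  let f : Poly := MvPolynomial.X (0, 0)
  have hex : ∀ s ≥ 1, ∀ ξ : Qbar, ∃ u, rescaledSphere.w ξ s u = restr (orbit (ξ : Mat3)) f := by
    intro s hs ξ
    have key : ∀ {ξ' : Mat3}, ξ' = chamberPt (coords (label ξ) (intRadius ξ)) →
        ∃ u, univSymbol ξ' (scaled s (label ξ)) (coords (label ξ) (intRadius ξ))
          (intRadius ξ / s) u = restr (orbit ξ') f := by
      rintro _ rfl
      obtain ⟨u, hu⟩ := irrepRep_surjective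
        (unscale (intRadius ξ / s) (entryOp (label ξ) (intRadius ξ) s))
      exact ⟨u, by rw [univSymbol_chamberPt, hu, rescaled_entryOp (intRadius_pos ξ) hs]⟩
    exact key (coe_eq_chamberPt ξ)
  obtain ⟨h1, -⟩ := hU f f 1 fun s hs ξ => ⟨hex s hs ξ, hex s hs ξ⟩
  obtain ⟨C, hC0, hC⟩ : ∃ C : ℝ, 0 ≤ C ∧ ∀ (s : ℕ), 1 ≤ s → ∀ (ξ : Qbar) (Y : orbit (ξ : Mat3)),
      ‖twistedProduct (rescaledSphere.w ξ s) (restr (orbit (ξ : Mat3)) f)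
        (restr (orbit (ξ : Mat3)) f) Y‖ ≤ C / (1 + intRadius ξ / s) := by
    refine ⟨2 * (2 * (‖slotLie true (entrySl (0, 0) : Mat3)‖ +
      ‖slotLie false (entrySl (0, 0) : Mat3)‖)) ^ 2, by positivity, fun s hs ξ => ?_⟩
    · have key : ∀ {ξ' : Mat3}, ξ' = chamberPt (coords (label ξ) (intRadius ξ)) →
          ∀ Y : orbit ξ', ‖twistedProduct (univSymbol ξ' (scaled s (label ξ))
            (coords (label ξ) (intRadius ξ)) (intRadius ξ / s)) (restr (orbit ξ') f)
            (restr (orbit ξ') f) Y‖ ≤ 2 * (2 * (‖slotLie true (entrySl (0, 0) : Mat3)‖ +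
              ‖slotLie false (entrySl (0, 0) : Mat3)‖)) ^ 2 / (1 + intRadius ξ / s) := by
        rintro _ rfl
        exact norm_twistedProduct_entry_le (intRadius_pos ξ) hs (label_le_intRadius ξ)
      exact key (coe_eq_chamberPt ξ)
  obtain ⟨s, hs, hs1⟩ := ((Metric.tendstoUniformlyOn_iff.1 h1 (1 / 12) (by norm_num)).and
    (eventually_ge_atTop 1)).exists
  have hs0 : (0 : ℝ) < s := by exact_mod_cast hs1
  obtain ⟨K, hK⟩ := exists_nat_ge (3 / 2 * (12 * C * s) ^ 2)
  obtain ⟨ξ', hξ', hK'⟩ := exists_sqNorm_gt ξ hV K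
  have hr := intRadius_pos ξ'
  have hr2 : 12 * C * s < intRadius ξ' := by
    have h2 := intRadius_sq ξ'
    have h3 : (K : ℝ) < sqNorm (label ξ') := by exact_mod_cast hK'
    refine lt_of_pow_lt_pow_left₀ 2 hr.le ?_
    linarith
  let Y : orbit (ξ' : Mat3) := ⟨ξ', 1, by simp [Ad]⟩
  have h4 := hs ⟨ξ', Y⟩ hξ'
  have h5 := hC s hs1 ξ' Y
  have h6 : 1 / 6 ≤ ‖restr (orbit (ξ' : Mat3)) (f * f) Y‖ := norm_entry_sq_ge ξ'
  have h7 : C / (1 + intRadius ξ' / s) ≤ 1 / 12 := by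
    have h8 : 12 * C < intRadius ξ' / s := by rwa [lt_div_iff₀ hs0]
    rw [div_le_iff₀ (by positivity)]
    linarith
  rw [dist_eq_norm] at h4
  have h8 := norm_sub_norm_le (restr (orbit (ξ' : Mat3)) (f * f) Y)
    (twistedProduct (rescaledSphere.w ξ' s) (restr (orbit (ξ' : Mat3)) f)
        (restr (orbit (ξ' : Mat3)) f) Y)
  have h9 : ‖restr (orbit (ξ' : Mat3)) (f * f) Y - twistedProduct (rescaledSphere.w ξ' s)
    (restr (orbit (ξ' : Mat3)) f) (restr (orbit (ξ' : Mat3)) f) Y‖ < 1 / 12 := h4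
  linarith

end NonUniform

end

end Magoo

theorem proposition4p23 :
    ∃ M : Magoo.MagooSphere, M.chain.IsRadial ∧ M.IsRescaledBerezin ∧ M.IsPoissonType ∧
      ∀ ξ : Magoo.Qbar, ∀ V ∈ nhds ξ, ¬ M.IsUniformPoissonOn V :=
  ⟨Magoo.rescaledSphere, Magoo.radialChain_isRadial, Magoo.rescaledSphere_isRescaledBerezin,
    Magoo.rescaledSphere_isPoissonType,
    fun ξ _ hV => Magoo.rescaledSphere_not_isUniformPoissonOn ξ hV⟩
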